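/- Let $\Lambda<0$, $r_h>0$ and $N(r)=1-\frac{2m(r)}{r}-\frac{\Lambda r^2}{3}$, $'=d/dr$. An *asymptotically AdS $\mathfrak{su}(2)$ Einstein–Yang–Mills black hole* with parameters $(\Lambda,r_h)$ is a triple $(m,S,\omega)$ of $C^2$ functions on $[r_h,\infty)$ with $S>0$, solving for $r>r_h$ $$m'=N\omega'^2+\frac{(\omega^2-1)^2}{2r^2},\qquad \frac{S'}{S}=\frac{2\omega'^2}{r},\qquad r^2N\omega''+\Big(2m-\frac{2\Lambda r^3}{3}-\frac{(\omega^2-1)^2}{r}\Big)\omega'+(1-\omega^2)\omega=0,$$ with $N(r_h)=0$, $N'(r_h)>0$, $N>0$ on $(r_h,\infty)$, and such that, as $r\to\infty$, $m\to M$ for some finite $M$, $S\to1$ and $\omega\to\omega_\infty$ for some finite $\omega_\infty$. The metric is $-NS^2dt^2+N^{-1}dr^2+r^2(d\theta^2+\sin^2\theta\,d\phi^2)$. Put $\omega_h=\omega(r_h)$ and $\frac{d}{dr^*}=NS\frac{d}{dr}$ (then $r^*\to-\infty$ as $r\to r_h$, and $r^*$ has a finite limit as $r\to\infty$). The sphaleronic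 and the gravitational potentials are $$V=\frac{NS^2}{r^2}(1+\omega^2)+\frac{2}{\omega^2}\Big(\frac{d\omega}{dr^*}\Big)^2,$$ $$U=\frac{NS^2}{r^2}\Big\{3\omega^2-1-4r\omega'^2\Big[\frac1r-\Lambda r-\frac{(1-\omega^2)^2}{r^3}\Big]+\frac8r\,\omega\omega'(\omega^2-1)\Big\}.$$ A *bound state* of $\sigma^2\beta=-\frac{d^2\beta}{dr^{*2}}+W\beta$ (with $W=V$ or $W=U$, $\sigma^2\in\mathbb R$) is a not identically zero complex $C^2$ solution $\beta$ on $r>r_h$ with $\int|\beta|^2dr^*<\infty$ and with $\beta\to0$ or $d\beta/dr^*\to0$ as $r\to\infty$. A *sphaleronic mode* with frequency $\sigma\in\mathbb C$ is a pair $e^{i\sigma t}(\delta b(r),\delta\nu(r))$, $\delta b\in C^1$, $\delta\nu\in C^2$, solving for $r>r_h$ (dot denoting $d/dt$) $$0=\ddot{\delta b}+\tfrac{2NS^2}{r^2}\left[\omega(\delta\nu'+\omega\,\delta b)-\omega'\delta\nu\right],$$ $$0=\ddot{\delta\nu}-NS(NS)'\left[\delta\nu'+\omega\,\delta b\right]-N^2S^2\left[\delta\nu''+\omega\,\delta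 b'+2\omega'\delta b\right]+\tfrac{NS^2}{r^2}(\omega^2-1)\delta\nu,$$ $$0=\Big(\tfrac{2}{rS^2}-\tfrac{S'}{S^3}\Big)\dot{\delta b}+\tfrac1{S^2}\dot{\delta b}'+\tfrac{2}{r^2NS^2}\,\omega\,\dot{\delta\nu},$$ with $r^2\delta b,\ \delta\nu\in L^2(dr^*)$ and with $\delta\nu\to0$ or $r^2\delta b\to0$ as $r\to\infty$. A *gravitational mode* is a triple $e^{i\sigma t}(\delta\omega(r),\delta m(r),\delta S(r))$, $\delta\omega\in C^2$, $\delta m,\delta S\in C^1$, solving on $r>r_h$ the linearization about $(m,S,\omega)$ of $$\dot m=2N\omega'\dot\omega,\quad m'=N\omega'^2+\frac{\dot\omega^2}{NS^2}+\frac{(\omega^2-1)^2}{2r^2},\quad \frac{S'}{S}=\frac2r\Big(\omega'^2+\frac{\dot\omega^2}{N^2S^2}\Big),\quad (NS\omega')'=\partial_t\Big(\frac{\dot\omega}{NS}\Big)+\frac{S\omega(\omega^2-1)}{r^2},$$ with $\delta\omega,\ d\delta\omega/dr^*\in L^2(dr^*)$, with $\delta S\to0$, and with $\delta\omega\to0$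 or $d\delta\omega/dr^*\to0$, as $r\to\infty$. The black hole is *stable in a sector* if every mode of that sector with $\operatorname{Im}\sigma<0$ vanishes identically, and *linearly stable* (under spherically symmetric perturbations) if it is stable in both sectors. **(A)** Let $(m,S,\omega)$ be such a black hole with $\omega(r)\ne0$ for all $r\ge r_h$. Then $V$ is positive and continuous on $(r_h,\infty)$ and $V\to0$ as $r\to r_h$. If $\omega_\infty\neq0$, then $a=\lim_{r\to\infty}r(\omega-\omega_\infty)$ exists, $V\to-\frac{\Lambda}{3}(1+\omega_\infty^2)+\frac{2\Lambda^2a^2}{9\omega_\infty^2}$ as $r\to\infty$, and the black hole is stable in the sphaleronic sector. In all cases the Schrödinger equation with potential $V$ has no bound state with $\sigma^2<0$. **(B)** Fix $r_h>0$ and $\omega_h>1/\sqrt3$. Then $\sqrt{|\Lambda|}\,\sup_{r\ge r_h}|\omega'(r)|\to0$ as $\Lambda\to-\infty$, uniformly over all black holes with these $r_h$, $\omega_h$. Moreover there is $L>0$ (depending on $r_h,\omega_h$) such that for every $\Lambda<-L$ a black hole with parameters $(\Lambda,r_h)$ and $\omega(r_h)=\omega_h$ exists, and every such black hole satisfies: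 $\omega>1/\sqrt3$ on $[r_h,\infty)$ (so it is nodeless) and $\omega_\infty>1/\sqrt3$; $U>0$ on $(r_h,\infty)$, $U\to0$ as $r\to r_h$ and $U\to-\frac\Lambda3(3\omega_\infty^2-1)$ as $r\to\infty$; neither the equation with potential $V$ nor that with potential $U$ has a bound state with $\sigma^2<0$; and the black hole is linearly stable. -/

import Mathlib

open Set Filter Topology MeasureTheory

noncomputable section

/-- The data of a static, spherically symmetric, purely magnetic `su(2)` Einstein-Yang-Mills
configuration: cosmological constant `Λ`, horizon radius `rh`, and the radial functions
`m` (mass function), `S` (lapse function) and `ω` (gauge field), all used on `[rh, ∞)` only.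
The metric is `-N S² dt² + N⁻¹ dr² + r² (dθ² + sin² θ dφ²)`, with `N` as defined below. -/
structure StaticEYM where
  Λ : ℝ
  rh : ℝ
  m : ℝ → ℝ
  S : ℝ → ℝ
  ω : ℝ → ℝ

namespace StaticEYM

/-- The metric function `N = 1 - 2 m / r - Λ r² / 3`. -/
def N (B : StaticEYM) (r : ℝ) : ℝ := 1 - 2 * B.m r / r - B.Λ * r ^ 2 / 3

/-- `B` is a regular, asymptotically anti-de Sitter black hole solution of the static
Einstein-Yang-Mills equations with `Λ < 0`, whose gauge field tends to `ωinf` at infinity. -/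
structure IsAdSBlackHole (B : StaticEYM) (ωinf : ℝ) : Prop where
  cosmological_neg : B.Λ < 0
  radius_pos : 0 < B.rh
  -- the fields are regular up to and including the horizon
  m_regular : ContDiffOn ℝ 2 B.m (Ici B.rh)
  S_regular : ContDiffOn ℝ 2 B.S (Ici B.rh)
  ω_regular : ContDiffOn ℝ 2 B.ω (Ici B.rh)
  S_pos : ∀ r, B.rh ≤ r → 0 < B.S r
  -- there is a regular event horizon at `rh`, and no further horizon outside it
  horizon : B.N B.rh = 0
  horizon_regular : 0 < derivWithin B.N (Ici B.rh) B.rh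
  exterior : ∀ r, B.rh < r → 0 < B.N r
  -- the field equations
  m_eq : ∀ r, B.rh < r →
    deriv B.m r = B.N r * deriv B.ω r ^ 2 + (B.ω r ^ 2 - 1) ^ 2 / (2 * r ^ 2)
  S_eq : ∀ r, B.rh < r → deriv B.S r / B.S r = 2 * deriv B.ω r ^ 2 / r
  ω_eq : ∀ r, B.rh < r →
    0 = r ^ 2 * B.N r * deriv (deriv B.ω) r
      + (2 * B.m r - 2 * B.Λ * r ^ 3 / 3 - (B.ω r ^ 2 - 1) ^ 2 / r) * deriv B.ω r
      + (1 - B.ω r ^ 2) * B.ω r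
  -- the geometry approaches anti-de Sitter space at infinity
  m_lim : ∃ M : ℝ, Tendsto B.m atTop (𝓝 M)
  S_lim : Tendsto B.S atTop (𝓝 1)
  ω_lim : Tendsto B.ω atTop (𝓝 ωinf)

/-- The gauge field has no nodes. -/
def Nodeless (B : StaticEYM) : Prop := ∀ r, B.rh ≤ r → B.ω r ≠ 0

/-- The derivative `d/dr* = N S d/dr` with respect to the tortoise coordinate `r*`, which is
given by `dr*/dr = 1 / (N S)`. Functions of `r*` are written as functions of `r`. -/
def dStar {E : Type*} [NormedAddCommGroup E] [NormedSpace ℝ E]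
    (B : StaticEYM) (f : ℝ → E) (r : ℝ) : E :=
  (B.N r * B.S r) • deriv f r

/-- `f` is square integrable over the exterior with respect to `dr* = dr / (N S)`. -/
def SquareIntegrable (B : StaticEYM) (f : ℝ → ℂ) : Prop :=
  IntegrableOn (fun r => ‖f r‖ ^ 2 / (B.N r * B.S r)) (Ioi B.rh)

/-- The potential of the sphaleronic sector. -/
def sphaleronicPotential (B : StaticEYM) (r : ℝ) : ℝ :=
  B.N r * B.S r ^ 2 / r ^ 2 * (1 + B.ω r ^ 2) + 2 / B.ω r ^ 2 * B.dStar B.ω r ^ 2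

/-- The potential `U` of the gravitational sector. -/
def gravitationalPotential (B : StaticEYM) (r : ℝ) : ℝ :=
  B.N r * B.S r ^ 2 / r ^ 2 *
    (3 * B.ω r ^ 2 - 1
      - 4 * r * deriv B.ω r ^ 2 * (1 / r - B.Λ * r - (1 - B.ω r ^ 2) ^ 2 / r ^ 3)
      + 8 / r * B.ω r * deriv B.ω r * (B.ω r ^ 2 - 1))

/-- `β` is a bound state of the Schrödinger equation `σ² β = - d²β/dr*² + V β` on the exterior
region, with `σ² = E`. The range of `r*` is a half line `(-∞, R)`, the finite endpoint `R`
corresponding to `r = ∞`; there `β` obeys the Dirichlet or the Neumann boundary condition. -/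
structure IsBoundState (B : StaticEYM) (V : ℝ → ℝ) (E : ℝ) (β : ℝ → ℂ) : Prop where
  smooth : ContDiffOn ℝ 2 β (Ioi B.rh)
  nontrivial : ∃ r, B.rh < r ∧ β r ≠ 0
  schrodinger : ∀ r, B.rh < r → (E : ℂ) * β r = -B.dStar (B.dStar β) r + (V r : ℂ) * β r
  normalizable : B.SquareIntegrable β
  boundary : Tendsto β atTop (𝓝 0) ∨ Tendsto (B.dStar β) atTop (𝓝 0)

/-- `e^{iσt} (δb, δν)` is a mode of the sphaleronic sector: the amplitudes solve the two linearized
Yang-Mills equations and the linearized Gauss constraint, have finite norm, and satisfy one of the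
two reflecting boundary conditions `δν → 0`, `r² δb → 0` at infinity. -/
structure IsSphaleronicMode (B : StaticEYM) (σ : ℂ) (δb δν : ℝ → ℂ) : Prop where
  b_smooth : ContDiffOn ℝ 1 δb (Ioi B.rh)
  ν_smooth : ContDiffOn ℝ 2 δν (Ioi B.rh)
  b_eq : ∀ r, B.rh < r →
    0 = -σ ^ 2 * δb r + ((2 * B.N r * B.S r ^ 2 / r ^ 2 : ℝ) : ℂ) *
      ((B.ω r : ℂ) * (deriv δν r + (B.ω r : ℂ) * δb r) - ((deriv B.ω r : ℝ) : ℂ) * δν r)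
  ν_eq : ∀ r, B.rh < r →
    0 = -σ ^ 2 * δν r
      - ((B.N r * B.S r * deriv (fun s => B.N s * B.S s) r : ℝ) : ℂ) *
          (deriv δν r + (B.ω r : ℂ) * δb r)
      - ((B.N r ^ 2 * B.S r ^ 2 : ℝ) : ℂ) *
          (deriv (deriv δν) r + (B.ω r : ℂ) * deriv δb r + 2 * ((deriv B.ω r : ℝ) : ℂ) * δb r)
      + ((B.N r * B.S r ^ 2 / r ^ 2 * (B.ω r ^ 2 - 1) : ℝ) : ℂ) * δν r
  gauss : ∀ r, B.rh < r →
    0 = (Complex.I * σ) *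
      (((2 / (r * B.S r ^ 2) - deriv B.S r / B.S r ^ 3 : ℝ) : ℂ) * δb r
        + ((1 / B.S r ^ 2 : ℝ) : ℂ) * deriv δb r
        + ((2 / (r ^ 2 * B.N r * B.S r ^ 2) * B.ω r : ℝ) : ℂ) * δν r)
  b_normalizable : B.SquareIntegrable (fun r => (r : ℂ) ^ 2 * δb r)
  ν_normalizable : B.SquareIntegrable δν
  boundary : Tendsto δν atTop (𝓝 0) ∨ Tendsto (fun r : ℝ => (r : ℂ) ^ 2 * δb r) atTop (𝓝 0)

/-- `e^{iσt} (δω, δm, δS)` is a mode of the gravitational sector: the amplitudes solve the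
linearization, about the static solution, of the time-dependent equations
`∂ₜ m = 2 N ω' ∂ₜ ω`,
`m' = N ω'² + (∂ₜ ω)² / (N S²) + (ω² - 1)² / (2 r²)`,
`S' / S = (2 / r) (ω'² + (∂ₜ ω)² / (N S)²)`,
`(N S ω')' = ∂ₜ (∂ₜ ω / (N S)) + S ω (ω² - 1) / r²`,
(so that `δN = - 2 δm / r`), they have finite norm, `δS` respects the normalization `S → 1` at
infinity, and `δω` obeys the Dirichlet or the Neumann boundary condition at infinity. -/
structure IsGravitationalMode (B : StaticEYM) (σ : ℂ) (δω δm δS : ℝ → ℂ) : Prop where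
  ω_smooth : ContDiffOn ℝ 2 δω (Ioi B.rh)
  m_smooth : ContDiffOn ℝ 1 δm (Ioi B.rh)
  S_smooth : ContDiffOn ℝ 1 δS (Ioi B.rh)
  momentum_eq : ∀ r, B.rh < r →
    (Complex.I * σ) * δm r
      = ((2 * B.N r * deriv B.ω r : ℝ) : ℂ) * ((Complex.I * σ) * δω r)
  m_eq : ∀ r, B.rh < r →
    deriv δm r = ((deriv B.ω r : ℝ) : ℂ) ^ 2 * (-2 * δm r / (r : ℂ))
      + ((2 * B.N r * deriv B.ω r : ℝ) : ℂ) * deriv δω r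
      + ((2 * B.ω r * (B.ω r ^ 2 - 1) / r ^ 2 : ℝ) : ℂ) * δω r
  S_eq : ∀ r, B.rh < r →
    deriv (fun s => δS s / (B.S s : ℂ)) r = ((4 * deriv B.ω r / r : ℝ) : ℂ) * deriv δω r
  ω_eq : ∀ r, B.rh < r →
    deriv (fun s => ((B.N s * B.S s : ℝ) : ℂ) * deriv δω s
        + ((B.S s : ℂ) * (-2 * δm s / (s : ℂ)) + (B.N s : ℂ) * δS s) * ((deriv B.ω s : ℝ) : ℂ)) r
      = -σ ^ 2 * δω r / ((B.N r * B.S r : ℝ) : ℂ)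
        + (((B.ω r ^ 2 - 1) * B.ω r : ℝ) : ℂ) * δS r / (r : ℂ) ^ 2
        + ((B.S r * (3 * B.ω r ^ 2 - 1) / r ^ 2 : ℝ) : ℂ) * δω r
  ω_normalizable : B.SquareIntegrable δω
  dω_normalizable : B.SquareIntegrable (B.dStar δω)
  S_boundary : Tendsto δS atTop (𝓝 0)
  boundary : Tendsto δω atTop (𝓝 0) ∨ Tendsto (B.dStar δω) atTop (𝓝 0)

/-- There is no nonzero growing mode (`|e^{iσt}| → ∞` as `t → ∞`) in the sphaleronic sector. -/
def SphaleronicallyStable (B : StaticEYM) : Prop :=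
  ∀ (σ : ℂ) (δb δν : ℝ → ℂ), σ.im < 0 → B.IsSphaleronicMode σ δb δν →
    ∀ r, B.rh < r → δb r = 0 ∧ δν r = 0

/-- There is no nonzero growing mode in the gravitational sector. -/
def GravitationallyStable (B : StaticEYM) : Prop :=
  ∀ (σ : ℂ) (δω δm δS : ℝ → ℂ), σ.im < 0 → B.IsGravitationalMode σ δω δm δS →
    ∀ r, B.rh < r → δω r = 0 ∧ δm r = 0 ∧ δS r = 0

/-- Linear stability under spherically symmetric perturbations: no growing modes in either of the
two sectors into which the linearized equations decouple. -/
def LinearlyStable (B : StaticEYM) : Prop :=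
  B.SphaleronicallyStable ∧ B.GravitationallyStable

end StaticEYM

end

/-! Stability rests on a flux argument. In each sector the growing modes satisfy a first-order
system dX/dr* = wY, dY/dr* = (Q - σ²/w)X with w > 0 and Q ≥ 0. If Im σ < 0 then σ² is not a
nonnegative real, so some constant c puts both c and -cσ² in the right half plane, and Re(c X̄ Y) is
nondecreasing. Since r* runs to -∞ at the horizon, integrability forces this flux to be nonnegative;
since r* is finite at infinity, a reflecting boundary condition makes it tend to zero there. Hence
it vanishes, and X with it (`IsTortoiseFactor.sturmLiouville_eq_zero`). Bound states of negative
energy are excluded similarly (`IsTortoiseFactor.boundState_eq_zero`), with a separate argument at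
the horizon because dβ/dr* is not assumed square integrable.

In the sphaleronic sector, w = ω² and Q = 2NS²/r², so nodelessness is what is needed. In the
gravitational sector the constraints eliminate δm and δS, leaving w = 1 and Q = U, so the question
becomes whether U > 0.

For large |Λ|, the flux equation (NSω')' = Sω(ω² - 1)/r² and the growth of N give |ω'| = O(|Λ|⁻¹
r⁻²) as long as ω stays near ω_h. Integrating, ω never leaves that neighbourhood
(`abs_ω_sub_le_and_abs_deriv_ω_le`). Then U is governed by 3ω² - 1 > 0, since the dangerous term
|Λ|ω'² is O(|Λ|⁻¹).

Existence is a contraction argument for w = r²ω'. Integrating the equations for NSω' and rNS from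
the horizon, where both vanish, gives ω' as r times a quotient of integrals. Replacing integrals by
mean values removes the 0/0 at the horizon. For large |Λ| the resulting map is a contraction of the
bounded continuous functions (`eventually_exists_profileMap_eq`); its fixed point has |w| ≤ 1, so
the truncation in `profileDeriv` is inactive there. -/

/-! ### Calculus on half lines. -/

/-- A function whose derivative is `O(r⁻²)` converges at infinity. -/
theorem exists_tendsto_atTop_of_norm_deriv_le {E : Type*} [NormedAddCommGroup E]
    [NormedSpace ℝ E] [CompleteSpace E] [SecondCountableTopology E] {f f' : ℝ → E} {C a : ℝ}
    (ha : 0 < a) (hf : ∀ r, a < r → HasDerivAt f (f' r) r)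
    (hb : ∀ r, a < r → ‖f' r‖ ≤ C / r ^ 2) : ∃ l, Tendsto f atTop (𝓝 l) := by
  have hi : IntegrableOn (deriv f) (Ioi a) := by
    have h1 : IntegrableOn (fun r : ℝ => C * r ^ (-2 : ℝ)) (Ioi a) :=
      (integrableOn_Ioi_rpow_of_lt (by norm_num) ha).const_mul C
    refine Integrable.mono' h1 (stronglyMeasurable_deriv f).aestronglyMeasurable ?_
    refine ae_restrict_of_forall_mem measurableSet_Ioi fun r hr => ?_
    have hr0 : 0 < r := ha.trans hr
    rw [(hf r hr).deriv, Real.rpow_neg hr0.le, ← div_eq_mul_inv]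
    exact_mod_cast hb r hr
  exact ⟨_, tendsto_limUnder_of_hasDerivAt_of_integrableOn_Ioi
    (fun r hr => by rw [(hf r hr).deriv]; exact hf r hr) hi⟩

theorem monotoneOn_Ioi_of_hasDerivAt_nonneg {f f' : ℝ → ℝ} {a : ℝ}
    (hf : ∀ r, a < r → HasDerivAt f (f' r) r) (h0 : ∀ r, a < r → 0 ≤ f' r) :
    MonotoneOn f (Ioi a) := by
  refine monotoneOn_of_deriv_nonneg (convex_Ioi a)
    (fun r hr => (hf r hr).continuousAt.continuousWithinAt) ?_ ?_
  · rw [interior_Ioi]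
    exact fun r hr => (hf r hr).differentiableAt.differentiableWithinAt
  · rw [interior_Ioi]
    intro r hr
    rw [(hf r hr).deriv]
    exact h0 r hr

/-- A function that vanishes at the left end of an interval and has nonnegative derivative is
nonnegative. -/
theorem nonneg_of_tendsto_zero_of_deriv_nonneg {f f' : ℝ → ℝ} {a b : ℝ}
    (hl : Tendsto f (𝓝[>] a) (𝓝 0)) (hf : ∀ r ∈ Ioc a b, HasDerivAt f (f' r) r)
    (h0 : ∀ r ∈ Ioc a b, 0 ≤ f' r) : ∀ r ∈ Ioc a b, 0 ≤ f r := by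
  have hm : MonotoneOn f (Ioc a b) := by
    refine monotoneOn_of_deriv_nonneg (convex_Ioc a b)
      (fun r hr => (hf r hr).continuousAt.continuousWithinAt) ?_ ?_
    · exact fun r hr => (hf r (interior_subset hr)).differentiableAt.differentiableWithinAt
    · intro r hr
      rw [(hf r (interior_subset hr)).deriv]
      exact h0 r (interior_subset hr)
  intro r hr
  refine le_of_tendsto hl ?_
  filter_upwards [Ioc_mem_nhdsGT hr.1] with s hs
  exact hm ⟨hs.1, hs.2.trans hr.2⟩ hr hs.2

/-- A continuous function without zeros on `[a, ∞)` and with nonzero limit is bounded away from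
zero. -/
theorem exists_pos_le_abs_of_tendsto {f : ℝ → ℝ} {a l : ℝ} (hf : ContinuousOn f (Ici a))
    (h0 : ∀ r, a ≤ r → f r ≠ 0) (hl : Tendsto f atTop (𝓝 l)) (hl0 : l ≠ 0) :
    ∃ c, 0 < c ∧ ∀ r, a ≤ r → c ≤ |f r| := by
  have h1 : ∀ᶠ r in atTop, |l| / 2 < |f r| :=
    hl.abs.eventually (lt_mem_nhds (by have := abs_pos.2 hl0; linarith))
  obtain ⟨b, hb⟩ := (h1.and (eventually_ge_atTop a)).exists_forall_of_atTop
  have hab : a ≤ b := (hb b le_rfl).2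
  obtain ⟨x, hx, hmin⟩ := isCompact_Icc.exists_isMinOn (nonempty_Icc.2 hab)
    (hf.mono (Icc_subset_Ici_self : Icc a b ⊆ Ici a)).abs
  refine ⟨min (|f x|) (|l| / 2), lt_min (abs_pos.2 (h0 x hx.1))
    (by have := abs_pos.2 hl0; linarith), fun r hr => ?_⟩
  rcases le_total r b with h | h
  · exact (min_le_left _ _).trans (hmin ⟨hr, h⟩)
  · exact (min_le_right _ _).trans (hb r h).1.le

/-- A continuous function on `[a, ∞)` with a limit at infinity is bounded. -/
theorem exists_abs_le_of_tendsto {f : ℝ → ℝ} {a l : ℝ} (hf : ContinuousOn f (Ici a))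
    (hl : Tendsto f atTop (𝓝 l)) : ∃ C, 0 < C ∧ ∀ r, a ≤ r → |f r| ≤ C := by
  obtain ⟨b, hb⟩ := (hl.abs.eventually (gt_mem_nhds (lt_add_one |l|))).exists_forall_of_atTop
  obtain ⟨K, hK⟩ := isCompact_Icc.exists_bound_of_continuousOn
    (hf.mono (Icc_subset_Ici_self : Icc a b ⊆ Ici a))
  refine ⟨max K (|l| + 1), lt_max_of_lt_right (by positivity), fun r hr => ?_⟩
  rcases le_total r b with h | h
  · exact (hK r ⟨hr, h⟩).trans (le_max_left _ _)
  · exact (hb r h).le.trans (le_max_right _ _)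

/-! ### Flux arguments in the tortoise coordinate. -/

/-- `p = dr / dr*` is a conversion factor to a tortoise coordinate whose range is `(-∞, R)` with
`R` finite. -/
structure IsTortoiseFactor (a : ℝ) (p : ℝ → ℝ) : Prop where
  pos_left : 0 < a
  continuousOn : ContinuousOn p (Ioi a)
  pos : ∀ r, a < r → 0 < p r
  not_integrable : ∀ b, a < b → ¬ IntegrableOn (fun r => (p r)⁻¹) (Ioc a b)
  quadratic : ∃ b c, a < b ∧ 0 < c ∧ ∀ r, b < r → c * r ^ 2 ≤ p r

namespace IsTortoiseFactor

variable {a : ℝ} {p : ℝ → ℝ}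

/-- A function bounded below near the left end is not integrable for `dr / p`. -/
theorem false_of_integrableOn (hp : IsTortoiseFactor a p) {g : ℝ → ℝ} {b c : ℝ} (hb : a < b)
    (hc : 0 < c) (hg : IntegrableOn (fun r => g r / p r) (Ioi a))
    (hl : ∀ r ∈ Ioc a b, c ≤ |g r|) : False := by
  refine hp.not_integrable b hb ?_
  have h1 : IntegrableOn (fun r => c⁻¹ * ‖g r / p r‖) (Ioc a b) :=
    ((hg.mono_set Ioc_subset_Ioi_self).norm).const_mul _
  refine Integrable.mono' h1 ?_ (ae_restrict_of_forall_mem measurableSet_Ioc fun r hr => ?_)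
  · refine ContinuousOn.aestronglyMeasurable ?_ measurableSet_Ioc
    exact (hp.continuousOn.mono Ioc_subset_Ioi_self).inv₀ fun r hr => (hp.pos r hr.1).ne'
  · have hpr := hp.pos r hr.1
    rw [Real.norm_of_nonneg (inv_pos.2 hpr).le, norm_div, Real.norm_of_nonneg hpr.le,
      Real.norm_eq_abs, div_eq_mul_inv, ← mul_assoc]
    refine le_mul_of_one_le_left (inv_pos.2 hpr).le ?_
    rw [inv_mul_eq_div, one_le_div hc]
    exact hl r hr

/-- A negative value would persist, at least as negative, all the way to the left end, where the
dr*-length is infinite. -/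
theorem nonneg_of_monotoneOn (hp : IsTortoiseFactor a p) {G : ℝ → ℝ} (hG : MonotoneOn G (Ioi a))
    (hi : IntegrableOn (fun r => G r / p r) (Ioi a)) : ∀ r, a < r → 0 ≤ G r := by
  intro r hr
  by_contra! h
  refine hp.false_of_integrableOn (g := G) (c := -G r) hr (by linarith) hi fun s hs => ?_
  have := hG hs.1 hr hs.2
  exact (by linarith : -G r ≤ -G s).trans (neg_le_abs _)

/-- If `df/dr*` is bounded near infinity, then `f` converges at infinity. -/
theorem exists_tendsto (hp : IsTortoiseFactor a p) {f g : ℝ → ℂ} {C b : ℝ}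
    (hf : ∀ r, a < r → HasDerivAt f (g r / p r) r) (hg : ∀ r, b < r → ‖g r‖ ≤ C) :
    ∃ l, Tendsto f atTop (𝓝 l) := by
  obtain ⟨b', c, hb', hc, hq⟩ := hp.quadratic
  have h0 : 0 < max b b' := lt_max_of_lt_right (hp.pos_left.trans hb')
  refine exists_tendsto_atTop_of_norm_deriv_le (a := max b b') (C := C / c) h0
    (fun r hr => hf r (hb'.trans ((le_max_right _ _).trans_lt hr))) fun r hr => ?_
  have hr0 : 0 < r := h0.trans hr
  have hpr := hp.pos r (hb'.trans ((le_max_right _ _).trans_lt hr))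
  rw [norm_div, Complex.norm_real, Real.norm_of_nonneg hpr.le, div_div]
  have h1 := hg r ((le_max_left _ _).trans_lt hr)
  exact div_le_div₀ ((norm_nonneg _).trans h1) h1 (by positivity)
    (hq r ((le_max_right _ _).trans_lt hr))

end IsTortoiseFactor

/-- The derivative of `Re (c X̄ Y)`. -/
theorem hasDerivAt_re_mul_conj_mul {X Y : ℝ → ℂ} {X' Y' c : ℂ} {r : ℝ} (hX : HasDerivAt X X' r)
    (hY : HasDerivAt Y Y' r) :
    HasDerivAt (fun s => (c * (starRingEnd ℂ (X s) * Y s)).re)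
      (c * (starRingEnd ℂ X' * Y r + starRingEnd ℂ (X r) * Y')).re r := by
  have h1 : HasDerivAt (fun s => starRingEnd ℂ (X s)) (starRingEnd ℂ X') r := by
    simpa using hX.star
  have h2 := (h1.mul hY).const_mul c
  exact (Complex.reCLM.hasFDerivAt.comp_hasDerivAt r h2)

theorem re_mul_conj_mul_le (c x y : ℂ) :
    |(c * (starRingEnd ℂ x * y)).re| ≤ ‖c‖ * (‖x‖ ^ 2 + ‖y‖ ^ 2) := by
  refine (Complex.abs_re_le_norm _).trans ?_
  rw [norm_mul, norm_mul, RCLike.norm_conj]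
  gcongr
  nlinarith [sq_nonneg (‖x‖ - ‖y‖), sq_nonneg ‖x‖, sq_nonneg ‖y‖]

/-- For `λ ∉ [0, ∞)` there is a rotation bringing `1` and `-λ` into the right half plane. -/
theorem exists_re_pos_re_neg_mul_pos {l : ℂ} (hl : ∀ x : ℝ, 0 ≤ x → l ≠ x) :
    ∃ c : ℂ, 0 < c.re ∧ 0 < (-(c * l)).re := by
  have h0 : l ≠ 0 := by simpa using hl 0 le_rfl
  have h1 : l.re < ‖l‖ := by
    refine lt_of_le_of_ne (Complex.re_le_norm l) fun h => ?_
    have h2 := Complex.re_eq_norm.1 h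
    exact hl ‖l‖ (norm_nonneg _) (by
      apply Complex.ext
      · simpa using h
      · have := h2.2
        simpa using this.symm)
  have hn : 0 < ‖l‖ := norm_pos_iff.2 h0
  -- With c = |λ| - λ̄ one gets -cλ = |λ|² - |λ|λ; both real parts are positive multiples of |λ| -
  -- Re λ.
  refine ⟨(‖l‖ : ℂ) - starRingEnd ℂ l, by simpa using h1, ?_⟩
  have h3 : (-(((‖l‖ : ℂ) - starRingEnd ℂ l) * l)) = ((‖l‖ ^ 2 : ℝ) : ℂ) - ‖l‖ * l := by
    have : starRingEnd ℂ l * l = ((‖l‖ ^ 2 : ℝ) : ℂ) := by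
      rw [mul_comm, Complex.mul_conj, Complex.normSq_eq_norm_sq]
    rw [← this]
    ring
  rw [h3]
  simp only [Complex.sub_re, Complex.ofReal_re, Complex.mul_re, Complex.ofReal_im, zero_mul,
    sub_zero]
  nlinarith

namespace IsTortoiseFactor

variable {a : ℝ} {p : ℝ → ℝ}

/-- Uniqueness for the Sturm-Liouville problem `d/dr* (w⁻¹ dX/dr*) = (Q - λ / w) X`, with `Q ≥ 0`
and `λ ∉ [0, ∞)`, in the class of square integrable functions with a reflecting boundary condition
at infinity. -/
theorem sturmLiouville_eq_zero (hp : IsTortoiseFactor a p) {X Y : ℝ → ℂ} {w Q : ℝ → ℝ} {l : ℂ}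
    (hX : ∀ r, a < r → HasDerivAt X (w r * Y r / p r) r)
    (hY : ∀ r, a < r → HasDerivAt Y ((Q r - l / w r) * X r / p r) r)
    (hw : ∀ r, a < r → 0 < w r) (hQ : ∀ r, a < r → 0 ≤ Q r)
    (hl : ∀ x : ℝ, 0 ≤ x → l ≠ x)
    (hwb : ∃ C b, ∀ r, b < r → w r ≤ C) (hQb : ∃ C b, ∀ r, b < r → ‖(Q r - l / w r : ℂ)‖ ≤ C)
    (hXi : IntegrableOn (fun r => ‖X r‖ ^ 2 / p r) (Ioi a))
    (hYi : IntegrableOn (fun r => ‖Y r‖ ^ 2 / p r) (Ioi a))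
    (hbd : Tendsto X atTop (𝓝 0) ∨ Tendsto Y atTop (𝓝 0)) :
    ∀ r, a < r → X r = 0 := by
  obtain ⟨c, hc1, hc2⟩ := exists_re_pos_re_neg_mul_pos hl
  -- The rotated flux. The choice of c makes every term of its derivative nonnegative.
  set G : ℝ → ℝ := fun s => (c * (starRingEnd ℂ (X s) * Y s)).re with hGdef
  have hG : ∀ r, a < r → HasDerivAt G
      ((c.re * (w r * ‖Y r‖ ^ 2 + Q r * ‖X r‖ ^ 2) + (-(c * l)).re * (‖X r‖ ^ 2 / w r)) / p r) r := by
    intro r hr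
    refine (hasDerivAt_re_mul_conj_mul (c := c) (hX r hr) (hY r hr)).congr_deriv ?_
    have hwr : (w r : ℂ) ≠ 0 := by exact_mod_cast (hw r hr).ne'
    have hpr : (p r : ℂ) ≠ 0 := by exact_mod_cast (hp.pos r hr).ne'
    have e1 : starRingEnd ℂ (Y r) * Y r = ((‖Y r‖ ^ 2 : ℝ) : ℂ) := by
      rw [mul_comm, Complex.mul_conj, Complex.normSq_eq_norm_sq]
    have e2 : starRingEnd ℂ (X r) * X r = ((‖X r‖ ^ 2 : ℝ) : ℂ) := by
      rw [mul_comm, Complex.mul_conj, Complex.normSq_eq_norm_sq]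
    have e3 : c * (starRingEnd ℂ (w r * Y r / p r) * Y r
          + starRingEnd ℂ (X r) * ((Q r - l / w r) * X r / p r))
        = ((p r)⁻¹ * (w r * ‖Y r‖ ^ 2 + Q r * ‖X r‖ ^ 2) : ℝ) * c
          + ((p r)⁻¹ * (‖X r‖ ^ 2 / w r) : ℝ) * (-(c * l)) := by
      have : c * (starRingEnd ℂ (w r * Y r / p r) * Y r
          + starRingEnd ℂ (X r) * ((Q r - l / w r) * X r / p r))
          = c * (w r / p r * (starRingEnd ℂ (Y r) * Y r)
          + (Q r - l / w r) / p r * (starRingEnd ℂ (X r) * X r)) := by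
        simp only [map_mul, map_div₀, Complex.conj_ofReal]
        ring
      rw [this, e1, e2]
      push_cast
      ring
    rw [e3, Complex.add_re, Complex.re_ofReal_mul, Complex.re_ofReal_mul]
    ring
  have hG' : ∀ r, a < r → 0 ≤ (c.re * (w r * ‖Y r‖ ^ 2 + Q r * ‖X r‖ ^ 2)
      + (-(c * l)).re * (‖X r‖ ^ 2 / w r)) / p r := by
    intro r hr
    have h1 := hw r hr
    have h2 := hQ r hr
    have h3 := hp.pos r hr
    positivity
  have hmono := monotoneOn_Ioi_of_hasDerivAt_nonneg hG hG'
  have hcont : ContinuousOn G (Ioi a) := fun r hr => (hG r hr).continuousAt.continuousWithinAt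
  have hGi : IntegrableOn (fun r => G r / p r) (Ioi a) := by
    refine Integrable.mono' ((hXi.add hYi).const_mul ‖c‖) ?_
      (ae_restrict_of_forall_mem measurableSet_Ioi fun r hr => ?_)
    · exact (hcont.div hp.continuousOn fun r hr => (hp.pos r hr).ne').aestronglyMeasurable
        measurableSet_Ioi
    · have hpr := hp.pos r hr
      rw [norm_div, Real.norm_of_nonneg hpr.le, Pi.add_apply, ← add_div, ← mul_div_assoc]
      gcongr
      exact re_mul_conj_mul_le _ _ _
  have hnn := hp.nonneg_of_monotoneOn hmono hGi
  -- The boundary condition kills one factor. The r*-derivative of the other is then bounded near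
  -- infinity, so that factor converges because r* is finite there.
  have hprod : Tendsto (fun r => starRingEnd ℂ (X r) * Y r) atTop (𝓝 0) := by
    rcases hbd with h | h
    · obtain ⟨C, b, hC⟩ := hQb
      obtain ⟨b', hb'⟩ := (h.norm.eventually
        (gt_mem_nhds (by simp : ‖(0 : ℂ)‖ < 1))).exists_forall_of_atTop
      obtain ⟨y, hy⟩ := hp.exists_tendsto (C := C * 1) (b := max b b') hY fun r hr => by
        have h1 := hC r ((le_max_left _ _).trans_lt hr)
        rw [norm_mul]
        exact mul_le_mul h1 (hb' r ((le_max_right _ _).trans hr.le)).le (norm_nonneg _)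
          ((norm_nonneg _).trans h1)
      have h0 : Tendsto (fun r => starRingEnd ℂ (X r)) atTop (𝓝 0) := by
        simpa [Function.comp_def] using (Complex.continuous_conj.tendsto _).comp h
      simpa using h0.mul hy
    · obtain ⟨C, b, hC⟩ := hwb
      obtain ⟨b', hb'⟩ := (h.norm.eventually
        (gt_mem_nhds (by simp : ‖(0 : ℂ)‖ < 1))).exists_forall_of_atTop
      obtain ⟨x, hx⟩ := hp.exists_tendsto (C := C * 1) (b := max a (max b b')) hX fun r hr => by
        have h2 := hw r ((le_max_left _ _).trans_lt hr)
        have h1 := hC r (((le_max_left _ _).trans (le_max_right _ _)).trans_lt hr)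
        rw [norm_mul, Complex.norm_real, Real.norm_of_nonneg h2.le]
        exact mul_le_mul h1 (hb' r (((le_max_right _ _).trans (le_max_right _ _)).trans hr.le)).le
          (norm_nonneg _) (h2.le.trans h1)
      have h0 := (Complex.continuous_conj.tendsto _).comp hx
      simpa using h0.mul h
  have hG0 : Tendsto G atTop (𝓝 0) := by
    have := (Complex.continuous_re.tendsto _).comp (hprod.const_mul c)
    simp only [mul_zero, Complex.zero_re] at this
    exact this
  have hnp : ∀ r, a < r → G r ≤ 0 := fun r hr => by
    refine ge_of_tendsto hG0 ?_
    filter_upwards [eventually_ge_atTop r] with s hs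
    exact hmono hr (lt_of_lt_of_le hr hs) hs
  intro r hr
  have hz : HasDerivAt G 0 r := by
    refine (hasDerivAt_const r (0 : ℝ)).congr_of_eventuallyEq ?_
    filter_upwards [Ioi_mem_nhds hr] with s hs
    exact le_antisymm (hnp s hs) (hnn s hs)
  have h := (hG r hr).unique hz
  have h1 := hw r hr
  have h2 := hQ r hr
  have h3 := hp.pos r hr
  have h4 : 0 ≤ c.re * (w r * ‖Y r‖ ^ 2 + Q r * ‖X r‖ ^ 2) := by positivity
  have h5 : 0 ≤ (-(c * l)).re * (‖X r‖ ^ 2 / w r) := by positivity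
  rw [div_eq_zero_iff] at h
  have h6 : (-(c * l)).re * (‖X r‖ ^ 2 / w r) = 0 := by
    rcases h with h | h <;> linarith
  rcases mul_eq_zero.1 h6 with h7 | h7
  · exact absurd h7 hc2.ne'
  · simpa [h1.ne'] using h7

/-- A nonnegative potential has no bound state of negative energy. -/
theorem boundState_eq_zero (hp : IsTortoiseFactor a p) {X Y : ℝ → ℂ} {V : ℝ → ℝ} {E : ℝ}
    (hX : ∀ r, a < r → HasDerivAt X (Y r / p r) r)
    (hY : ∀ r, a < r → HasDerivAt Y ((V r - E) * X r / p r) r)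
    (hV : ∀ r, a < r → 0 ≤ V r) (hE : E < 0)
    (hXi : IntegrableOn (fun r => ‖X r‖ ^ 2 / p r) (Ioi a))
    (hbd : Tendsto X atTop (𝓝 0) ∨ Tendsto Y atTop (𝓝 0)) :
    ∀ r, a < r → X r = 0 := by
  set G : ℝ → ℝ := fun s => (1 * (starRingEnd ℂ (X s) * Y s)).re with hGdef
  have esq : ∀ z : ℂ, starRingEnd ℂ z * z = ((‖z‖ ^ 2 : ℝ) : ℂ) := fun z => by
    rw [mul_comm, Complex.mul_conj, Complex.normSq_eq_norm_sq]
  have hG : ∀ r, a < r → HasDerivAt G ((‖Y r‖ ^ 2 + (V r - E) * ‖X r‖ ^ 2) / p r) r := by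
    intro r hr
    refine (hasDerivAt_re_mul_conj_mul (c := 1) (hX r hr) (hY r hr)).congr_deriv ?_
    have : 1 * (starRingEnd ℂ (Y r / p r) * Y r
          + starRingEnd ℂ (X r) * ((V r - E) * X r / p r))
        = (((‖Y r‖ ^ 2 + (V r - E) * ‖X r‖ ^ 2) / p r : ℝ) : ℂ) := by
      have : 1 * (starRingEnd ℂ (Y r / p r) * Y r
          + starRingEnd ℂ (X r) * ((V r - E) * X r / p r))
          = (starRingEnd ℂ (Y r) * Y r + (V r - E) * (starRingEnd ℂ (X r) * X r)) / p r := by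
        simp only [map_div₀, Complex.conj_ofReal]
        ring
      rw [this, esq, esq]
      push_cast
      ring
    rw [this, Complex.ofReal_re]
  have hf : ∀ r, a < r → HasDerivAt (fun s => ‖X s‖ ^ 2) (2 * G r / p r) r := by
    intro r hr
    have h1 := hasDerivAt_re_mul_conj_mul (c := 1) (hX r hr) (hX r hr)
    have e : (fun s => (1 * (starRingEnd ℂ (X s) * X s)).re) = fun s => ‖X s‖ ^ 2 := by
      funext s
      rw [one_mul, esq, Complex.ofReal_re]
    rw [e] at h1
    refine h1.congr_deriv ?_
    have : (1 * (starRingEnd ℂ (Y r / p r) * X r + starRingEnd ℂ (X r) * (Y r / p r)))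
        = ((p r)⁻¹ : ℝ) * (starRingEnd ℂ (starRingEnd ℂ (X r) * Y r)
          + starRingEnd ℂ (X r) * Y r) := by
      simp only [map_div₀, map_mul, Complex.conj_ofReal, Complex.conj_conj]
      push_cast
      ring
    rw [this, Complex.re_ofReal_mul, Complex.add_re, Complex.conj_re, hGdef]
    simp only [one_mul]
    ring
  have hmono : MonotoneOn G (Ioi a) := by
    refine monotoneOn_Ioi_of_hasDerivAt_nonneg hG fun r hr => ?_
    have h1 : 0 ≤ V r - E := by linarith [hV r hr]
    have h2 := hp.pos r hr
    positivity
  -- Without square integrability of Y the flux need not be integrable. Instead, a negative flux at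
  -- r stays negative to the left, so |X|² decreases up to r and is bounded below by |X(r)|² near
  -- the left end.
  have hnn : ∀ r, a < r → 0 ≤ G r := by
    intro r hr
    by_contra! h
    have hX0 : X r ≠ 0 := by
      intro h0
      simp [hGdef, h0] at h
    refine hp.false_of_integrableOn (g := fun s => ‖X s‖ ^ 2) (c := ‖X r‖ ^ 2) hr (by positivity)
      hXi fun s hs => ?_
    rw [abs_of_nonneg (sq_nonneg _)]
    have hanti : AntitoneOn (fun s => ‖X s‖ ^ 2) (Ioc a r) := by
      refine antitoneOn_of_deriv_nonpos (convex_Ioc a r)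
        (fun t ht => (hf t ht.1).continuousAt.continuousWithinAt)
        (fun t ht => (hf t (interior_subset ht).1).differentiableAt.differentiableWithinAt) ?_
      intro t ht
      have ht' := interior_subset ht
      rw [(hf t ht'.1).deriv]
      have h1 := hmono ht'.1 hr ht'.2
      exact div_nonpos_of_nonpos_of_nonneg (by linarith) (hp.pos t ht'.1).le
    exact hanti hs ⟨hr, le_rfl⟩ hs.2
  intro r hr
  -- Under the Dirichlet condition |X|² is nondecreasing with limit zero. Under the Neumann
  -- condition X converges, so the flux tends to zero and vanishes identically.
  rcases hbd with h | h
  · have hm : MonotoneOn (fun s => ‖X s‖ ^ 2) (Ioi a) :=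
      monotoneOn_Ioi_of_hasDerivAt_nonneg hf fun s hs =>
        div_nonneg (by linarith [hnn s hs]) (hp.pos s hs).le
    have h1 : ‖X r‖ ^ 2 ≤ 0 := by
      have h2 : Tendsto (fun s => ‖X s‖ ^ 2) atTop (𝓝 0) := by simpa using h.norm.pow 2
      refine ge_of_tendsto h2 ?_
      filter_upwards [eventually_ge_atTop r] with s hs
      exact hm hr (lt_of_lt_of_le hr hs) hs
    simpa using le_antisymm h1 (sq_nonneg _)
  · obtain ⟨b', hb'⟩ := (h.norm.eventually
        (gt_mem_nhds (by simp : ‖(0 : ℂ)‖ < 1))).exists_forall_of_atTop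
    obtain ⟨x, hx⟩ := hp.exists_tendsto (C := 1) (b := b') hX fun r hr => (hb' r hr.le).le
    have hG0 : Tendsto G atTop (𝓝 0) := by
      have h0 := ((Complex.continuous_conj.tendsto _).comp hx).mul h
      have := (Complex.continuous_re.tendsto _).comp (h0.const_mul 1)
      simp only [mul_zero, Complex.zero_re] at this
      exact this
    have hnp : ∀ r, a < r → G r ≤ 0 := fun r hr => by
      refine ge_of_tendsto hG0 ?_
      filter_upwards [eventually_ge_atTop r] with s hs
      exact hmono hr (lt_of_lt_of_le hr hs) hs
    have hz : HasDerivAt G 0 r := by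
      refine (hasDerivAt_const r (0 : ℝ)).congr_of_eventuallyEq ?_
      filter_upwards [Ioi_mem_nhds hr] with s hs
      exact le_antisymm (hnp s hs) (hnn s hs)
    have h0 := (hG r hr).unique hz
    have h1 : 0 < V r - E := by linarith [hV r hr]
    have h3 := hp.pos r hr
    have h4 : (V r - E) * ‖X r‖ ^ 2 = 0 := by
      have : 0 ≤ (V r - E) * ‖X r‖ ^ 2 := by positivity
      rw [div_eq_zero_iff] at h0
      rcases h0 with h0 | h0
      · nlinarith [sq_nonneg ‖Y r‖]
      · linarith
    simpa [h1.ne'] using h4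

end IsTortoiseFactor

/-! ### Static field equations and asymptotics of the potentials. -/

namespace StaticEYM.IsAdSBlackHole

variable {B : StaticEYM} {ωinf : ℝ}

theorem hasDerivAt_m (h : B.IsAdSBlackHole ωinf) {r : ℝ} (hr : B.rh < r) :
    HasDerivAt B.m (deriv B.m r) r :=
  ((h.m_regular.contDiffAt (Ici_mem_nhds hr)).differentiableAt (by norm_num)).hasDerivAt

theorem hasDerivAt_S (h : B.IsAdSBlackHole ωinf) {r : ℝ} (hr : B.rh < r) :
    HasDerivAt B.S (2 * deriv B.ω r ^ 2 / r * B.S r) r := by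
  have h1 := ((h.S_regular.contDiffAt (Ici_mem_nhds hr)).differentiableAt
    (by norm_num)).hasDerivAt
  have h2 := h.S_eq r hr
  rw [div_eq_iff (h.S_pos r hr.le).ne'] at h2
  rwa [h2] at h1

theorem hasDerivAt_ω (h : B.IsAdSBlackHole ωinf) {r : ℝ} (hr : B.rh < r) :
    HasDerivAt B.ω (deriv B.ω r) r :=
  ((h.ω_regular.contDiffAt (Ici_mem_nhds hr)).differentiableAt (by norm_num)).hasDerivAt

theorem hasDerivAt_deriv_ω (h : B.IsAdSBlackHole ωinf) {r : ℝ} (hr : B.rh < r) :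
    HasDerivAt (deriv B.ω) (deriv (deriv B.ω) r) r := by
  have h1 : ContDiffOn ℝ (1 + 1) B.ω (Ioi B.rh) :=
    (h.ω_regular.mono Ioi_subset_Ici_self).of_le (by norm_num)
  have h2 := ((contDiffOn_succ_iff_deriv_of_isOpen isOpen_Ioi).1 h1).2.2
  exact ((h2.contDiffAt (Ioi_mem_nhds hr)).differentiableAt (by norm_num)).hasDerivAt

theorem pos_of_le (h : B.IsAdSBlackHole ωinf) {r : ℝ} (hr : B.rh ≤ r) : 0 < r :=
  h.radius_pos.trans_le hr

theorem hasDerivAt_N (h : B.IsAdSBlackHole ωinf) {r : ℝ} (hr : B.rh < r) :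
    HasDerivAt B.N (1 / r - B.N r / r - B.Λ * r - 2 * B.N r * deriv B.ω r ^ 2 / r
      - (B.ω r ^ 2 - 1) ^ 2 / r ^ 3) r := by
  have hr0 := (h.pos_of_le hr.le).ne'
  have h1 := ((((h.hasDerivAt_m hr).const_mul 2).div (hasDerivAt_id r) hr0).const_sub 1).sub
    (((hasDerivAt_pow 2 r).const_mul B.Λ).div_const 3)
  refine h1.congr_deriv ?_
  rw [h.m_eq r hr]
  simp only [N, id]
  field_simp
  ring

/-- The ω'² terms of N' and S' cancel, so the derivative of NS is free of ω'. -/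
theorem hasDerivAt_N_mul_S (h : B.IsAdSBlackHole ωinf) {r : ℝ} (hr : B.rh < r) :
    HasDerivAt (fun s => B.N s * B.S s)
      (B.S r * (1 / r - B.N r / r - B.Λ * r - (B.ω r ^ 2 - 1) ^ 2 / r ^ 3)) r := by
  have hr0 := (h.pos_of_le hr.le).ne'
  refine ((h.hasDerivAt_N hr).mul (h.hasDerivAt_S hr)).congr_deriv ?_
  field_simp
  ring

/-- The Yang-Mills equation in divergence form. -/
theorem hasDerivAt_N_mul_S_mul_deriv_ω (h : B.IsAdSBlackHole ωinf) {r : ℝ} (hr : B.rh < r) :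
    HasDerivAt (fun s => B.N s * B.S s * deriv B.ω s)
      (B.S r * (B.ω r * (B.ω r ^ 2 - 1)) / r ^ 2) r := by
  have hr0 := (h.pos_of_le hr.le).ne'
  refine ((h.hasDerivAt_N_mul_S hr).mul (h.hasDerivAt_deriv_ω hr)).congr_deriv ?_
  have h1 := h.ω_eq r hr
  have h2 : r ^ 2 * B.N r * deriv (deriv B.ω) r = B.ω r * (B.ω r ^ 2 - 1)
      - (2 * B.m r - 2 * B.Λ * r ^ 3 / 3 - (B.ω r ^ 2 - 1) ^ 2 / r) * deriv B.ω r := by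
    linarith
  have h3 : B.N r * B.S r * deriv (deriv B.ω) r
      = B.S r / r ^ 2 * (r ^ 2 * B.N r * deriv (deriv B.ω) r) := by
    field_simp
  rw [h3, h2]
  simp only [N]
  field_simp
  ring

theorem continuousOn_N (h : B.IsAdSBlackHole ωinf) : ContinuousOn B.N (Ici B.rh) := by
  have hm := h.m_regular.continuousOn
  exact (continuousOn_const.sub ((continuousOn_const.mul hm).div continuousOn_id
    fun r hr => (h.pos_of_le hr).ne')).sub
    ((continuousOn_const.mul (continuousOn_id.pow 2)).div_const 3)

theorem tendsto_deriv_ω (h : B.IsAdSBlackHole ωinf) :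
    Tendsto (deriv B.ω) (𝓝[>] B.rh) (𝓝 (derivWithin B.ω (Ici B.rh) B.rh)) := by
  have h1 : ContDiffOn ℝ (1 + 1) B.ω (Ici B.rh) := h.ω_regular.of_le (by norm_num)
  have h2 := ((contDiffOn_succ_iff_derivWithin (uniqueDiffOn_Ici _)).1 h1).2.2.continuousOn
  have h3 := (h2 B.rh self_mem_Ici).mono_left (nhdsWithin_mono _ Ioi_subset_Ici_self)
  refine h3.congr' ?_
  filter_upwards [self_mem_nhdsWithin] with r hr
  exact derivWithin_of_mem_nhds (Ici_mem_nhds hr)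

theorem tendsto_right {f : ℝ → ℝ} {a : ℝ} (hf : ContinuousOn f (Ici a)) :
    Tendsto f (𝓝[>] a) (𝓝 (f a)) :=
  (hf a self_mem_Ici).mono_left (nhdsWithin_mono _ Ioi_subset_Ici_self)

theorem tendsto_N_horizon (h : B.IsAdSBlackHole ωinf) : Tendsto B.N (𝓝[>] B.rh) (𝓝 0) := by
  have := tendsto_right h.continuousOn_N
  rwa [h.horizon] at this

theorem continuousOn_deriv_ω (h : B.IsAdSBlackHole ωinf) :
    ContinuousOn (deriv B.ω) (Ioi B.rh) := fun _ hr =>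
  (h.hasDerivAt_deriv_ω hr).continuousAt.continuousWithinAt

theorem monotoneOn_S (h : B.IsAdSBlackHole ωinf) : MonotoneOn B.S (Ici B.rh) := by
  refine monotoneOn_of_deriv_nonneg (convex_Ici _) h.S_regular.continuousOn ?_ ?_
  · rw [interior_Ici]
    exact fun r hr => (h.hasDerivAt_S hr).differentiableAt.differentiableWithinAt
  · rw [interior_Ici]
    intro r hr
    rw [(h.hasDerivAt_S hr).deriv]
    have h1 := h.pos_of_le (le_of_lt hr)
    have h2 := h.S_pos r (le_of_lt hr)
    positivity

theorem tendsto_N_div_sq (h : B.IsAdSBlackHole ωinf) :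
    Tendsto (fun r => B.N r / r ^ 2) atTop (𝓝 (-B.Λ / 3)) := by
  obtain ⟨M, hM⟩ := h.m_lim
  have h2 : Tendsto (fun r : ℝ => (r ^ 2)⁻¹) atTop (𝓝 0) :=
    (tendsto_pow_atTop two_ne_zero).inv_tendsto_atTop
  have h3 : Tendsto (fun r : ℝ => (r ^ 3)⁻¹) atTop (𝓝 0) :=
    (tendsto_pow_atTop three_ne_zero).inv_tendsto_atTop
  have h4 := (h2.sub ((hM.const_mul 2).mul h3)).sub_const (B.Λ / 3)
  have e : (0 : ℝ) - 2 * M * 0 - B.Λ / 3 = -B.Λ / 3 := by ring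
  rw [e] at h4
  refine h4.congr' ?_
  filter_upwards [eventually_gt_atTop 0] with r hr
  simp only [N]
  field_simp

/-- The tortoise coordinate of the exterior has range `(-∞, R)` with `R` finite. -/
theorem isTortoiseFactor (h : B.IsAdSBlackHole ωinf) :
    IsTortoiseFactor B.rh (fun r => B.N r * B.S r) where
  pos_left := h.radius_pos
  continuousOn := fun _ hr => (h.hasDerivAt_N_mul_S hr).continuousAt.continuousWithinAt
  pos := fun r hr => mul_pos (h.exterior r hr) (h.S_pos r hr.le)
  not_integrable := by
    intro b hb hi
    -- A nonzero `derivWithin` certifies differentiability, as its default value is zero. Hence NS =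
    -- O(r - rh), and 1/(NS) dominates a multiple of the nonintegrable 1/(r - rh).
    have h1 : DifferentiableWithinAt ℝ B.N (Ici B.rh) B.rh :=
      differentiableWithinAt_of_derivWithin_ne_zero h.horizon_regular.ne'
    have h2 : (fun x => B.N x - B.N B.rh) =O[𝓝[Ici B.rh] B.rh] fun x => x - B.rh :=
      h1.hasDerivWithinAt.isBigO_sub.comp_tendsto (k := fun x => (x, B.rh))
        (tendsto_id.prodMk (tendsto_pure.2 (Eventually.of_forall fun _ => rfl)))
    have h3 : B.S =O[𝓝[Ici B.rh] B.rh] fun _ => (1 : ℝ) :=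
      (h.S_regular.continuousOn B.rh self_mem_Ici).tendsto.isBigO_one ℝ
    have h4 := h2.mul h3
    obtain ⟨K, hK⟩ := h4.bound
    have h5 := hK.filter_mono (nhdsWithin_mono B.rh Ioi_subset_Ici_self)
    obtain ⟨c, hc, hc'⟩ := mem_nhdsGT_iff_exists_Ioc_subset.1 (h5 : _ ∈ _)
    have hc0 : B.rh < c := hc
    set d := min b c
    have hd : B.rh < d := lt_min hb hc0
    have hnot : ¬ IntervalIntegrable (fun x => (x - B.rh)⁻¹) volume B.rh d := by
      rw [intervalIntegrable_sub_inv_iff]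
      push Not
      exact ⟨hd.ne, left_mem_uIcc⟩
    refine hnot ?_
    rw [intervalIntegrable_iff_integrableOn_Ioc_of_le hd.le]
    refine Integrable.mono' (((hi.mono_set (Ioc_subset_Ioc_right (min_le_left b c)))).const_mul K)
      ?_ (ae_restrict_of_forall_mem measurableSet_Ioc fun r hr => ?_)
    · exact ((measurable_id.sub_const _).inv).aestronglyMeasurable
    · have hp := mul_pos (h.exterior r hr.1) (h.S_pos r hr.1.le)
      have hrr : 0 < r - B.rh := sub_pos.2 hr.1
      have hb' := hc' ⟨hr.1, hr.2.trans (min_le_right b c)⟩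
      simp only [mem_ofPred_eq, h.horizon, sub_zero, mul_one] at hb'
      rw [Real.norm_of_nonneg hp.le, Real.norm_of_nonneg hrr.le] at hb'
      rw [Real.norm_of_nonneg (inv_pos.2 hrr).le, ← div_eq_mul_inv, inv_eq_one_div,
        div_le_div_iff₀ hrr hp, one_mul]
      exact hb'
  quadratic := by
    have h1 := h.tendsto_N_div_sq.mul h.S_lim
    have h2 : 0 < -B.Λ / 3 := by have := h.cosmological_neg; linarith
    rw [mul_one] at h1
    obtain ⟨b, hb⟩ := (h1.eventually (lt_mem_nhds (half_lt_self h2))).exists_forall_of_atTop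
    refine ⟨max b (B.rh + 1), -B.Λ / 3 / 2, lt_max_of_lt_right (lt_add_one _), half_pos h2,
      fun r hr => ?_⟩
    have hr0 : 0 < r := h.pos_of_le ((lt_add_one _).le.trans ((le_max_right _ _).trans hr.le))
    have h3 := hb r ((le_max_left _ _).trans hr.le)
    rw [div_mul_eq_mul_div, lt_div_iff₀ (by positivity)] at h3
    exact h3.le

/-- `r² ω'` converges at infinity. -/
theorem exists_tendsto_sq_mul_deriv_ω (h : B.IsAdSBlackHole ωinf) :
    ∃ c, Tendsto (fun r => r ^ 2 * deriv B.ω r) atTop (𝓝 c) := by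
  have h1 := (h.S_lim.mul (h.ω_lim.mul ((h.ω_lim.pow 2).sub_const 1))).abs
  obtain ⟨b, hb⟩ := (h1.eventually (gt_mem_nhds (lt_add_one _))).exists_forall_of_atTop
  -- The flux NSω' converges since its derivative is O(r⁻²); dividing by NS/r², which tends to -Λ/3,
  -- recovers r²ω'.
  obtain ⟨l, hl⟩ := exists_tendsto_atTop_of_norm_deriv_le
    (f := fun s => B.N s * B.S s * deriv B.ω s) (a := max b B.rh)
    (lt_max_of_lt_right h.radius_pos)
    (fun r hr => h.hasDerivAt_N_mul_S_mul_deriv_ω ((le_max_right _ _).trans_lt hr))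
    (fun r hr => by
      rw [norm_div, Real.norm_of_nonneg (sq_nonneg r)]
      exact div_le_div_of_nonneg_right (hb r ((le_max_left _ _).trans hr.le)).le (sq_nonneg r))
  have h2 : -B.Λ / 3 * 1 ≠ 0 := by have := h.cosmological_neg; intro h0; linarith
  have h3 := hl.div (h.tendsto_N_div_sq.mul h.S_lim) h2
  refine ⟨_, h3.congr' ?_⟩
  filter_upwards [eventually_gt_atTop B.rh] with r hr
  have hr0 := (h.pos_of_le hr.le).ne'
  have hN := (h.exterior r hr).ne'
  have hS := (h.S_pos r hr.le).ne'
  simp only [Pi.div_apply]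
  field_simp

/-- L'Hôpital's rule against 1/r: the quotient of derivatives is -r²ω'. -/
theorem tendsto_mul_sub (h : B.IsAdSBlackHole ωinf) {c : ℝ}
    (hc : Tendsto (fun r => r ^ 2 * deriv B.ω r) atTop (𝓝 c)) :
    Tendsto (fun r => r * (B.ω r - ωinf)) atTop (𝓝 (-c)) := by
  have h1 : Tendsto (fun r => (B.ω r - ωinf) / r⁻¹) atTop (𝓝 (-c)) := by
    refine HasDerivAt.lhopital_zero_atTop (f := fun r => B.ω r - ωinf) (g := fun r => r⁻¹)
      (f' := deriv B.ω) (g' := fun r => -(r ^ 2)⁻¹) ?_ ?_ ?_ ?_ tendsto_inv_atTop_zero ?_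
    · filter_upwards [eventually_gt_atTop B.rh] with r hr
      exact (h.hasDerivAt_ω hr).sub_const _
    · filter_upwards [eventually_gt_atTop 0] with r hr
      exact hasDerivAt_inv hr.ne'
    · filter_upwards [eventually_gt_atTop 0] with r hr
      simp [hr.ne']
    · simpa using h.ω_lim.sub_const ωinf
    · refine hc.neg.congr' ?_
      filter_upwards [eventually_gt_atTop 0] with r hr
      field_simp
  refine h1.congr fun r => ?_
  rw [div_inv_eq_mul, mul_comm]

theorem sphaleronicPotential_pos (h : B.IsAdSBlackHole ωinf) {r : ℝ} (hr : B.rh < r) :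
    0 < B.sphaleronicPotential r := by
  have h1 := h.exterior r hr
  have h2 := h.S_pos r hr.le
  have h3 := h.pos_of_le hr.le
  unfold sphaleronicPotential
  positivity

theorem continuousOn_sphaleronicPotential (h : B.IsAdSBlackHole ωinf) (hn : B.Nodeless) :
    ContinuousOn B.sphaleronicPotential (Ioi B.rh) := by
  have hN := h.continuousOn_N.mono Ioi_subset_Ici_self
  have hS := h.S_regular.continuousOn.mono Ioi_subset_Ici_self
  have hω := h.ω_regular.continuousOn.mono Ioi_subset_Ici_self
  have hω' := h.continuousOn_deriv_ω
  refine (((hN.mul (hS.pow 2)).div (continuousOn_id.pow 2) fun r hr => ?_).mul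
    (continuousOn_const.add (hω.pow 2))).add
    ((continuousOn_const.div (hω.pow 2) fun r hr => ?_).mul (((hN.mul hS).mul hω').pow 2))
  · exact pow_ne_zero 2 (h.pos_of_le (le_of_lt hr)).ne'
  · exact pow_ne_zero 2 (hn r (le_of_lt hr))

theorem tendsto_sphaleronicPotential_horizon (h : B.IsAdSBlackHole ωinf) (hn : B.Nodeless) :
    Tendsto B.sphaleronicPotential (𝓝[>] B.rh) (𝓝 0) := by
  have hN := h.tendsto_N_horizon
  have hS := tendsto_right h.S_regular.continuousOn
  have hω := tendsto_right h.ω_regular.continuousOn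
  have hω' := h.tendsto_deriv_ω
  have hr : Tendsto (fun r : ℝ => r) (𝓝[>] B.rh) (𝓝 B.rh) := tendsto_nhdsWithin_of_tendsto_nhds
    tendsto_id
  have h1 := (((hN.mul (hS.pow 2)).div (hr.pow 2) (pow_ne_zero 2 h.radius_pos.ne')).mul
    ((hω.pow 2).const_add 1)).add (((tendsto_const_nhds (x := (2 : ℝ))).div (hω.pow 2)
      (pow_ne_zero 2 (hn _ le_rfl))).mul (((hN.mul hS).mul hω').pow 2))
  simp only [zero_mul, zero_div, ne_eq, OfNat.ofNat_ne_zero, not_false_eq_true, zero_pow,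
    mul_zero, add_zero] at h1
  exact h1

/-- Powers of r are grouped so that each factor converges: dω/dr* is (N/r²) · S · (r²ω'). -/
theorem tendsto_sphaleronicPotential_atTop (h : B.IsAdSBlackHole ωinf) (hinf : ωinf ≠ 0) {c : ℝ}
    (hc : Tendsto (fun r => r ^ 2 * deriv B.ω r) atTop (𝓝 c)) :
    Tendsto B.sphaleronicPotential atTop
      (𝓝 (-B.Λ / 3 * (1 + ωinf ^ 2) + 2 * B.Λ ^ 2 * (-c) ^ 2 / (9 * ωinf ^ 2))) := by
  have hN := h.tendsto_N_div_sq
  have h1 := ((hN.mul (h.S_lim.pow 2)).mul ((h.ω_lim.pow 2).const_add 1)).add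
    (((tendsto_const_nhds (x := (2 : ℝ))).div (h.ω_lim.pow 2) (pow_ne_zero 2 hinf)).mul
      (((hN.mul h.S_lim).mul hc).pow 2))
  have e : -B.Λ / 3 * 1 ^ 2 * (1 + ωinf ^ 2) + 2 / ωinf ^ 2 * (-B.Λ / 3 * 1 * c) ^ 2
      = -B.Λ / 3 * (1 + ωinf ^ 2) + 2 * B.Λ ^ 2 * (-c) ^ 2 / (9 * ωinf ^ 2) := by
    field_simp
    ring
  rw [e] at h1
  refine h1.congr' ?_
  filter_upwards [eventually_gt_atTop 0] with r hr
  simp only [sphaleronicPotential, dStar, smul_eq_mul, Pi.div_apply]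
  field_simp

/-- The factor multiplying `N S² / r²` in the gravitational potential tends to `3 ω² - 1`. -/
theorem tendsto_gravitationalPotential_factor (h : B.IsAdSBlackHole ωinf) :
    Tendsto (fun r => 3 * B.ω r ^ 2 - 1
      - 4 * r * deriv B.ω r ^ 2 * (1 / r - B.Λ * r - (1 - B.ω r ^ 2) ^ 2 / r ^ 3)
      + 8 / r * B.ω r * deriv B.ω r * (B.ω r ^ 2 - 1)) atTop (𝓝 (3 * ωinf ^ 2 - 1)) := by
  obtain ⟨c, hc⟩ := h.exists_tendsto_sq_mul_deriv_ω
  have hp : ∀ n : ℕ, n ≠ 0 → Tendsto (fun r : ℝ => (r ^ n)⁻¹) atTop (𝓝 0) := fun n hn =>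
    (tendsto_pow_atTop hn).inv_tendsto_atTop
  have h1 := ((((h.ω_lim.pow 2).const_mul 3).sub_const 1).sub (((hc.pow 2).const_mul 4).mul
    (((hp 4 (by norm_num)).sub ((hp 2 (by norm_num)).const_mul B.Λ)).sub
      (((h.ω_lim.pow 2).const_sub 1).pow 2 |>.mul (hp 6 (by norm_num)))))).add
    (((hp 3 (by norm_num)).const_mul 8).mul (h.ω_lim.mul (hc.mul ((h.ω_lim.pow 2).sub_const 1))))
  simp only [mul_zero, sub_zero, zero_mul, add_zero] at h1
  refine h1.congr' ?_
  filter_upwards [eventually_gt_atTop 0] with r hr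
  field_simp

theorem tendsto_gravitationalPotential_atTop (h : B.IsAdSBlackHole ωinf) :
    Tendsto B.gravitationalPotential atTop (𝓝 (-B.Λ / 3 * (3 * ωinf ^ 2 - 1))) := by
  have h1 := (h.tendsto_N_div_sq.mul (h.S_lim.pow 2)).mul h.tendsto_gravitationalPotential_factor
  rw [one_pow, mul_one] at h1
  refine h1.congr fun r => ?_
  simp only [gravitationalPotential]
  ring

/-- The bracket has a finite limit because ω is C² up to the horizon, and the prefactor N tends to
zero. -/
theorem tendsto_gravitationalPotential_horizon (h : B.IsAdSBlackHole ωinf) :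
    Tendsto B.gravitationalPotential (𝓝[>] B.rh) (𝓝 0) := by
  have hN := h.tendsto_N_horizon
  have hS := tendsto_right h.S_regular.continuousOn
  have hω := tendsto_right h.ω_regular.continuousOn
  have hω' := h.tendsto_deriv_ω
  have hr : Tendsto (fun r : ℝ => r) (𝓝[>] B.rh) (𝓝 B.rh) := tendsto_nhdsWithin_of_tendsto_nhds
    tendsto_id
  have h0 := h.radius_pos.ne'
  have h1 := ((hN.mul (hS.pow 2)).div (hr.pow 2) (pow_ne_zero 2 h0)).mul
    (((((hω.pow 2).const_mul 3).sub_const 1).sub (((hr.const_mul 4).mul (hω'.pow 2)).mul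
      ((((tendsto_const_nhds (x := (1 : ℝ))).div hr h0).sub (hr.const_mul B.Λ)).sub
        ((((hω.pow 2).const_sub 1).pow 2).div (hr.pow 3) (pow_ne_zero 3 h0))))).add
      (((((tendsto_const_nhds (x := (8 : ℝ))).div hr h0).mul hω).mul hω').mul
        ((hω.pow 2).sub_const 1)))
  rw [zero_mul, zero_div, zero_mul] at h1
  exact h1

theorem not_isBoundState (h : B.IsAdSBlackHole ωinf) {V : ℝ → ℝ}
    (hV : ∀ r, B.rh < r → 0 < V r) {E : ℝ} (hE : E < 0) (β : ℝ → ℂ) :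
    ¬ B.IsBoundState V E β := by
  intro hβ
  obtain ⟨r, hr, hne⟩ := hβ.nontrivial
  have hp := h.isTortoiseFactor
  have hd1 : ∀ s, B.rh < s → HasDerivAt β (deriv β s) s := fun s hs =>
    ((hβ.smooth.contDiffAt (Ioi_mem_nhds hs)).differentiableAt (by norm_num)).hasDerivAt
  have hd2 : ∀ s, B.rh < s → DifferentiableAt ℝ (deriv β) s := fun s hs => by
    have h1 : ContDiffOn ℝ (1 + 1) β (Ioi B.rh) := hβ.smooth.of_le (by norm_num)
    have h2 := ((contDiffOn_succ_iff_deriv_of_isOpen isOpen_Ioi).1 h1).2.2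
    exact (h2.contDiffAt (Ioi_mem_nhds hs)).differentiableAt (by norm_num)
  refine hne (hp.boundState_eq_zero (X := β) (Y := B.dStar β) (V := V) (E := E) ?_ ?_
    (fun s hs => (hV s hs).le) hE hβ.normalizable hβ.boundary r hr)
  · intro s hs
    have hps : ((B.N s * B.S s : ℝ) : ℂ) ≠ 0 := by exact_mod_cast (hp.pos s hs).ne'
    refine (hd1 s hs).congr_deriv ?_
    rw [dStar, Complex.real_smul, mul_div_cancel_left₀ _ hps]
  · intro s hs
    have hps : ((B.N s * B.S s : ℝ) : ℂ) ≠ 0 := by exact_mod_cast (hp.pos s hs).ne'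
    have h1 : DifferentiableAt ℝ (B.dStar β) s :=
      (h.hasDerivAt_N_mul_S hs).differentiableAt.smul (hd2 s hs)
    refine h1.hasDerivAt.congr_deriv ?_
    have h2 := hβ.schrodinger s hs
    rw [dStar, Complex.real_smul] at h2
    rw [eq_div_iff hps]
    linear_combination h2

end StaticEYM.IsAdSBlackHole

/-! ### Absence of growing modes in the two sectors. -/

namespace StaticEYM.IsAdSBlackHole

variable {B : StaticEYM} {ωinf : ℝ}

/-- If σ² is real and Im σ ≠ 0, then σ is purely imaginary and σ² is negative. -/
theorem sq_ne_ofReal_of_im_neg {σ : ℂ} (hσ : σ.im < 0) (x : ℝ) (hx : 0 ≤ x) : σ ^ 2 ≠ x := by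
  intro h
  have h1 : (σ ^ 2).im = 0 := by rw [h, Complex.ofReal_im]
  have h2 : (σ ^ 2).re = x := by rw [h, Complex.ofReal_re]
  simp only [sq, Complex.mul_im, Complex.mul_re] at h1 h2
  have h3 : σ.re = 0 := by nlinarith
  rw [h3] at h2
  nlinarith

/-- With X = r²δb/S and Y = -2δν/ω, the Gauss constraint reads dX/dr* = ω²Y, and the δb equation
reads dY/dr* = (2NS²/r² - σ²/ω²)X. Nodelessness and a nonzero limit bound ω away from zero, so the
norms and boundary conditions transfer to X and Y. -/
theorem sphaleronicallyStable (h : B.IsAdSBlackHole ωinf) (hn : B.Nodeless) (hinf : ωinf ≠ 0) :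
    B.SphaleronicallyStable := by
  intro σ δb δν hσ hm
  have hp := h.isTortoiseFactor
  have hσ0 : σ ≠ 0 := by
    rintro rfl
    simp at hσ
  have hdb : ∀ s, B.rh < s → HasDerivAt δb (deriv δb s) s := fun s hs =>
    ((hm.b_smooth.contDiffAt (Ioi_mem_nhds hs)).differentiableAt (by norm_num)).hasDerivAt
  have hdν : ∀ s, B.rh < s → HasDerivAt δν (deriv δν s) s := fun s hs =>
    ((hm.ν_smooth.contDiffAt (Ioi_mem_nhds hs)).differentiableAt (by norm_num)).hasDerivAt
  obtain ⟨cω, hcω, hω⟩ := exists_pos_le_abs_of_tendsto h.ω_regular.continuousOn hn h.ω_lim hinf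
  obtain ⟨Cω, hCω, hωC⟩ := exists_abs_le_of_tendsto h.ω_regular.continuousOn h.ω_lim
  obtain ⟨C2, hC2⟩ : ∃ C b, ∀ r, b < r → |2 * (B.N r / r ^ 2) * B.S r ^ 2| ≤ C := by
    have h1 := ((h.tendsto_N_div_sq.const_mul 2).mul (h.S_lim.pow 2)).abs
    obtain ⟨b, hb⟩ := (h1.eventually (gt_mem_nhds (lt_add_one _))).exists_forall_of_atTop
    exact ⟨_, b, fun r hr => (hb r hr.le).le⟩
  have hSh := h.S_pos B.rh le_rfl
  have hSl : ∀ r, B.rh < r → B.S B.rh ≤ B.S r := fun r hr =>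
    h.monotoneOn_S self_mem_Ici hr.le hr.le
  have hωc : ∀ r, B.rh < r → (B.ω r : ℂ) ≠ 0 := fun r hr => by exact_mod_cast hn r hr.le
  have hX0 : ∀ r, B.rh < r → (r : ℂ) ^ 2 * δb r / B.S r = 0 := by
    refine hp.sturmLiouville_eq_zero (X := fun r => (r : ℂ) ^ 2 * δb r / B.S r)
      (Y := fun r => -2 * δν r / B.ω r) (w := fun r => B.ω r ^ 2)
      (Q := fun r => 2 * B.N r * B.S r ^ 2 / r ^ 2) (l := σ ^ 2) ?_ ?_ ?_ ?_
      (sq_ne_ofReal_of_im_neg hσ) ?_ ?_ ?_ ?_ ?_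
    · intro r hr
      have hr0 : (r : ℂ) ≠ 0 := by exact_mod_cast (h.pos_of_le hr.le).ne'
      have hS : (B.S r : ℂ) ≠ 0 := by exact_mod_cast (h.S_pos r hr.le).ne'
      have hN : (B.N r : ℂ) ≠ 0 := by exact_mod_cast (h.exterior r hr).ne'
      have hω0 := hωc r hr
      have h1 : HasDerivAt (fun s : ℝ => (s : ℂ) ^ 2) (2 * r) r := by
        simpa using (hasDerivAt_pow 2 r).ofReal_comp
      refine ((h1.mul (hdb r hr)).div (h.hasDerivAt_S hr).ofReal_comp hS).congr_deriv ?_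
      have h2 := hm.gauss r hr
      have h3 := (mul_eq_zero.1 h2.symm).resolve_left (mul_ne_zero Complex.I_ne_zero hσ0)
      rw [(h.hasDerivAt_S hr).deriv] at h3
      simp only [Pi.mul_apply]
      push_cast at h3 ⊢
      field_simp at h3 ⊢
      linear_combination h3
    · intro r hr
      have hr0 : (r : ℂ) ≠ 0 := by exact_mod_cast (h.pos_of_le hr.le).ne'
      have hS : (B.S r : ℂ) ≠ 0 := by exact_mod_cast (h.S_pos r hr.le).ne'
      have hN : (B.N r : ℂ) ≠ 0 := by exact_mod_cast (h.exterior r hr).ne'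
      have hω0 := hωc r hr
      refine (((hdν r hr).const_mul (-2)).div (h.hasDerivAt_ω hr).ofReal_comp hω0).congr_deriv ?_
      have h2 := hm.b_eq r hr
      push_cast at h2 ⊢
      field_simp at h2 ⊢
      linear_combination h2
    · exact fun r hr => sq_pos_of_ne_zero (hn r hr.le)
    · intro r hr
      have h1 := h.exterior r hr
      positivity
    · exact ⟨Cω ^ 2, B.rh, fun r hr => by
        rw [← sq_abs]
        exact pow_le_pow_left₀ (abs_nonneg _) (hωC r hr.le) 2⟩
    · obtain ⟨b, hb⟩ := hC2
      refine ⟨C2 + ‖σ‖ ^ 2 / cω ^ 2, max b B.rh, fun r hr => ?_⟩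
      refine (norm_sub_le _ _).trans (add_le_add ?_ ?_)
      · rw [Complex.norm_real, Real.norm_eq_abs]
        refine le_trans (le_of_eq ?_) (hb r ((le_max_left _ _).trans_lt hr))
        congr 1
        ring
      · rw [norm_div, norm_pow, Complex.norm_real, Real.norm_of_nonneg (sq_nonneg _)]
        refine div_le_div_of_nonneg_left (sq_nonneg _) (by positivity) ?_
        rw [← sq_abs (B.ω r)]
        exact pow_le_pow_left₀ hcω.le (hω r ((le_max_right _ _).trans hr.le)) 2
    · refine Integrable.mono' (hm.b_normalizable.const_mul ((B.S B.rh)⁻¹ ^ 2)) ?_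
        (ae_restrict_of_forall_mem measurableSet_Ioi fun r hr => ?_)
      · refine ContinuousOn.aestronglyMeasurable ?_ measurableSet_Ioi
        refine ContinuousOn.div (ContinuousOn.pow (ContinuousOn.norm ?_) 2) hp.continuousOn
          fun r hr => (hp.pos r hr).ne'
        intro r hr
        have hS : (B.S r : ℂ) ≠ 0 := by exact_mod_cast (h.S_pos r (le_of_lt hr)).ne'
        exact ((((Complex.continuous_ofReal.pow 2).continuousAt).mul
          (hdb r hr).continuousAt).div (h.hasDerivAt_S hr).ofReal_comp.continuousAt
          hS).continuousWithinAt
      · have hpr := hp.pos r hr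
        rw [Real.norm_of_nonneg (by positivity), ← mul_div_assoc, norm_div, Complex.norm_real,
          Real.norm_of_nonneg (h.S_pos r (le_of_lt hr)).le, div_pow, div_eq_inv_mul (_ ^ 2),
          ← inv_pow]
        have h1 := hSl r hr
        have h2 : (B.S r)⁻¹ ^ 2 ≤ (B.S B.rh)⁻¹ ^ 2 :=
          pow_le_pow_left₀ (inv_nonneg.2 (hSh.le.trans h1)) (inv_anti₀ hSh h1) 2
        exact div_le_div_of_nonneg_right (mul_le_mul_of_nonneg_right h2 (sq_nonneg _)) hpr.le
    · refine Integrable.mono' (hm.ν_normalizable.const_mul ((2 / cω) ^ 2)) ?_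
        (ae_restrict_of_forall_mem measurableSet_Ioi fun r hr => ?_)
      · refine ContinuousOn.aestronglyMeasurable ?_ measurableSet_Ioi
        refine ContinuousOn.div (ContinuousOn.pow (ContinuousOn.norm ?_) 2) hp.continuousOn
          fun r hr => (hp.pos r hr).ne'
        intro r hr
        exact ((continuousAt_const.mul (hdν r hr).continuousAt).div
          (h.hasDerivAt_ω hr).ofReal_comp.continuousAt (hωc r hr)).continuousWithinAt
      · have hpr := hp.pos r hr
        have h1 := hω r (le_of_lt hr)
        rw [Real.norm_of_nonneg (by positivity), ← mul_div_assoc, norm_div, norm_mul,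
          Complex.norm_real, Real.norm_eq_abs, ← mul_pow]
        have h2 : ‖(-2 : ℂ)‖ = 2 := by simp
        rw [h2, div_mul_eq_mul_div]
        gcongr
    · rcases hm.boundary with h1 | h1
      · right
        have h2 := (h1.const_mul (-2)).div
          ((Complex.continuous_ofReal.tendsto _).comp h.ω_lim) (by exact_mod_cast hinf)
        rw [mul_zero, zero_div] at h2
        exact h2
      · left
        have h2 := h1.div ((Complex.continuous_ofReal.tendsto _).comp h.S_lim) (by simp)
        rw [zero_div] at h2
        exact h2
  have hb0 : ∀ r, B.rh < r → δb r = 0 := by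
    intro r hr
    have hr0 : (r : ℂ) ≠ 0 := by exact_mod_cast (h.pos_of_le hr.le).ne'
    have hS : (B.S r : ℂ) ≠ 0 := by exact_mod_cast (h.S_pos r hr.le).ne'
    simpa [hr0, hS] using hX0 r hr
  intro r hr
  refine ⟨hb0 r hr, ?_⟩
  have hr0 : (r : ℂ) ≠ 0 := by exact_mod_cast (h.pos_of_le hr.le).ne'
  have hS : (B.S r : ℂ) ≠ 0 := by exact_mod_cast (h.S_pos r hr.le).ne'
  have hN : (B.N r : ℂ) ≠ 0 := by exact_mod_cast (h.exterior r hr).ne'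
  -- With δb identically zero, the Gauss constraint leaves only a nonzero multiple of δν.
  have hd0 : deriv δb r = 0 := by
    refine ((hasDerivAt_const r (0 : ℂ)).congr_of_eventuallyEq ?_).deriv
    filter_upwards [Ioi_mem_nhds hr] with s hs
    exact hb0 s hs
  have h1 := (mul_eq_zero.1 (hm.gauss r hr).symm).resolve_left (mul_ne_zero Complex.I_ne_zero hσ0)
  rw [hb0 r hr, hd0, mul_zero, mul_zero, zero_add, zero_add] at h1
  refine (mul_eq_zero.1 h1).resolve_left ?_
  push_cast
  have := hωc r hr
  simp [hr0, hS, hN, this]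

/-- Since σ ≠ 0, the momentum constraint gives δm = 2Nω'δω, while (δS/S)' = 4ω'δω'/r. Substitution
turns the perturbed Yang-Mills equation into a Schrödinger equation for δω alone with potential U.
Once δω = 0, δS/S is constant and its limit at infinity makes it zero. -/
theorem gravitationallyStable (h : B.IsAdSBlackHole ωinf)
    (hU : ∀ r, B.rh < r → 0 < B.gravitationalPotential r) : B.GravitationallyStable := by
  intro σ δω δm δS hσ hm
  have hp := h.isTortoiseFactor
  have hσ0 : σ ≠ 0 := by
    rintro rfl
    simp at hσ
  have hdω : ∀ s, B.rh < s → HasDerivAt δω (deriv δω s) s := fun s hs =>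
    ((hm.ω_smooth.contDiffAt (Ioi_mem_nhds hs)).differentiableAt (by norm_num)).hasDerivAt
  have hddω : ∀ s, B.rh < s → HasDerivAt (deriv δω) (deriv (deriv δω) s) s := fun s hs => by
    have h1 : ContDiffOn ℝ (1 + 1) δω (Ioi B.rh) := hm.ω_smooth.of_le (by norm_num)
    have h2 := ((contDiffOn_succ_iff_deriv_of_isOpen isOpen_Ioi).1 h1).2.2
    exact ((h2.contDiffAt (Ioi_mem_nhds hs)).differentiableAt (by norm_num)).hasDerivAt
  have hδm : ∀ r, B.rh < r → δm r = 2 * B.N r * deriv B.ω r * δω r := fun r hr => by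
    have h1 := hm.momentum_eq r hr
    push_cast at h1
    have h2 : (Complex.I * σ) ≠ 0 := mul_ne_zero Complex.I_ne_zero hσ0
    refine mul_left_cancel₀ h2 ?_
    linear_combination h1
  have hδS : ∀ r, B.rh < r → HasDerivAt (fun s => δS s / (B.S s : ℂ))
      ((4 * deriv B.ω r / r : ℝ) * deriv δω r) r := fun r hr => by
    have hS : (B.S r : ℂ) ≠ 0 := by exact_mod_cast (h.S_pos r hr.le).ne'
    have h1 := ((hm.S_smooth.contDiffAt (Ioi_mem_nhds hr)).differentiableAt
      (by norm_num)).hasDerivAt.div (h.hasDerivAt_S hr).ofReal_comp hS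
    rw [← hm.S_eq r hr]
    exact h1.differentiableAt.hasDerivAt
  have hω0 : ∀ r, B.rh < r → δω r = 0 := by
    refine hp.sturmLiouville_eq_zero (X := δω) (Y := B.dStar δω) (w := fun _ => 1)
      (Q := B.gravitationalPotential) (l := σ ^ 2) ?_ ?_ (fun _ _ => one_pos)
      (fun r hr => (hU r hr).le) (sq_ne_ofReal_of_im_neg hσ) ⟨1, 0, fun _ _ => le_rfl⟩ ?_
      hm.ω_normalizable hm.dω_normalizable hm.boundary
    · intro r hr
      have hps : ((B.N r * B.S r : ℝ) : ℂ) ≠ 0 := by exact_mod_cast (hp.pos r hr).ne'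
      refine (hdω r hr).congr_deriv ?_
      rw [dStar, Complex.real_smul, Complex.ofReal_one, one_mul, mul_div_cancel_left₀ _ hps]
    · intro r hr
      have hrr := h.pos_of_le hr.le
      have hr0 : (r : ℂ) ≠ 0 := by exact_mod_cast hrr.ne'
      have hS : (B.S r : ℂ) ≠ 0 := by exact_mod_cast (h.S_pos r hr.le).ne'
      have hN : (B.N r : ℂ) ≠ 0 := by exact_mod_cast (h.exterior r hr).ne'
      have hid : HasDerivAt (fun s : ℝ => (s : ℂ)) 1 r := Complex.ofRealCLM.hasDerivAt
      have hd := (h.hasDerivAt_N_mul_S hr).ofReal_comp.mul (hddω r hr)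
      have hg := ((((h.hasDerivAt_deriv_ω hr).ofReal_comp.const_mul (-4)).mul (hdω r hr)).div
        hid hr0).add (hδS r hr)
      have ht := hd.add ((h.hasDerivAt_N_mul_S_mul_deriv_ω hr).ofReal_comp.mul hg)
      -- The perturbed metric enters as the static flux NSω' times -4ω'δω/r + δS/S. On
      -- differentiation, the undifferentiated δS term matches the δS source on the right and
      -- cancels.
      have he : (fun s => ((B.N s * B.S s : ℝ) : ℂ) * deriv δω s
          + ((B.S s : ℂ) * (-2 * δm s / (s : ℂ)) + (B.N s : ℂ) * δS s) * ((deriv B.ω s : ℝ) : ℂ))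
          =ᶠ[𝓝 r] ((fun s => ((B.N s * B.S s : ℝ) : ℂ) * deriv δω s)
            + fun s => ((B.N s * B.S s * deriv B.ω s : ℝ) : ℂ)
              * (-4 * ((deriv B.ω s : ℝ) : ℂ) * δω s / s + δS s / (B.S s : ℂ))) := by
        filter_upwards [Ioi_mem_nhds hr] with s hs
        have hs0 : (s : ℂ) ≠ 0 := by exact_mod_cast (h.pos_of_le (le_of_lt hs)).ne'
        have hSs : (B.S s : ℂ) ≠ 0 := by exact_mod_cast (h.S_pos s (le_of_lt hs)).ne'
        rw [hδm s hs, Pi.add_apply]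
        push_cast
        field_simp
        ring
      have h1 := (ht.congr_of_eventuallyEq he).deriv.symm.trans (hm.ω_eq r hr)
      have h2 := hd
      rw [show (fun s => ((B.N s * B.S s : ℝ) : ℂ)) * deriv δω = B.dStar δω from
        funext fun s => (Complex.real_smul ..).symm] at h2
      refine h2.congr_deriv ?_
      -- The static equation removes ω'', which does not occur in U.
      have h3 : B.N r * deriv (deriv B.ω) r = (B.ω r * (B.ω r ^ 2 - 1)
          - (r - B.N r * r - B.Λ * r ^ 3 - (B.ω r ^ 2 - 1) ^ 2 / r) * deriv B.ω r) / r ^ 2 := by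
        have h4 := h.ω_eq r hr
        have h5 : 2 * B.m r = r - B.N r * r - B.Λ * r ^ 3 / 3 := by
          simp only [N]
          field_simp
          ring
        rw [h5] at h4
        field_simp at h4 ⊢
        linear_combination -h4 / 3
      have h4 : (B.N r : ℂ) * (deriv (deriv B.ω) r : ℝ)
          = (B.ω r * (B.ω r ^ 2 - 1) - (r - B.N r * r - B.Λ * r ^ 3
            - (B.ω r ^ 2 - 1) ^ 2 / r) * (deriv B.ω r : ℝ)) / r ^ 2 := by
        exact_mod_cast h3
      have h5 : ((deriv (deriv B.ω) r : ℝ) : ℂ) = (B.ω r * (B.ω r ^ 2 - 1)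
          - (r - B.N r * r - B.Λ * r ^ 3
            - (B.ω r ^ 2 - 1) ^ 2 / r) * (deriv B.ω r : ℝ)) / r ^ 2 / B.N r := by
        rw [eq_div_iff hN, mul_comm]
        exact h4
      rw [h5] at h1
      simp only [gravitationalPotential]
      simp only [Pi.add_apply, Pi.mul_apply, Pi.div_apply] at h1
      push_cast at h1 ⊢
      rw [← sub_eq_zero] at h1 ⊢
      rw [← h1]
      field_simp
      ring
    · have h1 := h.tendsto_gravitationalPotential_atTop.abs
      obtain ⟨b, hb⟩ := (h1.eventually (gt_mem_nhds (lt_add_one _))).exists_forall_of_atTop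
      refine ⟨_, b, fun r hr => (norm_sub_le _ _).trans
        (add_le_add (b := |-B.Λ / 3 * (3 * ωinf ^ 2 - 1)| + 1) (d := ‖σ ^ 2‖) ?_ ?_)⟩
      · rw [Complex.norm_real]
        exact (hb r hr.le).le
      · simp
  have hS0 : ∀ r, B.rh < r → δS r = 0 := by
    have hd0 : ∀ r, B.rh < r → deriv δω r = 0 := fun r hr => by
      refine ((hasDerivAt_const r (0 : ℂ)).congr_of_eventuallyEq ?_).deriv
      filter_upwards [Ioi_mem_nhds hr] with s hs
      exact hω0 s hs
    have hlim : Tendsto (fun s => δS s / (B.S s : ℂ)) atTop (𝓝 0) := by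
      have h2 := hm.S_boundary.div ((Complex.continuous_ofReal.tendsto _).comp h.S_lim) (by simp)
      rw [zero_div] at h2
      exact h2
    intro r hr
    have hS : (B.S r : ℂ) ≠ 0 := by exact_mod_cast (h.S_pos r hr.le).ne'
    have hconst : ∀ s, B.rh < s → δS s / (B.S s : ℂ) = δS r / (B.S r : ℂ) := fun s hs => by
      refine isOpen_Ioi.is_const_of_deriv_eq_zero (convex_Ioi B.rh).isPreconnected
        (fun t ht => (hδS t ht).differentiableAt.differentiableWithinAt) (fun t ht => ?_) hs hr
      rw [(hδS t ht).deriv, hd0 t ht, mul_zero]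
      rfl
    have h1 : δS r / (B.S r : ℂ) = 0 := by
      refine tendsto_nhds_unique (tendsto_const_nhds.congr' ?_) hlim
      filter_upwards [eventually_gt_atTop B.rh] with s hs
      exact (hconst s hs).symm
    simpa [hS] using h1
  intro r hr
  refine ⟨hω0 r hr, ?_, hS0 r hr⟩
  rw [hδm r hr, hω0 r hr, mul_zero]

end StaticEYM.IsAdSBlackHole

/-! ### A priori estimates for large |Λ|. -/

theorem abs_le_of_abs_deriv_le {f f' g g' : ℝ → ℝ} {a b : ℝ}
    (hf0 : Tendsto f (𝓝[>] a) (𝓝 0)) (hg0 : Tendsto g (𝓝[>] a) (𝓝 0))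
    (hf : ∀ r ∈ Ioc a b, HasDerivAt f (f' r) r) (hg : ∀ r ∈ Ioc a b, HasDerivAt g (g' r) r)
    (hfg : ∀ r ∈ Ioc a b, |f' r| ≤ g' r) : ∀ r ∈ Ioc a b, |f r| ≤ g r := by
  intro r hr
  have h1 := nonneg_of_tendsto_zero_of_deriv_nonneg (f := fun r => g r - f r)
    (by simpa using hg0.sub hf0) (fun r hr => (hg r hr).sub (hf r hr))
    (fun r hr => by have := abs_le.1 (hfg r hr); linarith) r hr
  have h2 := nonneg_of_tendsto_zero_of_deriv_nonneg (f := fun r => g r + f r)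
    (by simpa using hg0.add hf0) (fun r hr => (hg r hr).add (hf r hr))
    (fun r hr => by have := abs_le.1 (hfg r hr); linarith) r hr
  exact abs_le.2 ⟨by linarith, by linarith⟩

namespace StaticEYM.IsAdSBlackHole

variable {B : StaticEYM} {ωinf : ℝ}

theorem tendsto_N_mul_S_mul_deriv_ω_horizon (h : B.IsAdSBlackHole ωinf) :
    Tendsto (fun r => B.N r * B.S r * deriv B.ω r) (𝓝[>] B.rh) (𝓝 0) := by
  simpa using (h.tendsto_N_horizon.mul (tendsto_right h.S_regular.continuousOn)).mul
    h.tendsto_deriv_ω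

theorem tendsto_id_horizon (a : ℝ) : Tendsto (fun r : ℝ => r) (𝓝[>] a) (𝓝 a) :=
  tendsto_nhdsWithin_of_tendsto_nhds tendsto_id

/-- The flux NSω' vanishes at the horizon and its derivative is at most CS/r² in size. Because S is
nondecreasing, CS(1/rh - 1/r) grows at least that fast, and S then cancels. -/
theorem N_mul_abs_deriv_ω_le (h : B.IsAdSBlackHole ωinf) {C b : ℝ}
    (hC : ∀ r ∈ Ioc B.rh b, |B.ω r * (B.ω r ^ 2 - 1)| ≤ C) :
    ∀ r ∈ Ioc B.rh b, B.N r * |deriv B.ω r| ≤ C * (1 / B.rh - 1 / r) := by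
  have hrh := h.radius_pos
  intro r hr
  have hS := h.S_pos r hr.1.le
  have hN := h.exterior r hr.1
  have h1 : |B.N r * B.S r * deriv B.ω r| ≤ C * (B.S r * (1 / B.rh - 1 / r)) := by
    refine abs_le_of_abs_deriv_le (a := B.rh) (b := b)
      (f := fun r => B.N r * B.S r * deriv B.ω r)
      (g := fun r => C * (B.S r * (1 / B.rh - 1 / r)))
      (f' := fun r => B.S r * (B.ω r * (B.ω r ^ 2 - 1)) / r ^ 2)
      (g' := fun r => C * (2 * deriv B.ω r ^ 2 / r * B.S r * (1 / B.rh - 1 / r) + B.S r / r ^ 2))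
      h.tendsto_N_mul_S_mul_deriv_ω_horizon ?_
      (fun s hs => h.hasDerivAt_N_mul_S_mul_deriv_ω hs.1) ?_ ?_ r hr
    · have := ((tendsto_right h.S_regular.continuousOn).mul
        (((tendsto_const_nhds (x := (1 : ℝ))).div (tendsto_id_horizon B.rh) hrh.ne').const_sub
          (1 / B.rh))).const_mul C
      rw [sub_self, mul_zero, mul_zero] at this
      exact this
    · intro s hs
      have hs0 := (h.pos_of_le hs.1.le).ne'
      have h2 : HasDerivAt (fun s : ℝ => 1 / s) (-(s ^ 2)⁻¹) s := by
        simpa using hasDerivAt_inv hs0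
      refine (((h.hasDerivAt_S hs.1).mul (h2.const_sub (1 / B.rh))).const_mul C).congr_deriv ?_
      field_simp
    · intro s hs
      have hs0 := h.pos_of_le hs.1.le
      have hSs := h.S_pos s hs.1.le
      have hC0 : 0 ≤ C := (abs_nonneg _).trans (hC s hs)
      have h3 : 0 ≤ 1 / B.rh - 1 / s := sub_nonneg.2 (one_div_le_one_div_of_le hrh hs.1.le)
      rw [abs_div, abs_mul, abs_of_pos hSs, abs_of_pos (by positivity : 0 < s ^ 2), mul_add]
      have h4 : B.S s * |B.ω s * (B.ω s ^ 2 - 1)| / s ^ 2 ≤ C * (B.S s / s ^ 2) := by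
        rw [mul_comm, mul_div_assoc]
        exact mul_le_mul_of_nonneg_right (hC s hs) (by positivity)
      have h5 : 0 ≤ C * (2 * deriv B.ω s ^ 2 / s * B.S s * (1 / B.rh - 1 / s)) := by positivity
      linarith
  rw [abs_mul, abs_mul, abs_of_pos hN, abs_of_pos hS] at h1
  refine le_of_mul_le_mul_left ?_ hS
  linarith

/-- While `ω (ω² - 1)` and `(ω² - 1)²` stay bounded by `C` and `K`, the derivative `ω'` is of order
`|Λ|⁻¹ r⁻²`. -/
theorem abs_deriv_ω_le (h : B.IsAdSBlackHole ωinf) {C K b : ℝ}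
    (hC : ∀ r ∈ Ioc B.rh b, |B.ω r * (B.ω r ^ 2 - 1)| ≤ C)
    (hK : ∀ r ∈ Ioc B.rh b, (B.ω r ^ 2 - 1) ^ 2 ≤ K)
    (hL1 : 2 * K ≤ -B.Λ * B.rh ^ 4) (hL2 : 4 * C ≤ -B.Λ * B.rh ^ 3) :
    ∀ r ∈ Ioc B.rh b, |deriv B.ω r| ≤ 12 * C / (-B.Λ * B.rh) / r ^ 2 := by
  have hrh := h.radius_pos
  set L := -B.Λ with hLdef
  have hL : 0 < L := neg_pos.2 h.cosmological_neg
  -- The condition 2K ≤ L rh⁴ lets half of the cosmological term absorb the magnetic one.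
  have hlow : ∀ r ∈ Ioc B.rh b, L * r ^ 2 / 2 ≤ 1 + L * r ^ 2 - (B.ω r ^ 2 - 1) ^ 2 / r ^ 2 := by
    intro r hr
    have hr0 := h.pos_of_le hr.1.le
    have h1 : (B.ω r ^ 2 - 1) ^ 2 / r ^ 2 ≤ L * r ^ 2 / 2 := by
      rw [div_le_iff₀ (by positivity)]
      have h2 : B.rh ^ 4 ≤ r ^ 4 := pow_le_pow_left₀ hrh.le hr.1.le 4
      nlinarith [hK r hr]
    linarith
  have h1 := h.N_mul_abs_deriv_ω_le hC
  -- A crude bound, growing in r, from comparing the flux with a multiple of rNS; it serves only to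
  -- control the back-reaction of ω' on N.
  have h2 : ∀ r ∈ Ioc B.rh b, |deriv B.ω r| ≤ 2 * C / B.rh ^ 4 / L * r := by
    intro r hr
    have hS := h.S_pos r hr.1.le
    have hN := h.exterior r hr.1
    have h3 : |B.N r * B.S r * deriv B.ω r| ≤ 2 * C / B.rh ^ 4 / L * (r * (B.N r * B.S r)) := by
      refine abs_le_of_abs_deriv_le (a := B.rh) (b := b)
        (f := fun r => B.N r * B.S r * deriv B.ω r)
        (g := fun r => 2 * C / B.rh ^ 4 / L * (r * (B.N r * B.S r)))
        (f' := fun r => B.S r * (B.ω r * (B.ω r ^ 2 - 1)) / r ^ 2)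
        (g' := fun r => 2 * C / B.rh ^ 4 / L *
          (B.S r * (1 + L * r ^ 2 - (B.ω r ^ 2 - 1) ^ 2 / r ^ 2)))
        h.tendsto_N_mul_S_mul_deriv_ω_horizon ?_
        (fun s hs => h.hasDerivAt_N_mul_S_mul_deriv_ω hs.1) ?_ ?_ r hr
      · have := ((tendsto_id_horizon B.rh).mul (h.tendsto_N_horizon.mul
          (tendsto_right h.S_regular.continuousOn))).const_mul (2 * C / B.rh ^ 4 / L)
        rw [zero_mul, mul_zero, mul_zero] at this
        exact this
      · intro s hs
        have hs0 := (h.pos_of_le hs.1.le).ne'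
        refine (((hasDerivAt_id s).mul (h.hasDerivAt_N_mul_S hs.1)).const_mul _).congr_deriv ?_
        rw [hLdef]
        simp only [id]
        field_simp
        ring
      · intro s hs
        have hs0 := h.pos_of_le hs.1.le
        have hSs := h.S_pos s hs.1.le
        have hC0 : 0 ≤ C := (abs_nonneg _).trans (hC s hs)
        rw [abs_div, abs_mul, abs_of_pos hSs, abs_of_pos (by positivity : 0 < s ^ 2)]
        have h4 : 2 * C / B.rh ^ 4 / L * (B.S s * (L * s ^ 2 / 2))
            ≤ 2 * C / B.rh ^ 4 / L *
              (B.S s * (1 + L * s ^ 2 - (B.ω s ^ 2 - 1) ^ 2 / s ^ 2)) := by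
          gcongr
          exact hlow s hs
        refine le_trans ?_ h4
        have h5 : 2 * C / B.rh ^ 4 / L * (B.S s * (L * s ^ 2 / 2))
            = B.S s * (C * s ^ 4 / B.rh ^ 4) / s ^ 2 := by
          field_simp
        rw [h5]
        gcongr
        rw [le_div_iff₀ (by positivity)]
        have h6 : B.rh ^ 4 ≤ s ^ 4 := pow_le_pow_left₀ hrh.le hs.1.le 4
        exact mul_le_mul (hC s hs) h6 (by positivity) hC0
    rw [abs_mul, abs_of_pos (mul_pos hN hS)] at h3
    refine le_of_mul_le_mul_left ?_ (mul_pos hN hS)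
    linarith
  -- The term 2Nω'² in (rN)' costs at most Lr²/4, by the two preceding bounds and 4C ≤ L rh³. What
  -- remains is at least Lr²/4, the derivative of the comparison function.
  have h3 : ∀ r ∈ Ioc B.rh b, 0 ≤ r * B.N r - L / 12 * (r ^ 3 - B.rh ^ 3) := by
    refine nonneg_of_tendsto_zero_of_deriv_nonneg
      (f' := fun r => 1 + L * r ^ 2 - (B.ω r ^ 2 - 1) ^ 2 / r ^ 2 - 2 * B.N r * deriv B.ω r ^ 2
        - L * r ^ 2 / 4) ?_ ?_ ?_
    · have := ((tendsto_id_horizon B.rh).mul h.tendsto_N_horizon).sub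
        ((((tendsto_id_horizon B.rh).pow 3).sub_const (B.rh ^ 3)).const_mul (L / 12))
      rw [sub_self, mul_zero, mul_zero, sub_zero] at this
      exact this
    · intro s hs
      have hs0 := (h.pos_of_le hs.1.le).ne'
      refine (((hasDerivAt_id s).mul (h.hasDerivAt_N hs.1)).sub
        (((hasDerivAt_pow 3 s).sub_const _).const_mul (L / 12))).congr_deriv ?_
      rw [hLdef]
      simp only [id]
      field_simp
      ring
    · intro s hs
      have hs0 := h.pos_of_le hs.1.le
      have hC0 : 0 ≤ C := (abs_nonneg _).trans (hC s hs)
      have hN := h.exterior s hs.1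
      have e1 : B.N s * |deriv B.ω s| ≤ C / B.rh := by
        refine (h1 s hs).trans ?_
        rw [mul_sub, mul_one_div]
        have : 0 ≤ C * (1 / s) := by positivity
        linarith
      have e2 : B.N s * deriv B.ω s ^ 2 ≤ C / B.rh * (2 * C / B.rh ^ 4 / L * s) := by
        rw [← sq_abs, sq, ← mul_assoc]
        exact mul_le_mul e1 (h2 s hs) (abs_nonneg _) (by positivity)
      have e3 : C / B.rh * (2 * C / B.rh ^ 4 / L * s) ≤ L * s ^ 2 / 8 := by
        have e4 : C / B.rh * (2 * C / B.rh ^ 4 / L * s) = 2 * C ^ 2 * s / (B.rh ^ 5 * L) := by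
          field_simp
        rw [e4, div_le_iff₀ (by positivity)]
        have e5 : (4 * C) ^ 2 ≤ (L * B.rh ^ 3) ^ 2 := pow_le_pow_left₀ (by positivity) hL2 2
        have e6 : 16 * C ^ 2 ≤ L ^ 2 * B.rh ^ 5 * s := by
          have : L ^ 2 * B.rh ^ 5 * B.rh ≤ L ^ 2 * B.rh ^ 5 * s :=
            mul_le_mul_of_nonneg_left hs.1.le (by positivity)
          nlinarith
        nlinarith
      have := hlow s hs
      linarith
  intro r hr
  have hr0 := h.pos_of_le hr.1.le
  have hd : 0 < r - B.rh := sub_pos.2 hr.1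
  have e1 := h1 r hr
  have e2 := h3 r hr
  -- This lower bound and the flux bound share the factor r - rh, so their quotient is uniform down
  -- to the horizon.
  have e3 : L / 12 * (r * (r - B.rh)) ≤ B.N r := by
    refine le_of_mul_le_mul_left ?_ hr0
    have e4 : r ^ 2 * (r - B.rh) ≤ r ^ 3 - B.rh ^ 3 := by
      have : B.rh ^ 2 ≤ r ^ 2 := pow_le_pow_left₀ hrh.le hr.1.le 2
      nlinarith
    have e5 := mul_le_mul_of_nonneg_left e4 (by positivity : 0 ≤ L / 12)
    nlinarith
  have e4 : L / 12 * (r * (r - B.rh)) * |deriv B.ω r| ≤ C * (1 / B.rh - 1 / r) :=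
    (mul_le_mul_of_nonneg_right e3 (abs_nonneg _)).trans e1
  have e5 : C * (1 / B.rh - 1 / r)
      = L / 12 * (r * (r - B.rh)) * (12 * C / (L * B.rh) / r ^ 2) := by
    field_simp
  rw [e5] at e4
  exact le_of_mul_le_mul_left e4 (by positivity)

theorem abs_ω_sub_le (h : B.IsAdSBlackHole ωinf) {D b : ℝ} (hD0 : 0 ≤ D)
    (hD : ∀ r ∈ Ioc B.rh b, |deriv B.ω r| ≤ D / r ^ 2) :
    ∀ r ∈ Ioc B.rh b, |B.ω r - B.ω B.rh| ≤ D / B.rh := by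
  have hrh := h.radius_pos
  intro r hr
  have h1 : |B.ω r - B.ω B.rh| ≤ D * (1 / B.rh - 1 / r) := by
    refine abs_le_of_abs_deriv_le (a := B.rh) (b := b) (f := fun r => B.ω r - B.ω B.rh)
      (g := fun r => D * (1 / B.rh - 1 / r)) (f' := deriv B.ω) (g' := fun r => D / r ^ 2)
      ?_ ?_ (fun s hs => (h.hasDerivAt_ω hs.1).sub_const _) ?_ hD r hr
    · simpa using (tendsto_right h.ω_regular.continuousOn).sub_const (B.ω B.rh)
    · have := (((tendsto_const_nhds (x := (1 : ℝ))).div (tendsto_id_horizon B.rh)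
        hrh.ne').const_sub (1 / B.rh)).const_mul D
      rw [sub_self, mul_zero] at this
      exact this
    · intro s hs
      have hs0 := (h.pos_of_le hs.1.le).ne'
      have h2 : HasDerivAt (fun s : ℝ => 1 / s) (-(s ^ 2)⁻¹) s := by
        simpa using hasDerivAt_inv hs0
      refine ((h2.const_sub (1 / B.rh)).const_mul D).congr_deriv ?_
      field_simp
  have hr0 := h.pos_of_le hr.1.le
  have h2 : 0 ≤ D * (1 / r) := by positivity
  rw [mul_sub, mul_one_div] at h1
  linarith

/-- For `|Λ|` large the gauge field stays close to its value at the horizon. -/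
theorem abs_ω_sub_le_and_abs_deriv_ω_le (h : B.IsAdSBlackHole ωinf) {C K δ : ℝ} (hC0 : 0 ≤ C)
    (hC : ∀ x, |x - B.ω B.rh| ≤ δ → |x * (x ^ 2 - 1)| ≤ C)
    (hK : ∀ x, |x - B.ω B.rh| ≤ δ → (x ^ 2 - 1) ^ 2 ≤ K)
    (hL1 : 2 * K ≤ -B.Λ * B.rh ^ 4) (hL2 : 4 * C ≤ -B.Λ * B.rh ^ 3)
    (hL3 : 12 * C / (-B.Λ * B.rh) / B.rh < δ) {r : ℝ} (hr : B.rh < r) :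
    |B.ω r - B.ω B.rh| ≤ δ ∧ |deriv B.ω r| ≤ 12 * C / (-B.Λ * B.rh) / r ^ 2 := by
  have hrh := h.radius_pos
  have hL : 0 < -B.Λ := neg_pos.2 h.cosmological_neg
  have hD0 : 0 ≤ 12 * C / (-B.Λ * B.rh) := by positivity
  have hδ : 0 < δ := lt_of_le_of_lt (by positivity) hL3
  -- Continuity argument: before the first radius c where the deviation reaches δ the estimates
  -- apply, and they bound the deviation at c by a quantity smaller than δ.
  have hall : ∀ s, B.rh < s → |B.ω s - B.ω B.rh| < δ := by
    by_contra! hex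
    obtain ⟨b, hb, hbδ⟩ := hex
    have hcont : ContinuousOn (fun s => |B.ω s - B.ω B.rh|) (Icc B.rh b) :=
      ((h.ω_regular.continuousOn.mono Icc_subset_Ici_self).sub continuousOn_const).abs
    set T := Icc B.rh b ∩ (fun s => |B.ω s - B.ω B.rh|) ⁻¹' Ici δ
    have hT : IsCompact T := isCompact_Icc.of_isClosed_subset
      (hcont.preimage_isClosed_of_isClosed isClosed_Icc isClosed_Ici) inter_subset_left
    obtain ⟨c, hcT, hcmin⟩ := hT.exists_isLeast ⟨b, ⟨hb.le, le_rfl⟩, hbδ⟩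
    have hc : B.rh < c := by
      refine lt_of_le_of_ne hcT.1.1 fun he => ?_
      have := hcT.2
      rw [← he] at this
      simp only [mem_preimage, sub_self, abs_zero, mem_Ici] at this
      linarith
    have hlt : ∀ s, B.rh ≤ s → s < c → |B.ω s - B.ω B.rh| ≤ δ := fun s hs1 hs2 => by
      by_contra! hgt
      exact absurd (hcmin ⟨⟨hs1, hs2.le.trans hcT.1.2⟩, hgt.le⟩) (not_le.2 hs2)
    have hle : ∀ s, B.rh < s → s < c →
        |B.ω s - B.ω B.rh| ≤ 12 * C / (-B.Λ * B.rh) / B.rh := fun s hs1 hs2 => by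
      refine h.abs_ω_sub_le (b := s) hD0 (h.abs_deriv_ω_le (C := C) (K := K) ?_ ?_ hL1 hL2) s
        ⟨hs1, le_rfl⟩
      · exact fun t ht => hC _ (hlt t ht.1.le (ht.2.trans_lt hs2))
      · exact fun t ht => hK _ (hlt t ht.1.le (ht.2.trans_lt hs2))
    have hlim : Tendsto (fun s => |B.ω s - B.ω B.rh|) (𝓝[<] c) (𝓝 |B.ω c - B.ω B.rh|) :=
      (((h.hasDerivAt_ω hc).continuousAt.sub continuousAt_const).abs).mono_left
        nhdsWithin_le_nhds
    have h1 : |B.ω c - B.ω B.rh| ≤ 12 * C / (-B.Λ * B.rh) / B.rh := by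
      refine le_of_tendsto hlim ?_
      filter_upwards [Ioo_mem_nhdsLT hc] with s hs
      exact hle s hs.1 hs.2
    have h2 : δ ≤ |B.ω c - B.ω B.rh| := hcT.2
    linarith
  refine ⟨(hall r hr).le, h.abs_deriv_ω_le (b := r) ?_ ?_ hL1 hL2 r ⟨hr, le_rfl⟩⟩
  · exact fun t ht => hC _ (hall t ht.1).le
  · exact fun t ht => hK _ (hall t ht.1).le

end StaticEYM.IsAdSBlackHole

theorem abs_mul_sq_sub_one_le {x a : ℝ} (hx : |x| ≤ a) : |x * (x ^ 2 - 1)| ≤ a * (a ^ 2 + 1) := by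
  rw [abs_mul]
  have h1 : |x ^ 2 - 1| ≤ a ^ 2 + 1 := by
    have h2 : x ^ 2 ≤ a ^ 2 := sq_le_sq' (abs_le.1 hx).1 (abs_le.1 hx).2
    exact abs_le.2 ⟨by nlinarith [sq_nonneg x], by linarith⟩
  exact mul_le_mul hx h1 (abs_nonneg _) ((abs_nonneg _).trans hx)

theorem sq_sub_one_sq_le {x a : ℝ} (hx : |x| ≤ a) : (x ^ 2 - 1) ^ 2 ≤ (a ^ 2 + 1) ^ 2 := by
  have h2 : x ^ 2 ≤ a ^ 2 := sq_le_sq' (abs_le.1 hx).1 (abs_le.1 hx).2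
  exact sq_le_sq' (by nlinarith [sq_nonneg x]) (by linarith)

/-! ### Mean values over intervals starting at the horizon. -/

/-- The mean value of `f` on the interval between `a` and `r`. -/
noncomputable def intervalMean (a : ℝ) (f : ℝ → ℝ) (r : ℝ) : ℝ :=
  ∫ t in (0 : ℝ)..1, f (a + (r - a) * t)

theorem sub_mul_intervalMean (a : ℝ) (f : ℝ → ℝ) (r : ℝ) :
    (r - a) * intervalMean a f r = ∫ s in a..r, f s := by
  have := intervalIntegral.smul_integral_comp_add_mul (a := 0) (b := 1) f (r - a) a
  rw [smul_eq_mul] at this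
  rw [intervalMean, this]
  simp

/-- The integral over the fixed interval [0, 1] involves no division by r - a, so r = a is not
exceptional. -/
theorem continuous_intervalMean (a : ℝ) {f : ℝ → ℝ} (hf : Continuous f) :
    Continuous (intervalMean a f) :=
  intervalIntegral.continuous_parametric_intervalIntegral_of_continuous'
    (f := fun r t => f (a + (r - a) * t)) (by fun_prop) 0 1

theorem le_add_sub_mul {a r t : ℝ} (hr : a ≤ r) (ht : 0 ≤ t) : a ≤ a + (r - a) * t :=
  le_add_of_nonneg_right (mul_nonneg (sub_nonneg.2 hr) ht)

theorem intervalMean_congr {a r : ℝ} {f g : ℝ → ℝ} (hfg : EqOn f g (Ici a)) (hr : a ≤ r) :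
    intervalMean a f r = intervalMean a g r := by
  refine intervalIntegral.integral_congr fun t ht => hfg ?_
  rw [uIcc_of_le zero_le_one] at ht
  exact le_add_sub_mul hr ht.1

theorem intervalMean_mono {a r : ℝ} {f g : ℝ → ℝ} (hf : ContinuousOn f (Ici a))
    (hg : ContinuousOn g (Ici a)) (hfg : ∀ s, a ≤ s → f s ≤ g s) (hr : a ≤ r) :
    intervalMean a f r ≤ intervalMean a g r := by
  have hi : ∀ φ : ℝ → ℝ, ContinuousOn φ (Ici a) →
      IntervalIntegrable (fun t => φ (a + (r - a) * t)) volume 0 1 := fun φ hφ => by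
    refine ContinuousOn.intervalIntegrable (hφ.comp (by fun_prop) fun t ht => ?_)
    rw [uIcc_of_le zero_le_one] at ht
    exact le_add_sub_mul hr ht.1
  exact intervalIntegral.integral_mono_on zero_le_one (hi f hf) (hi g hg)
    fun t ht => hfg _ (le_add_sub_mul hr ht.1)

theorem abs_intervalMean_le {a r : ℝ} {f g : ℝ → ℝ} (hf : ContinuousOn f (Ici a))
    (hg : ContinuousOn g (Ici a)) (hfg : ∀ s, a ≤ s → |f s| ≤ g s) (hr : a ≤ r) :
    |intervalMean a f r| ≤ intervalMean a g r := by
  have h1 := intervalMean_mono hf hg (fun s hs => (le_abs_self _).trans (hfg s hs)) hr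
  have h2 := intervalMean_mono (f := fun s => -f s) hf.neg hg
    (fun s hs => (neg_le_abs _).trans (hfg s hs)) hr
  have h3 : intervalMean a (fun s => -f s) r = -intervalMean a f r :=
    intervalIntegral.integral_neg
  rw [h3] at h2
  exact abs_le.2 ⟨by linarith, h1⟩

theorem intervalMean_sub {a r : ℝ} {f g : ℝ → ℝ} (hf : Continuous f) (hg : Continuous g) :
    intervalMean a (fun s => f s - g s) r = intervalMean a f r - intervalMean a g r := by
  refine intervalIntegral.integral_sub ?_ ?_
  · exact (hf.comp (by fun_prop)).intervalIntegrable _ _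
  · exact (hg.comp (by fun_prop)).intervalIntegrable _ _

theorem intervalMean_inv_sq {a r c : ℝ} (ha : 0 < a) (hr : a ≤ r) :
    intervalMean a (fun s => c / s ^ 2) r = c / (a * r) := by
  have hr0 := ha.trans_le hr
  -- This antiderivative contains no 1/(r - a), so it also covers r = a.
  have hd : ∀ t ∈ uIcc (0 : ℝ) 1, HasDerivAt (fun t => c * t / (a * (a + (r - a) * t)))
      (c / (a + (r - a) * t) ^ 2) t := fun t ht => by
    rw [uIcc_of_le zero_le_one] at ht
    have h0 : a + (r - a) * t ≠ 0 := (ha.trans_le (le_add_sub_mul hr ht.1)).ne'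
    have h1 : HasDerivAt (fun t => a * (a + (r - a) * t)) (a * ((r - a) * 1)) t :=
      (((hasDerivAt_id t).const_mul (r - a)).const_add a).const_mul a
    refine (((hasDerivAt_id t).const_mul c).div h1 (mul_ne_zero ha.ne' h0)).congr_deriv ?_
    simp only [id]
    field_simp
    ring
  have hi : IntervalIntegrable (fun t => c / (a + (r - a) * t) ^ 2) volume 0 1 := by
    refine ContinuousOn.intervalIntegrable ?_
    refine continuousOn_const.div (by fun_prop) fun t ht => ?_
    rw [uIcc_of_le zero_le_one] at ht
    exact pow_ne_zero 2 (ha.trans_le (le_add_sub_mul hr ht.1)).ne'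
  rw [intervalMean, intervalIntegral.integral_eq_sub_of_hasDerivAt hd hi,
    show a + (r - a) * 1 = r by ring]
  field_simp
  ring

theorem intervalMean_sq {a r c : ℝ} :
    intervalMean a (fun s => c * s ^ 2) r = c * ((a ^ 2 + a * r + r ^ 2) / 3) := by
  have hd : ∀ t ∈ uIcc (0 : ℝ) 1, HasDerivAt
      (fun t => c * (a ^ 2 * t + a * (r - a) * t ^ 2 + (r - a) ^ 2 / 3 * t ^ 3))
      (c * (a + (r - a) * t) ^ 2) t := fun t _ => by
    refine (((((hasDerivAt_id t).const_mul (a ^ 2)).add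
      ((hasDerivAt_pow 2 t).const_mul (a * (r - a)))).add
      ((hasDerivAt_pow 3 t).const_mul ((r - a) ^ 2 / 3))).const_mul c).congr_deriv ?_
    ring
  have hi : IntervalIntegrable (fun t => c * (a + (r - a) * t) ^ 2) volume 0 1 :=
    Continuous.intervalIntegrable (by fun_prop) _ _
  rw [intervalMean, intervalIntegral.integral_eq_sub_of_hasDerivAt hd hi]
  ring

/-- Differentiation under the integral sign, with a constant dominating function obtained by
compactness. -/
theorem contDiff_one_intervalMean {a : ℝ} {f f' : ℝ → ℝ} (hf : ∀ r, HasDerivAt f (f' r) r)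
    (hf' : Continuous f') : ContDiff ℝ 1 (intervalMean a f) := by
  have hfc : Continuous f := continuous_iff_continuousAt.2 fun r => (hf r).continuousAt
  have hd : ∀ r, HasDerivAt (intervalMean a f)
      (∫ t in (0 : ℝ)..1, f' (a + (r - a) * t) * t) r := by
    intro r
    have hK : IsCompact (Metric.closedBall r 1 ×ˢ Icc (0 : ℝ) 1) :=
      (isCompact_closedBall r 1).prod isCompact_Icc
    obtain ⟨C, hC⟩ := hK.exists_bound_of_continuousOn
      (f := fun q : ℝ × ℝ => f' (a + (q.1 - a) * q.2) * q.2)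
      (by fun_prop)
    refine (intervalIntegral.hasDerivAt_integral_of_dominated_loc_of_deriv_le
      (F := fun x t => f (a + (x - a) * t)) (F' := fun x t => f' (a + (x - a) * t) * t)
      (bound := fun _ => C) (Metric.closedBall_mem_nhds r one_pos) ?_ ?_ ?_ ?_ ?_ ?_).2
    · exact Eventually.of_forall fun x => Continuous.aestronglyMeasurable (by fun_prop)
    · exact Continuous.intervalIntegrable (by fun_prop) _ _
    · exact Continuous.aestronglyMeasurable (by fun_prop)
    · refine Eventually.of_forall fun t ht x hx => hC (x, t) ⟨hx, ?_⟩
      rw [uIoc_of_le zero_le_one] at ht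
      exact ⟨ht.1.le, ht.2⟩
    · exact intervalIntegrable_const
    · refine Eventually.of_forall fun t _ x _ => ?_
      have h1 : HasDerivAt (fun x => a + (x - a) * t) (1 * t) x :=
        (((hasDerivAt_id x).sub_const a).mul_const t).const_add a
      exact ((hf _).comp x h1).congr_deriv (by rw [one_mul])
  rw [contDiff_one_iff_deriv]
  refine ⟨fun r => (hd r).differentiableAt, ?_⟩
  have e : deriv (intervalMean a f) = fun r => ∫ t in (0 : ℝ)..1, f' (a + (r - a) * t) * t :=
    funext fun r => (hd r).deriv
  rw [e]
  exact intervalIntegral.continuous_parametric_intervalIntegral_of_continuous'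
    (f := fun r t => f' (a + (r - a) * t) * t) (by fun_prop) 0 1

/-- The mean value over `[a, r]` of a function that is `C¹` on `[a, ∞)` is a `C¹` function of `r`,
up to and including `r = a`. -/
theorem contDiffOn_one_intervalMean {a : ℝ} {f : ℝ → ℝ} (hf : ContDiffOn ℝ 1 f (Ici a)) :
    ContDiffOn ℝ 1 (intervalMean a f) (Ici a) := by
  obtain ⟨hd, hc⟩ := (contDiffOn_one_iff_derivWithin (uniqueDiffOn_Ici a)).1 hf
  -- Extending the derivative constantly to the left of a yields a C¹ function on the whole line
  -- that agrees with f on [a, ∞).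
  set f' : ℝ → ℝ := fun r => derivWithin f (Ici a) (max a r) with hf'
  have hf'c : Continuous f' :=
    hc.comp_continuous (by fun_prop) fun r => le_max_left a r
  set f1 : ℝ → ℝ := fun r => f a + ∫ s in a..r, f' s
  have hf1 : ∀ r, HasDerivAt f1 (f' r) r := fun r =>
    (hf'c.integral_hasStrictDerivAt a r).hasDerivAt.const_add _
  have heq : EqOn f f1 (Ici a) := by
    intro r hr
    have h1 : ∫ s in a..r, f' s = f r - f a := by
      refine intervalIntegral.integral_eq_sub_of_hasDerivAt_of_le hr
        (hf.continuousOn.mono Icc_subset_Ici_self) (fun s hs => ?_)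
        (hf'c.intervalIntegrable _ _)
      have h2 := (hd s hs.1.le).hasDerivWithinAt.hasDerivAt (Ici_mem_nhds hs.1)
      simp only [hf', max_eq_right hs.1.le]
      exact h2
    simp only [f1, h1]
    ring
  exact (contDiff_one_intervalMean hf1 hf'c).contDiffOn.congr
    fun r hr => intervalMean_congr heq hr

theorem contDiffOn_two_of_hasDerivWithinAt {a : ℝ} {f f' : ℝ → ℝ}
    (hf : ∀ r, a ≤ r → HasDerivWithinAt f (f' r) (Ici a) r) (hf' : ContDiffOn ℝ 1 f' (Ici a)) :
    ContDiffOn ℝ 2 f (Ici a) := by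
  have h1 : ContDiffOn ℝ (1 + 1) f (Ici a) := by
    refine (contDiffOn_succ_iff_derivWithin (uniqueDiffOn_Ici a)).2
      ⟨fun r hr => (hf r hr).differentiableWithinAt, by simp, hf'.congr fun r hr => ?_⟩
    exact (hf r hr).derivWithin (uniqueDiffOn_Ici a r hr)
  exact h1.of_le (by norm_num)

/-- The mean of c/s² over [a, r] is c/(ar) and the length is at most r, so the bound is uniform in
r. -/
theorem abs_integral_le_of_abs_le_div_sq {a c r : ℝ} {φ : ℝ → ℝ} (ha : 0 < a)
    (hφ : Continuous φ) (hb : ∀ s, a ≤ s → |φ s| ≤ c / s ^ 2) (hr : a ≤ r) :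
    |∫ s in a..r, φ s| ≤ c / a := by
  have hr0 := ha.trans_le hr
  have hc : 0 ≤ c := by
    have h1 := (abs_nonneg _).trans (hb a le_rfl)
    by_contra! h2
    exact absurd h1 (not_le.2 (div_neg_of_neg_of_pos h2 (by positivity)))
  have h1 : |intervalMean a φ r| ≤ c / (a * r) := by
    rw [← intervalMean_inv_sq ha hr]
    refine abs_intervalMean_le hφ.continuousOn ?_ hb hr
    exact continuousOn_const.div (by fun_prop) fun s hs =>
      pow_ne_zero 2 (ha.trans_le hs).ne'
  rw [← sub_mul_intervalMean, abs_mul, abs_of_nonneg (sub_nonneg.2 hr)]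
  have h2 : (r - a) * |intervalMean a φ r| ≤ r * (c / (a * r)) :=
    mul_le_mul (by linarith) h1 (abs_nonneg _) hr0.le
  have h3 : r * (c / (a * r)) = c / a := by field_simp
  linarith

/-- The quotient of two mean values depends in a Lipschitz way on the two functions. -/
theorem abs_pow_mul_intervalMean_div_sub_le {a L F F' G' d r : ℝ} {f₁ f₂ g₁ g₂ : ℝ → ℝ}
    (ha : 0 < a) (hL : 0 < L) (hF : 0 ≤ F) (hF' : 0 ≤ F') (hG' : 0 ≤ G') (hd : 0 ≤ d)
    (hf₁c : Continuous f₁) (hf₂c : Continuous f₂) (hg₁c : Continuous g₁) (hg₂c : Continuous g₂)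
    (hf₂ : ∀ s, a ≤ s → |f₂ s| ≤ F / s ^ 2)
    (hf : ∀ s, a ≤ s → |f₁ s - f₂ s| ≤ F' * d / s ^ 2)
    (hg₁ : ∀ s, a ≤ s → L / 2 * s ^ 2 ≤ g₁ s) (hg₂ : ∀ s, a ≤ s → L / 2 * s ^ 2 ≤ g₂ s)
    (hg : ∀ s, a ≤ s → |g₁ s - g₂ s| ≤ G' * d * L * s ^ 2) (hr : a ≤ r) :
    |r ^ 3 * intervalMean a f₁ r / intervalMean a g₁ r
        - r ^ 3 * intervalMean a f₂ r / intervalMean a g₂ r|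
      ≤ 3 / a * (2 * F' + 4 * F * G') / L * d := by
  have hr0 := ha.trans_le hr
  -- J is the mean of s² over [a, r]. The bound J ≥ r²/3 is what absorbs the weight r³.
  set J := (a ^ 2 + a * r + r ^ 2) / 3 with hJ
  have hJ0 : 0 < J := by positivity
  have hJr : r ^ 2 / 3 ≤ J := by
    rw [hJ]
    have : 0 ≤ a ^ 2 + a * r := by positivity
    linarith
  have hcs : ∀ c : ℝ, ContinuousOn (fun s : ℝ => c / s ^ 2) (Ici a) := fun c =>
    continuousOn_const.div (by fun_prop) fun s hs => pow_ne_zero 2 (ha.trans_le hs).ne'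
  have e1 : |intervalMean a f₂ r| ≤ F / (a * r) := by
    rw [← intervalMean_inv_sq ha hr]
    exact abs_intervalMean_le hf₂c.continuousOn (hcs _) hf₂ hr
  have e2 : |intervalMean a f₁ r - intervalMean a f₂ r| ≤ F' * d / (a * r) := by
    rw [← intervalMean_inv_sq ha hr, ← intervalMean_sub hf₁c hf₂c]
    exact abs_intervalMean_le (hf₁c.sub hf₂c).continuousOn (hcs _) hf hr
  have e3 : L / 2 * J ≤ intervalMean a g₁ r := by
    rw [hJ, ← intervalMean_sq]
    exact intervalMean_mono (by fun_prop) hg₁c.continuousOn hg₁ hr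
  have e4 : L / 2 * J ≤ intervalMean a g₂ r := by
    rw [hJ, ← intervalMean_sq]
    exact intervalMean_mono (by fun_prop) hg₂c.continuousOn hg₂ hr
  have e5 : |intervalMean a g₁ r - intervalMean a g₂ r| ≤ G' * d * L * J := by
    rw [hJ, ← intervalMean_sq, ← intervalMean_sub hg₁c hg₂c]
    exact abs_intervalMean_le (hg₁c.sub hg₂c).continuousOn (by fun_prop) hg hr
  set A₁ := intervalMean a f₁ r
  set A₂ := intervalMean a f₂ r
  set D₁ := intervalMean a g₁ r
  set D₂ := intervalMean a g₂ r
  have hLJ : 0 < L / 2 * J := by positivity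
  have hD₁ : 0 < D₁ := hLJ.trans_le e3
  have hD₂ : 0 < D₂ := hLJ.trans_le e4
  have h1 : r ^ 3 * A₁ / D₁ - r ^ 3 * A₂ / D₂
      = r ^ 3 * ((A₁ - A₂) / D₁) - r ^ 3 * (A₂ * (D₁ - D₂) / (D₁ * D₂)) := by
    field_simp
    ring
  have h2 : |(A₁ - A₂) / D₁| ≤ F' * d / (a * r) / (L / 2 * J) := by
    rw [abs_div, abs_of_pos hD₁]
    exact div_le_div₀ (by positivity) e2 hLJ e3
  have h3 : |A₂ * (D₁ - D₂) / (D₁ * D₂)|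
      ≤ F / (a * r) * (G' * d * L * J) / (L / 2 * J * (L / 2 * J)) := by
    rw [abs_div, abs_mul, abs_of_pos (mul_pos hD₁ hD₂)]
    exact div_le_div₀ (by positivity) (mul_le_mul e1 e5 (abs_nonneg _) (by positivity))
      (by positivity) (mul_le_mul e3 e4 hLJ.le hD₁.le)
  rw [h1]
  refine (abs_sub _ _).trans ?_
  rw [abs_mul, abs_mul, abs_of_pos (by positivity : 0 < r ^ 3)]
  have h4 : r ^ 3 * |(A₁ - A₂) / D₁| + r ^ 3 * |A₂ * (D₁ - D₂) / (D₁ * D₂)|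
      ≤ r ^ 3 * (F' * d / (a * r) / (L / 2 * J))
        + r ^ 3 * (F / (a * r) * (G' * d * L * J) / (L / 2 * J * (L / 2 * J))) := by
    gcongr
  refine h4.trans ?_
  have h5 : r ^ 3 * (F' * d / (a * r) / (L / 2 * J))
        + r ^ 3 * (F / (a * r) * (G' * d * L * J) / (L / 2 * J * (L / 2 * J)))
      = r ^ 2 / J * ((2 * F' + 4 * F * G') / (a * L) * d) := by
    field_simp
    ring
  have h6 : 3 / a * (2 * F' + 4 * F * G') / L * d
      = 3 * ((2 * F' + 4 * F * G') / (a * L) * d) := by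
    field_simp
  rw [h5, h6]
  refine mul_le_mul_of_nonneg_right ?_ (by positivity)
  rw [div_le_iff₀ hJ0]
  linarith

/-- The numerator mean is at most F/(ar) and the denominator mean at least Lr²/6, so the weight r³
is exactly balanced and a factor 1/L remains. -/
theorem abs_pow_mul_intervalMean_div_le {a L F r : ℝ} {f g : ℝ → ℝ} (ha : 0 < a) (hL : 0 < L)
    (hfc : Continuous f) (hgc : Continuous g)
    (hf : ∀ s, a ≤ s → |f s| ≤ F / s ^ 2) (hg : ∀ s, a ≤ s → L / 2 * s ^ 2 ≤ g s) (hr : a ≤ r) :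
    0 < intervalMean a g r ∧
      |r ^ 3 * intervalMean a f r / intervalMean a g r| ≤ 6 * F / (a * L) := by
  have hr0 := ha.trans_le hr
  set J := (a ^ 2 + a * r + r ^ 2) / 3 with hJ
  have hJ0 : 0 < J := by positivity
  have hJr : r ^ 2 / 3 ≤ J := by
    rw [hJ]
    have : 0 ≤ a ^ 2 + a * r := by positivity
    linarith
  have e1 : |intervalMean a f r| ≤ F / (a * r) := by
    rw [← intervalMean_inv_sq ha hr]
    exact abs_intervalMean_le hfc.continuousOn (continuousOn_const.div (by fun_prop)
      fun s hs => pow_ne_zero 2 (ha.trans_le hs).ne') hf hr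
  have e3 : L / 2 * J ≤ intervalMean a g r := by
    rw [hJ, ← intervalMean_sq]
    exact intervalMean_mono (by fun_prop) hgc.continuousOn hg hr
  have hLJ : 0 < L / 2 * J := by positivity
  have hF : 0 ≤ F := by
    have h1 := (abs_nonneg _).trans e1
    have h2 := mul_nonneg h1 (by positivity : 0 ≤ a * r)
    rwa [div_mul_cancel₀ _ (by positivity)] at h2
  refine ⟨hLJ.trans_le e3, ?_⟩
  rw [abs_div, abs_mul, abs_of_pos (by positivity : 0 < r ^ 3), abs_of_pos (hLJ.trans_le e3)]
  have h1 : r ^ 3 * |intervalMean a f r| / intervalMean a g r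
      ≤ r ^ 3 * (F / (a * r)) / (L / 2 * J) := by gcongr
  refine h1.trans ?_
  have h2 : r ^ 3 * (F / (a * r)) / (L / 2 * J) = r ^ 2 / J * (2 * F / (a * L)) := by
    field_simp
  have h3 : 6 * F / (a * L) = 3 * (2 * F / (a * L)) := by ring
  rw [h2, h3]
  refine mul_le_mul_of_nonneg_right ?_ (by positivity)
  rw [div_le_iff₀ hJ0]
  linarith

/-! ### The fixed point map and its contraction estimates. -/

noncomputable section

/-- The profile `ω'` determined by `w = r² ω'`, with `w` truncated to `[-1, 1]`. -/
def profileDeriv (a : ℝ) (w : ℝ → ℝ) (r : ℝ) : ℝ := max (-1) (min 1 (w r)) / max a r ^ 2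

def profile (a ω₀ : ℝ) (w : ℝ → ℝ) (r : ℝ) : ℝ := ω₀ + ∫ s in a..r, profileDeriv a w s

/-- Integrates S'/S = 2ω'²/r from S = 1 at the horizon; the normalization at infinity is imposed
afterwards. Using `max a s` keeps the integrand continuous on the whole line. -/
def logLapse (a : ℝ) (w : ℝ → ℝ) (r : ℝ) : ℝ :=
  ∫ s in a..r, 2 * profileDeriv a w s ^ 2 / max a s

def lapse (a : ℝ) (w : ℝ → ℝ) (r : ℝ) : ℝ := Real.exp (logLapse a w r)

/-- The derivative of `N S ω'`. -/
def fluxDensity (a ω₀ : ℝ) (w : ℝ → ℝ) (r : ℝ) : ℝ :=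
  lapse a w r * (profile a ω₀ w r * (profile a ω₀ w r ^ 2 - 1)) / max a r ^ 2

/-- The derivative of `r N S`. -/
def metricDensity (a ω₀ L : ℝ) (w : ℝ → ℝ) (r : ℝ) : ℝ :=
  lapse a w r * (1 + L * max a r ^ 2 - (profile a ω₀ w r ^ 2 - 1) ^ 2 / max a r ^ 2)

/-- The map whose fixed points are the functions `r² ω'` of solutions regular at `r = a`. -/
def profileMap (a ω₀ L : ℝ) (w : ℝ → ℝ) (r : ℝ) : ℝ :=
  max a r ^ 3 * intervalMean a (fluxDensity a ω₀ w) (max a r)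
    / intervalMean a (metricDensity a ω₀ L w) (max a r)

section estimates

variable {a ω₀ L : ℝ} {w w₁ w₂ : ℝ → ℝ}

theorem max_left_pos (ha : 0 < a) (r : ℝ) : 0 < max a r := lt_max_of_lt_left ha

theorem continuous_profileDeriv (ha : 0 < a) (hw : Continuous w) :
    Continuous (profileDeriv a w) :=
  Continuous.div (by fun_prop) (by fun_prop) fun r => pow_ne_zero 2 (max_left_pos ha r).ne'

theorem abs_profileDeriv_le {r : ℝ} (hr : a ≤ r) : |profileDeriv a w r| ≤ 1 / r ^ 2 := by
  rw [profileDeriv, max_eq_right hr, abs_div, abs_of_nonneg (sq_nonneg r)]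
  refine div_le_div_of_nonneg_right (abs_le.2 ⟨le_max_left _ _, ?_⟩) (sq_nonneg r)
  exact max_le (by norm_num) (min_le_left _ _)

theorem abs_profileDeriv_sub_le {d r : ℝ} (hd : |w₁ r - w₂ r| ≤ d) (hr : a ≤ r) :
    |profileDeriv a w₁ r - profileDeriv a w₂ r| ≤ d / r ^ 2 := by
  rw [profileDeriv, profileDeriv, max_eq_right hr, ← sub_div, abs_div,
    abs_of_nonneg (sq_nonneg r)]
  refine div_le_div_of_nonneg_right (le_trans ?_ hd) (sq_nonneg r)
  have h1 := abs_max_sub_max_le_max (-1) (min 1 (w₁ r)) (-1) (min 1 (w₂ r))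
  have h2 := abs_min_sub_min_le_max 1 (w₁ r) 1 (w₂ r)
  simp only [sub_self, abs_zero] at h1 h2
  refine h1.trans (max_le (abs_nonneg _) (h2.trans (max_le (abs_nonneg _) le_rfl)))

theorem hasDerivAt_profile (ha : 0 < a) (hw : Continuous w) (r : ℝ) :
    HasDerivAt (profile a ω₀ w) (profileDeriv a w r) r :=
  ((continuous_profileDeriv ha hw).integral_hasStrictDerivAt a r).hasDerivAt.const_add _

theorem continuous_profile (ha : 0 < a) (hw : Continuous w) : Continuous (profile a ω₀ w) :=
  continuous_iff_continuousAt.2 fun r => (hasDerivAt_profile ha hw r).continuousAt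

theorem continuous_logLapse_integrand (ha : 0 < a) (hw : Continuous w) :
    Continuous fun s => 2 * profileDeriv a w s ^ 2 / max a s :=
  Continuous.div (continuous_const.mul ((continuous_profileDeriv ha hw).pow 2)) (by fun_prop)
    fun r => (max_left_pos ha r).ne'

theorem hasDerivAt_lapse (ha : 0 < a) (hw : Continuous w) (r : ℝ) :
    HasDerivAt (lapse a w) (lapse a w r * (2 * profileDeriv a w r ^ 2 / max a r)) r :=
  ((continuous_logLapse_integrand ha hw).integral_hasStrictDerivAt a r).hasDerivAt.exp

theorem continuous_lapse (ha : 0 < a) (hw : Continuous w) : Continuous (lapse a w) :=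
  continuous_iff_continuousAt.2 fun r => (hasDerivAt_lapse ha hw r).continuousAt

theorem continuous_fluxDensity (ha : 0 < a) (hw : Continuous w) :
    Continuous (fluxDensity a ω₀ w) := by
  have h1 := continuous_profile (ω₀ := ω₀) ha hw
  exact ((continuous_lapse ha hw).mul (h1.mul ((h1.pow 2).sub continuous_const))).div
    (by fun_prop) fun r => pow_ne_zero 2 (max_left_pos ha r).ne'

theorem continuous_metricDensity (ha : 0 < a) (hw : Continuous w) :
    Continuous (metricDensity a ω₀ L w) := by
  have h1 := continuous_profile (ω₀ := ω₀) ha hw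
  refine (continuous_lapse ha hw).mul (Continuous.sub (by fun_prop)
    ((((h1.pow 2).sub continuous_const).pow 2).div (by fun_prop) fun r => ?_))
  exact pow_ne_zero 2 (max_left_pos ha r).ne'

theorem abs_profile_le (ha : 0 < a) (hw : Continuous w) {r : ℝ} (hr : a ≤ r) :
    |profile a ω₀ w r| ≤ |ω₀| + 1 / a :=
  (abs_add_le _ _).trans (add_le_add_right (abs_integral_le_of_abs_le_div_sq ha
    (continuous_profileDeriv ha hw) (fun _ hs => abs_profileDeriv_le hs) hr) _)

theorem abs_profile_sub_le (ha : 0 < a) (hw₁ : Continuous w₁) (hw₂ : Continuous w₂) {d : ℝ}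
    (hd : ∀ s, |w₁ s - w₂ s| ≤ d) {r : ℝ} (hr : a ≤ r) :
    |profile a ω₀ w₁ r - profile a ω₀ w₂ r| ≤ d / a := by
  have h1 := continuous_profileDeriv ha hw₁
  have h2 := continuous_profileDeriv ha hw₂
  rw [profile, profile, add_sub_add_left_eq_sub, ← intervalIntegral.integral_sub
    (h1.intervalIntegrable _ _) (h2.intervalIntegrable _ _)]
  exact abs_integral_le_of_abs_le_div_sq ha (h1.sub h2)
    (fun s hs => abs_profileDeriv_sub_le (hd s) hs) hr

/-- Common to the bound on `logLapse` and its Lipschitz estimate: the decay s⁻⁵ is weakened to s⁻²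
at the price of a⁻³. -/
theorem abs_two_mul_sq_div_le {a c s x y : ℝ} (ha : 0 < a) (hs : a ≤ s) (hx : |x| ≤ c / s ^ 2)
    (hy : |y| ≤ 2 / s ^ 2) : |2 * (x * y) / s| ≤ 4 * c / a ^ 3 / s ^ 2 := by
  have hs0 := ha.trans_le hs
  have hc : 0 ≤ c / s ^ 2 := (abs_nonneg _).trans hx
  rw [abs_div, abs_mul, abs_mul, abs_two, abs_of_pos hs0]
  have h1 : 2 * (|x| * |y|) / s ≤ 2 * (c / s ^ 2 * (2 / s ^ 2)) / s := by gcongr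
  refine h1.trans ?_
  have h2 : 2 * (c / s ^ 2 * (2 / s ^ 2)) / s = 4 * (c / s ^ 2) / s ^ 3 := by
    field_simp
    ring
  have h3 : 4 * c / a ^ 3 / s ^ 2 = 4 * (c / s ^ 2) / a ^ 3 := by
    field_simp
  rw [h2, h3]
  gcongr

theorem logLapse_nonneg (ha : 0 < a) {r : ℝ} (hr : a ≤ r) : 0 ≤ logLapse a w r :=
  intervalIntegral.integral_nonneg hr fun s _ => by
    have := max_left_pos ha s
    positivity

theorem logLapse_le (ha : 0 < a) (hw : Continuous w) {r : ℝ} (hr : a ≤ r) :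
    logLapse a w r ≤ 4 / a ^ 4 := by
  refine (le_abs_self _).trans ((abs_integral_le_of_abs_le_div_sq (c := 4 * 1 / a ^ 3) ha
    (continuous_logLapse_integrand ha hw) (fun s hs => ?_) hr).trans (le_of_eq ?_))
  · have h1 := abs_profileDeriv_le (w := w) hs
    have hs0 := ha.trans_le hs
    rw [max_eq_right hs, sq]
    exact abs_two_mul_sq_div_le ha hs h1 (h1.trans (by gcongr; norm_num))
  · field_simp

theorem abs_logLapse_sub_le (ha : 0 < a) (hw₁ : Continuous w₁) (hw₂ : Continuous w₂) {d : ℝ}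
    (hd : ∀ s, |w₁ s - w₂ s| ≤ d) {r : ℝ} (hr : a ≤ r) :
    |logLapse a w₁ r - logLapse a w₂ r| ≤ 4 * d / a ^ 4 := by
  have h1 := continuous_logLapse_integrand ha hw₁
  have h2 := continuous_logLapse_integrand ha hw₂
  rw [logLapse, logLapse, ← intervalIntegral.integral_sub
    (h1.intervalIntegrable _ _) (h2.intervalIntegrable _ _)]
  refine (abs_integral_le_of_abs_le_div_sq (c := 4 * d / a ^ 3) ha (h1.sub h2)
    (fun s hs => ?_) hr).trans (le_of_eq ?_)
  · have h1 := abs_profileDeriv_le (w := w₁) hs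
    have h2 := abs_profileDeriv_le (w := w₂) hs
    have hs0 := ha.trans_le hs
    rw [Pi.sub_apply, max_eq_right hs, ← sub_div, ← mul_sub, sq_sub_sq, mul_comm (_ + _)]
    refine abs_two_mul_sq_div_le ha hs (abs_profileDeriv_sub_le (hd s) hs) ?_
    have h3 := (abs_add_le (profileDeriv a w₁ s) (profileDeriv a w₂ s)).trans (add_le_add h1 h2)
    refine h3.trans (le_of_eq ?_)
    ring
  · field_simp

theorem one_le_lapse (ha : 0 < a) {r : ℝ} (hr : a ≤ r) : 1 ≤ lapse a w r :=
  Real.one_le_exp (logLapse_nonneg ha hr)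

theorem lapse_le (ha : 0 < a) (hw : Continuous w) {r : ℝ} (hr : a ≤ r) :
    lapse a w r ≤ Real.exp (4 / a ^ 4) :=
  Real.exp_le_exp.2 (logLapse_le ha hw hr)

theorem abs_exp_sub_exp_le {x y M : ℝ} (hx : x ≤ M) (hy : y ≤ M) :
    |Real.exp x - Real.exp y| ≤ Real.exp M * |x - y| := by
  wlog hxy : y ≤ x generalizing x y
  · rw [abs_sub_comm, abs_sub_comm x]
    exact this hy hx (le_of_not_ge hxy)
  rw [abs_of_nonneg (sub_nonneg.2 (Real.exp_le_exp.2 hxy)), abs_of_nonneg (sub_nonneg.2 hxy)]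
  -- Then exp(y - x) ≥ 1 + y - x bounds the difference by exp(x)(x - y).
  have h1 : Real.exp y = Real.exp x * Real.exp (y - x) := by
    rw [← Real.exp_add]
    ring_nf
  have h2 := Real.add_one_le_exp (y - x)
  have h3 := Real.exp_le_exp.2 hx
  have h4 := Real.exp_pos x
  rw [h1]
  nlinarith [mul_le_mul_of_nonneg_left h2 h4.le, mul_le_mul_of_nonneg_right h3 (sub_nonneg.2 hxy)]

theorem abs_lapse_sub_le (ha : 0 < a) (hw₁ : Continuous w₁) (hw₂ : Continuous w₂) {d : ℝ}
    (hd : ∀ s, |w₁ s - w₂ s| ≤ d) {r : ℝ} (hr : a ≤ r) :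
    |lapse a w₁ r - lapse a w₂ r| ≤ Real.exp (4 / a ^ 4) * (4 * d / a ^ 4) :=
  (abs_exp_sub_exp_le (logLapse_le ha hw₁ hr) (logLapse_le ha hw₂ hr)).trans
    (mul_le_mul_of_nonneg_left (abs_logLapse_sub_le ha hw₁ hw₂ hd hr) (Real.exp_pos _).le)

theorem abs_mul_sq_sub_one_sub_le {x y W : ℝ} (hx : |x| ≤ W) (hy : |y| ≤ W) :
    |x * (x ^ 2 - 1) - y * (y ^ 2 - 1)| ≤ (3 * W ^ 2 + 1) * |x - y| := by
  have h1 : x * (x ^ 2 - 1) - y * (y ^ 2 - 1) = (x ^ 2 + x * y + y ^ 2 - 1) * (x - y) := by ring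
  rw [h1, abs_mul]
  refine mul_le_mul_of_nonneg_right ?_ (abs_nonneg _)
  have hx' : x ^ 2 ≤ W ^ 2 := sq_le_sq' (abs_le.1 hx).1 (abs_le.1 hx).2
  have hy' : y ^ 2 ≤ W ^ 2 := sq_le_sq' (abs_le.1 hy).1 (abs_le.1 hy).2
  exact abs_le.2 ⟨by nlinarith [sq_nonneg (x + y), sq_nonneg x, sq_nonneg y],
    by nlinarith [sq_nonneg (x - y)]⟩

theorem abs_sq_sub_one_sq_sub_le {x y W : ℝ} (hx : |x| ≤ W) (hy : |y| ≤ W) :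
    |(x ^ 2 - 1) ^ 2 - (y ^ 2 - 1) ^ 2| ≤ 4 * W * (W ^ 2 + 1) * |x - y| := by
  have h1 : (x ^ 2 - 1) ^ 2 - (y ^ 2 - 1) ^ 2 = (x ^ 2 + y ^ 2 - 2) * (x + y) * (x - y) := by ring
  have hx' : x ^ 2 ≤ W ^ 2 := sq_le_sq' (abs_le.1 hx).1 (abs_le.1 hx).2
  have hy' : y ^ 2 ≤ W ^ 2 := sq_le_sq' (abs_le.1 hy).1 (abs_le.1 hy).2
  rw [h1, abs_mul, abs_mul]
  refine mul_le_mul_of_nonneg_right ?_ (abs_nonneg _)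
  have h2 : |x ^ 2 + y ^ 2 - 2| ≤ 2 * (W ^ 2 + 1) :=
    abs_le.2 ⟨by nlinarith [sq_nonneg x, sq_nonneg y], by linarith⟩
  have h3 : |x + y| ≤ 2 * W := (abs_add_le _ _).trans (by linarith)
  refine (mul_le_mul h2 h3 (abs_nonneg _) (by positivity)).trans (le_of_eq (by ring))

theorem abs_fluxDensity_le (ha : 0 < a) (hw : Continuous w) {r : ℝ} (hr : a ≤ r) :
    |fluxDensity a ω₀ w r|
      ≤ Real.exp (4 / a ^ 4) * ((|ω₀| + 1 / a) * ((|ω₀| + 1 / a) ^ 2 + 1)) / r ^ 2 := by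
  have h0 := one_le_lapse (w := w) ha hr
  rw [fluxDensity, max_eq_right hr, abs_div, abs_mul, abs_of_nonneg (sq_nonneg r),
    abs_of_nonneg (zero_le_one.trans h0)]
  gcongr
  · exact lapse_le ha hw hr
  · exact abs_mul_sq_sub_one_le (abs_profile_le ha hw hr)

theorem abs_fluxDensity_sub_le (ha : 0 < a) (hw₁ : Continuous w₁) (hw₂ : Continuous w₂) {d : ℝ}
    (hd : ∀ s, |w₁ s - w₂ s| ≤ d) {r : ℝ} (hr : a ≤ r) :
    |fluxDensity a ω₀ w₁ r - fluxDensity a ω₀ w₂ r|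
      ≤ Real.exp (4 / a ^ 4) * (4 / a ^ 4 * ((|ω₀| + 1 / a) * ((|ω₀| + 1 / a) ^ 2 + 1))
        + (3 * (|ω₀| + 1 / a) ^ 2 + 1) / a) * d / r ^ 2 := by
  have hd0 : 0 ≤ d := (abs_nonneg _).trans (hd r)
  set W := |ω₀| + 1 / a
  have hW : 0 ≤ W := by positivity
  set M := Real.exp (4 / a ^ 4)
  have hS := one_le_lapse (w := w₂) ha hr
  have b1 := abs_profile_le (ω₀ := ω₀) ha hw₁ hr
  have b2 := abs_profile_le (ω₀ := ω₀) ha hw₂ hr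
  rw [fluxDensity, fluxDensity, max_eq_right hr, ← sub_div, abs_div, abs_of_nonneg (sq_nonneg r)]
  refine div_le_div_of_nonneg_right ?_ (sq_nonneg r)
  set x := profile a ω₀ w₁ r
  set y := profile a ω₀ w₂ r
  have h1 : lapse a w₁ r * (x * (x ^ 2 - 1)) - lapse a w₂ r * (y * (y ^ 2 - 1))
      = (lapse a w₁ r - lapse a w₂ r) * (x * (x ^ 2 - 1))
        + lapse a w₂ r * (x * (x ^ 2 - 1) - y * (y ^ 2 - 1)) := by ring
  rw [h1]
  refine (abs_add_le _ _).trans ?_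
  rw [abs_mul, abs_mul (lapse a w₂ r), abs_of_nonneg (zero_le_one.trans hS)]
  have h2 : |lapse a w₁ r - lapse a w₂ r| * |x * (x ^ 2 - 1)|
      ≤ M * (4 * d / a ^ 4) * (W * (W ^ 2 + 1)) :=
    mul_le_mul (abs_lapse_sub_le ha hw₁ hw₂ hd hr) (abs_mul_sq_sub_one_le b1) (abs_nonneg _)
      (by positivity)
  have h3 : lapse a w₂ r * |x * (x ^ 2 - 1) - y * (y ^ 2 - 1)|
      ≤ M * ((3 * W ^ 2 + 1) * (d / a)) :=
    mul_le_mul (lapse_le ha hw₂ hr) ((abs_mul_sq_sub_one_sub_le b1 b2).trans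
      (mul_le_mul_of_nonneg_left (abs_profile_sub_le ha hw₁ hw₂ hd hr) (by positivity)))
      (abs_nonneg _) (Real.exp_pos _).le
  refine (add_le_add h2 h3).trans (le_of_eq ?_)
  ring

/-- For such L the magnetic term takes at most half of Lr², and the lapse is at least 1. This keeps
the denominator of `profileMap` positive. -/
theorem le_metricDensity (ha : 0 < a) (hw : Continuous w)
    (hL : 2 * ((|ω₀| + 1 / a) ^ 2 + 1) ^ 2 ≤ L * a ^ 4) {r : ℝ} (hr : a ≤ r) :
    L / 2 * r ^ 2 ≤ metricDensity a ω₀ L w r := by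
  have hr0 := ha.trans_le hr
  have hL0 : 0 ≤ L := by
    by_contra! hneg
    have : L * a ^ 4 < 0 := mul_neg_of_neg_of_pos hneg (by positivity)
    have : 0 ≤ 2 * ((|ω₀| + 1 / a) ^ 2 + 1) ^ 2 := by positivity
    linarith
  rw [metricDensity, max_eq_right hr]
  have h1 : (profile a ω₀ w r ^ 2 - 1) ^ 2 / r ^ 2 ≤ L / 2 * r ^ 2 := by
    rw [div_le_iff₀ (by positivity)]
    have h2 := sq_sub_one_sq_le (abs_profile_le (ω₀ := ω₀) ha hw hr)
    have h3 : L * a ^ 4 ≤ L * r ^ 4 :=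
      mul_le_mul_of_nonneg_left (pow_le_pow_left₀ ha.le hr 4) hL0
    nlinarith
  have h2 : L / 2 * r ^ 2 ≤ 1 + L * r ^ 2 - (profile a ω₀ w r ^ 2 - 1) ^ 2 / r ^ 2 := by
    linarith
  exact h2.trans (le_mul_of_one_le_left (le_trans (by positivity) h2) (one_le_lapse ha hr))

/-- The difference scales like L, as the density itself does, so the quotient in `profileMap` has
Lipschitz constant O(1/L). -/
theorem abs_metricDensity_sub_le (ha : 0 < a) (hw₁ : Continuous w₁) (hw₂ : Continuous w₂)
    (hL : 2 * ((|ω₀| + 1 / a) ^ 2 + 1) ^ 2 ≤ L * a ^ 4) (hL1 : 1 ≤ L * a ^ 2) {d : ℝ}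
    (hd : ∀ s, |w₁ s - w₂ s| ≤ d) {r : ℝ} (hr : a ≤ r) :
    |metricDensity a ω₀ L w₁ r - metricDensity a ω₀ L w₂ r|
      ≤ Real.exp (4 / a ^ 4) * (12 / a ^ 4
        + 4 * (|ω₀| + 1 / a) * ((|ω₀| + 1 / a) ^ 2 + 1) / a) * d * L * r ^ 2 := by
  have hd0 : 0 ≤ d := (abs_nonneg _).trans (hd r)
  have hr0 := ha.trans_le hr
  have hL0 : 0 < L := by
    by_contra! hneg
    have : L * a ^ 2 ≤ 0 := mul_nonpos_of_nonpos_of_nonneg hneg (by positivity)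
    linarith
  set W := |ω₀| + 1 / a
  have hW : 0 ≤ W := by positivity
  set M := Real.exp (4 / a ^ 4)
  have hM : 0 < M := Real.exp_pos _
  have hS := one_le_lapse (w := w₂) ha hr
  have b1 := abs_profile_le (ω₀ := ω₀) ha hw₁ hr
  have b2 := abs_profile_le (ω₀ := ω₀) ha hw₂ hr
  have c1 : 1 ≤ L * r ^ 2 :=
    hL1.trans (mul_le_mul_of_nonneg_left (pow_le_pow_left₀ ha.le hr 2) hL0.le)
  have c2 : 2 * (W ^ 2 + 1) ^ 2 ≤ L * r ^ 4 :=
    hL.trans (mul_le_mul_of_nonneg_left (pow_le_pow_left₀ ha.le hr 4) hL0.le)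
  rw [metricDensity, metricDensity, max_eq_right hr]
  have d1 := abs_profile_sub_le (ω₀ := ω₀) ha hw₁ hw₂ hd hr
  set x := profile a ω₀ w₁ r
  set y := profile a ω₀ w₂ r
  have k1 : |1 + L * r ^ 2 - (x ^ 2 - 1) ^ 2 / r ^ 2| ≤ 3 * (L * r ^ 2) := by
    have h1 : (x ^ 2 - 1) ^ 2 / r ^ 2 ≤ L * r ^ 2 := by
      rw [div_le_iff₀ (by positivity)]
      have h2 := sq_sub_one_sq_le b1
      have h3 : 0 ≤ (W ^ 2 + 1) ^ 2 := by positivity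
      nlinarith
    have h2 : 0 ≤ (x ^ 2 - 1) ^ 2 / r ^ 2 := by positivity
    exact abs_le.2 ⟨by linarith, by linarith⟩
  have k2 : |(x ^ 2 - 1) ^ 2 / r ^ 2 - (y ^ 2 - 1) ^ 2 / r ^ 2|
      ≤ 4 * W * (W ^ 2 + 1) * (d / a) * (L * r ^ 2) := by
    rw [← sub_div, abs_div, abs_of_nonneg (sq_nonneg r), div_le_iff₀ (by positivity)]
    have h1 := (abs_sq_sub_one_sq_sub_le b1 b2).trans
      (mul_le_mul_of_nonneg_left d1 (by positivity))
    have h2 : 0 ≤ (W ^ 2 + 1) ^ 2 := by positivity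
    have h3 : 1 ≤ L * r ^ 2 * r ^ 2 := by nlinarith [sq_nonneg (W ^ 2)]
    have h4 : 0 ≤ 4 * W * (W ^ 2 + 1) * (d / a) := by positivity
    nlinarith
  have h1 : lapse a w₁ r * (1 + L * r ^ 2 - (x ^ 2 - 1) ^ 2 / r ^ 2)
        - lapse a w₂ r * (1 + L * r ^ 2 - (y ^ 2 - 1) ^ 2 / r ^ 2)
      = (lapse a w₁ r - lapse a w₂ r) * (1 + L * r ^ 2 - (x ^ 2 - 1) ^ 2 / r ^ 2)
        - lapse a w₂ r * ((x ^ 2 - 1) ^ 2 / r ^ 2 - (y ^ 2 - 1) ^ 2 / r ^ 2) := by ring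
  rw [h1]
  refine (abs_sub _ _).trans ?_
  rw [abs_mul, abs_mul, abs_of_nonneg (zero_le_one.trans hS)]
  have h2 : |lapse a w₁ r - lapse a w₂ r| * |1 + L * r ^ 2 - (x ^ 2 - 1) ^ 2 / r ^ 2|
      ≤ M * (4 * d / a ^ 4) * (3 * (L * r ^ 2)) :=
    mul_le_mul (abs_lapse_sub_le ha hw₁ hw₂ hd hr) k1 (abs_nonneg _) (by positivity)
  have h3 : lapse a w₂ r * |(x ^ 2 - 1) ^ 2 / r ^ 2 - (y ^ 2 - 1) ^ 2 / r ^ 2|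
      ≤ M * (4 * W * (W ^ 2 + 1) * (d / a) * (L * r ^ 2)) :=
    mul_le_mul (lapse_le ha hw₂ hr) k2 (abs_nonneg _) hM.le
  refine (add_le_add h2 h3).trans (le_of_eq ?_)
  ring

theorem continuous_profileMap (ha : 0 < a) (hw : Continuous w)
    (hL : 2 * ((|ω₀| + 1 / a) ^ 2 + 1) ^ 2 ≤ L * a ^ 4) (hL0 : 0 < L) :
    Continuous (profileMap a ω₀ L w) := by
  have h1 := continuous_intervalMean a (continuous_fluxDensity (ω₀ := ω₀) ha hw)
  have h2 := continuous_intervalMean a (continuous_metricDensity (ω₀ := ω₀) (L := L) ha hw)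
  refine Continuous.div ?_ (h2.comp (by fun_prop)) fun r => ?_
  · exact (Continuous.pow (by fun_prop) 3).mul (h1.comp (by fun_prop))
  · exact (abs_pow_mul_intervalMean_div_le ha hL0 (continuous_fluxDensity (ω₀ := ω₀) ha hw)
      (continuous_metricDensity ha hw) (fun s hs => abs_fluxDensity_le ha hw hs)
      (fun s hs => le_metricDensity ha hw hL hs) (le_max_left a r)).1.ne'

/-- For `L` large there is a solution of the fixed point equation. -/
theorem eventually_exists_profileMap_eq (ω₀ : ℝ) (ha : 0 < a) :
    ∀ᶠ L in atTop, 0 < L ∧ 2 * ((|ω₀| + 1 / a) ^ 2 + 1) ^ 2 ≤ L * a ^ 4 ∧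
      ∃ w : ℝ → ℝ, Continuous w ∧ (∀ r, |w r| ≤ 1) ∧ ∀ r, profileMap a ω₀ L w r = w r := by
  set F := Real.exp (4 / a ^ 4) * ((|ω₀| + 1 / a) * ((|ω₀| + 1 / a) ^ 2 + 1)) with hF
  set F' := Real.exp (4 / a ^ 4) * (4 / a ^ 4 * ((|ω₀| + 1 / a) * ((|ω₀| + 1 / a) ^ 2 + 1))
        + (3 * (|ω₀| + 1 / a) ^ 2 + 1) / a) with hF'
  set G' := Real.exp (4 / a ^ 4) * (12 / a ^ 4
        + 4 * (|ω₀| + 1 / a) * ((|ω₀| + 1 / a) ^ 2 + 1) / a) with hG'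
  have hF0 : 0 ≤ F := by positivity
  have hF'0 : 0 ≤ F' := by positivity
  have hG'0 : 0 ≤ G' := by positivity
  have ev : ∀ c p : ℝ, 0 < p → ∀ᶠ L : ℝ in atTop, c ≤ L * p := fun c p hp =>
    (tendsto_id.atTop_mul_const hp).eventually_ge_atTop c
  -- The last two thresholds force the map into the unit ball and make it Lipschitz with constant
  -- 1/2; the ones before them make the density estimates available.
  filter_upwards [eventually_gt_atTop 0, ev (2 * ((|ω₀| + 1 / a) ^ 2 + 1) ^ 2) (a ^ 4)
    (by positivity), ev 1 (a ^ 2) (by positivity), ev (6 * F) a ha,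
    ev (3 / a * (2 * F' + 4 * F * G')) (1 / 2) (by norm_num)] with L hL0 hL1 hL2 hL3 hL4
  refine ⟨hL0, hL1, ?_⟩
  have hbd : ∀ w : ℝ → ℝ, Continuous w → ∀ r, |profileMap a ω₀ L w r| ≤ 1 := fun w hw r => by
    refine (abs_pow_mul_intervalMean_div_le ha hL0 (continuous_fluxDensity (ω₀ := ω₀) ha hw)
      (continuous_metricDensity ha hw) (fun s hs => abs_fluxDensity_le ha hw hs)
      (fun s hs => le_metricDensity ha hw hL1 hs) (le_max_left a r)).2.trans ?_
    rw [div_le_one (by positivity), mul_comm a]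
    exact hL3
  set T : BoundedContinuousFunction ℝ ℝ → BoundedContinuousFunction ℝ ℝ := fun w =>
    BoundedContinuousFunction.ofNormedAddCommGroup (profileMap a ω₀ L w)
      (continuous_profileMap ha w.continuous hL1 hL0) 1 (fun r => hbd w w.continuous r) with hT
  have hlip : LipschitzWith (1 / 2) T := by
    refine LipschitzWith.of_dist_le_mul fun w₁ w₂ => ?_
    have hnn : 0 ≤ ((1 / 2 : NNReal) : ℝ) * dist w₁ w₂ := by positivity
    refine (BoundedContinuousFunction.dist_le hnn).2 fun r => ?_
    have hd : ∀ s, |w₁ s - w₂ s| ≤ dist w₁ w₂ := fun s => by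
      rw [← Real.dist_eq]
      exact BoundedContinuousFunction.dist_coe_le_dist s
    have hw₁ := w₁.continuous
    have hw₂ := w₂.continuous
    have h1 := abs_pow_mul_intervalMean_div_sub_le (d := dist w₁ w₂) ha hL0 hF0 hF'0 hG'0
      dist_nonneg
      (continuous_fluxDensity (ω₀ := ω₀) ha hw₁) (continuous_fluxDensity (ω₀ := ω₀) ha hw₂)
      (continuous_metricDensity (ω₀ := ω₀) (L := L) ha hw₁)
      (continuous_metricDensity (ω₀ := ω₀) (L := L) ha hw₂)
      (fun s hs => abs_fluxDensity_le ha hw₂ hs)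
      (fun s hs => abs_fluxDensity_sub_le ha hw₁ hw₂ hd hs)
      (fun s hs => le_metricDensity ha hw₁ hL1 hs)
      (fun s hs => le_metricDensity ha hw₂ hL1 hs)
      (fun s hs => abs_metricDensity_sub_le ha hw₁ hw₂ hL1 hL2 hd hs) (le_max_left a r)
    rw [Real.dist_eq]
    refine h1.trans (mul_le_mul_of_nonneg_right ?_ dist_nonneg)
    rw [div_le_iff₀ hL0]
    push_cast
    linarith
  have hc : ContractingWith (1 / 2) T := ⟨by
    rw [← NNReal.coe_lt_coe]
    push_cast
    norm_num, hlip⟩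
  have hfix := hc.fixedPoint_isFixedPt
  set w := hc.fixedPoint T
  have hw : ∀ r, profileMap a ω₀ L w r = w r := fun r => DFunLike.congr_fun hfix r
  exact ⟨w, w.continuous, fun r => by rw [← hw r]; exact hbd w w.continuous r, hw⟩

end estimates

end

/-! ### From the fixed point to a black hole. -/

noncomputable section

section construction

variable {a ω₀ L : ℝ} {w : ℝ → ℝ}

theorem contDiff_profile (ha : 0 < a) (hw : Continuous w) : ContDiff ℝ 1 (profile a ω₀ w) := by
  rw [contDiff_one_iff_deriv]
  refine ⟨fun r => (hasDerivAt_profile ha hw r).differentiableAt, ?_⟩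
  rw [funext fun r => (hasDerivAt_profile (ω₀ := ω₀) ha hw r).deriv]
  exact continuous_profileDeriv ha hw

theorem contDiff_lapse (ha : 0 < a) (hw : Continuous w) : ContDiff ℝ 1 (lapse a w) := by
  rw [contDiff_one_iff_deriv]
  refine ⟨fun r => (hasDerivAt_lapse ha hw r).differentiableAt, ?_⟩
  rw [funext fun r => (hasDerivAt_lapse ha hw r).deriv]
  exact (continuous_lapse ha hw).mul (continuous_logLapse_integrand ha hw)

theorem contDiffOn_max (a : ℝ) : ContDiffOn ℝ 1 (fun r => max a r) (Ici a) :=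
  contDiffOn_id.congr fun _ hr => max_eq_right hr

theorem contDiffOn_fluxDensity (ha : 0 < a) (hw : Continuous w) :
    ContDiffOn ℝ 1 (fluxDensity a ω₀ w) (Ici a) := by
  have h1 := (contDiff_profile (ω₀ := ω₀) ha hw).contDiffOn (s := Ici a)
  exact ((contDiff_lapse ha hw).contDiffOn.mul (h1.mul ((h1.pow 2).sub contDiffOn_const))).div
    ((contDiffOn_max a).pow 2) fun r _ => pow_ne_zero 2 (max_left_pos ha r).ne'

theorem contDiffOn_metricDensity (ha : 0 < a) (hw : Continuous w) :
    ContDiffOn ℝ 1 (metricDensity a ω₀ L w) (Ici a) := by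
  have h1 := (contDiff_profile (ω₀ := ω₀) ha hw).contDiffOn (s := Ici a)
  have h2 := (contDiffOn_max a).pow 2
  exact (contDiff_lapse ha hw).contDiffOn.mul ((contDiffOn_const.add (contDiffOn_const.mul h2)).sub
    ((((h1.pow 2).sub contDiffOn_const).pow 2).div h2
      fun r _ => pow_ne_zero 2 (max_left_pos ha r).ne'))

theorem intervalMean_metricDensity_pos (ha : 0 < a) (hw : Continuous w) (hL0 : 0 < L)
    (hL : 2 * ((|ω₀| + 1 / a) ^ 2 + 1) ^ 2 ≤ L * a ^ 4) {r : ℝ} (hr : a ≤ r) :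
    0 < intervalMean a (metricDensity a ω₀ L w) r :=
  (abs_pow_mul_intervalMean_div_le ha hL0 (continuous_fluxDensity (ω₀ := ω₀) ha hw)
      (continuous_metricDensity ha hw) (fun _ hs => abs_fluxDensity_le ha hw hs)
      (fun _ hs => le_metricDensity ha hw hL hs) hr).1

/-- At a fixed point, `ω'` is a quotient of two mean values. -/
theorem profileDeriv_eq_of_fixed (ha : 0 < a) (hb : ∀ r, |w r| ≤ 1)
    (hfix : ∀ r, profileMap a ω₀ L w r = w r) {r : ℝ} (hr : a ≤ r) :
    profileDeriv a w r = r * intervalMean a (fluxDensity a ω₀ w) r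
      / intervalMean a (metricDensity a ω₀ L w) r := by
  have hr0 := (ha.trans_le hr).ne'
  have h1 := abs_le.1 (hb r)
  rw [profileDeriv, min_eq_right h1.2, max_eq_right h1.1, ← hfix r, profileMap, max_eq_right hr]
  field_simp

/-- Regularity bootstrap: w is only continuous, but ω and S are then C¹, hence so are the two
densities on [a, ∞). The fixed point equation writes ω' as r times a quotient of their means, which
is C¹ up to the horizon. -/
theorem contDiffOn_profileDeriv (ha : 0 < a) (hw : Continuous w) (hL0 : 0 < L)
    (hL : 2 * ((|ω₀| + 1 / a) ^ 2 + 1) ^ 2 ≤ L * a ^ 4) (hb : ∀ r, |w r| ≤ 1)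
    (hfix : ∀ r, profileMap a ω₀ L w r = w r) : ContDiffOn ℝ 1 (profileDeriv a w) (Ici a) := by
  refine ContDiffOn.congr ?_ fun r hr => profileDeriv_eq_of_fixed ha hb hfix hr
  exact (contDiffOn_id.mul (contDiffOn_one_intervalMean (contDiffOn_fluxDensity ha hw))).div
    (contDiffOn_one_intervalMean (contDiffOn_metricDensity ha hw))
    fun r hr => (intervalMean_metricDensity_pos ha hw hL0 hL hr).ne'

/-- The once integrated Yang-Mills equation: the two integrals stand for rNS and NSω', with S not
yet normalized. -/
theorem profileDeriv_mul_integral (ha : 0 < a) (hw : Continuous w) (hL0 : 0 < L)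
    (hL : 2 * ((|ω₀| + 1 / a) ^ 2 + 1) ^ 2 ≤ L * a ^ 4) (hb : ∀ r, |w r| ≤ 1)
    (hfix : ∀ r, profileMap a ω₀ L w r = w r) {r : ℝ} (hr : a ≤ r) :
    profileDeriv a w r * ∫ s in a..r, metricDensity a ω₀ L w s
      = r * ∫ s in a..r, fluxDensity a ω₀ w s := by
  have h1 := (intervalMean_metricDensity_pos ha hw hL0 hL hr).ne'
  rw [profileDeriv_eq_of_fixed ha hb hfix hr, ← sub_mul_intervalMean, ← sub_mul_intervalMean]
  field_simp

/-- The static configuration determined by `w = r² ω'`, with `S` normalized by `Sinf`. -/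
def configuration (a ω₀ L Sinf : ℝ) (w : ℝ → ℝ) : StaticEYM where
  Λ := -L
  rh := a
  m r := r / 2 * (1 - (∫ s in a..r, metricDensity a ω₀ L w s) / (r * lapse a w r)
    + L * r ^ 2 / 3)
  S r := lapse a w r / Sinf
  ω := profile a ω₀ w

/-- The mass function is chosen so that rNS, with the unnormalized lapse, is the integral of
`metricDensity`. -/
theorem configuration_N {Sinf r : ℝ} (hr : 0 < r) : (configuration a ω₀ L Sinf w).N r
    = (∫ s in a..r, metricDensity a ω₀ L w s) / (r * lapse a w r) := by
  simp only [StaticEYM.N, configuration]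
  field_simp
  ring

theorem exists_tendsto_lapse (ha : 0 < a) (hw : Continuous w) :
    ∃ Sinf, 0 < Sinf ∧ Tendsto (lapse a w) atTop (𝓝 Sinf) := by
  obtain ⟨l, hl⟩ := exists_tendsto_atTop_of_norm_deriv_le (a := a) (f := lapse a w)
    (C := Real.exp (4 / a ^ 4) * (4 * 1 / a ^ 3)) ha (fun r _ => hasDerivAt_lapse ha hw r)
    (fun r hr => by
      have h1 := abs_profileDeriv_le (w := w) hr.le
      have hr0 := ha.trans hr
      have h2 := abs_two_mul_sq_div_le ha hr.le h1 (h1.trans (by gcongr; norm_num))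
      rw [norm_mul, Real.norm_eq_abs, Real.norm_eq_abs, max_eq_right hr.le, sq,
        abs_of_nonneg (zero_le_one.trans (one_le_lapse ha hr.le)),
        mul_div_assoc (Real.exp _)]
      exact mul_le_mul (lapse_le ha hw hr.le) h2 (abs_nonneg _) (Real.exp_pos _).le)
  refine ⟨l, zero_lt_one.trans_le (ge_of_tendsto hl ?_), hl⟩
  filter_upwards [eventually_ge_atTop a] with r hr
  exact one_le_lapse ha hr

theorem hasDerivAt_configuration_m (ha : 0 < a) (hw : Continuous w) {Sinf r : ℝ} (hr : a < r) :
    HasDerivAt (configuration a ω₀ L Sinf w).m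
      ((configuration a ω₀ L Sinf w).N r * profileDeriv a w r ^ 2
        + (profile a ω₀ w r ^ 2 - 1) ^ 2 / (2 * r ^ 2)) r := by
  have hr0 : 0 < r := ha.trans hr
  have hS : lapse a w r ≠ 0 := (Real.exp_pos _).ne'
  have hG : HasDerivAt (fun r => ∫ s in a..r, metricDensity a ω₀ L w s)
      (metricDensity a ω₀ L w r) r :=
    ((continuous_metricDensity ha hw).integral_hasStrictDerivAt a r).hasDerivAt
  have h1 := ((hasDerivAt_id r).div_const 2).mul
    (((hG.div ((hasDerivAt_id r).mul (hasDerivAt_lapse ha hw r))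
      (mul_ne_zero hr0.ne' hS)).const_sub 1).add
    (((hasDerivAt_pow 2 r).const_mul L).div_const 3))
  refine h1.congr_deriv ?_
  rw [configuration_N hr0]
  simp only [Pi.add_apply, Pi.div_apply, Pi.mul_apply, id, metricDensity, max_eq_right hr.le]
  set G := ∫ s in a..r, lapse a w s *
    (1 + L * max a s ^ 2 - (profile a ω₀ w s ^ 2 - 1) ^ 2 / max a s ^ 2)
  field_simp
  ring

theorem isAdSBlackHole_configuration (ha : 0 < a) (hw : Continuous w) (hL0 : 0 < L)
    (hL : 2 * ((|ω₀| + 1 / a) ^ 2 + 1) ^ 2 ≤ L * a ^ 4) (hb : ∀ r, |w r| ≤ 1)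
    (hfix : ∀ r, profileMap a ω₀ L w r = w r) {Sinf ωinf : ℝ} (hSinf : 0 < Sinf)
    (hSlim : Tendsto (lapse a w) atTop (𝓝 Sinf))
    (hωlim : Tendsto (profile a ω₀ w) atTop (𝓝 ωinf)) :
    (configuration a ω₀ L Sinf w).IsAdSBlackHole ωinf := by
  have hpos : ∀ r, a ≤ r → 0 < r := fun r hr => ha.trans_le hr
  have hSpos : ∀ r, 0 < lapse a w r := fun r => Real.exp_pos _
  have hG : ∀ r, HasDerivAt (fun r => ∫ s in a..r, metricDensity a ω₀ L w s)
      (metricDensity a ω₀ L w r) r := fun r =>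
    ((continuous_metricDensity ha hw).integral_hasStrictDerivAt a r).hasDerivAt
  have hF : ∀ r, HasDerivAt (fun r => ∫ s in a..r, fluxDensity a ω₀ w s)
      (fluxDensity a ω₀ w r) r := fun r =>
    ((continuous_fluxDensity ha hw).integral_hasStrictDerivAt a r).hasDerivAt
  have hv := contDiffOn_profileDeriv ha hw hL0 hL hb hfix
  have hω' : deriv (configuration a ω₀ L Sinf w).ω = profileDeriv a w :=
    funext fun r => (hasDerivAt_profile ha hw r).deriv
  have hS2 : ContDiffOn ℝ 2 (lapse a w) (Ici a) := by
    refine contDiffOn_two_of_hasDerivWithinAt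
      (fun r _ => (hasDerivAt_lapse ha hw r).hasDerivWithinAt) ?_
    exact (contDiff_lapse ha hw).contDiffOn.mul ((contDiffOn_const.mul (hv.pow 2)).div
      (contDiffOn_max a) fun r _ => (max_left_pos ha r).ne')
  have hflux : ∀ r, a ≤ r → |∫ s in a..r, fluxDensity a ω₀ w s|
      ≤ Real.exp (4 / a ^ 4) * ((|ω₀| + 1 / a) * ((|ω₀| + 1 / a) ^ 2 + 1)) / a := fun r hr =>
    abs_integral_le_of_abs_le_div_sq ha (continuous_fluxDensity ha hw)
      (fun s hs => abs_fluxDensity_le ha hw hs) hr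
  have hGpos : ∀ r, a < r → 0 < ∫ s in a..r, metricDensity a ω₀ L w s := fun r hr => by
    rw [← sub_mul_intervalMean]
    exact mul_pos (sub_pos.2 hr) (intervalMean_metricDensity_pos ha hw hL0 hL hr.le)
  have hN : ∀ r, a ≤ r → (configuration a ω₀ L Sinf w).N r
      = (∫ s in a..r, metricDensity a ω₀ L w s) / (r * lapse a w r) := fun r hr =>
    configuration_N (hpos r hr)
  constructor
  · exact neg_lt_zero.2 hL0
  · exact ha
  · have h1 : ContDiffOn ℝ 2 (fun r => ∫ s in a..r, metricDensity a ω₀ L w s) (Ici a) :=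
      contDiffOn_two_of_hasDerivWithinAt (fun r _ => (hG r).hasDerivWithinAt)
        (contDiffOn_metricDensity ha hw)
    exact (contDiffOn_id.div_const 2).mul ((contDiffOn_const.sub (h1.div (contDiffOn_id.mul hS2)
      fun r hr => mul_ne_zero (hpos r hr).ne' (hSpos r).ne')).add
      ((contDiffOn_const.mul (contDiffOn_id.pow 2)).div_const 3))
  · exact hS2.div_const Sinf
  · exact contDiffOn_two_of_hasDerivWithinAt
      (fun r _ => (hasDerivAt_profile ha hw r).hasDerivWithinAt) hv
  · exact fun r _ => div_pos (hSpos r) hSinf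
  · change (configuration a ω₀ L Sinf w).N a = 0
    rw [hN a le_rfl, intervalIntegral.integral_same, zero_div]
  · change 0 < derivWithin (configuration a ω₀ L Sinf w).N (Ici a) a
    have h1 := ((hG a).div ((hasDerivAt_id a).mul (hasDerivAt_lapse ha hw a))
      (mul_ne_zero ha.ne' (hSpos a).ne')).hasDerivWithinAt (s := Ici a)
    have h2 := h1.congr (f₁ := (configuration a ω₀ L Sinf w).N) (fun r hr => hN r hr)
      (hN a le_rfl)
    rw [h2.derivWithin (uniqueDiffOn_Ici a a self_mem_Ici)]
    -- At the horizon N' is this density divided by aS, since the integral itself vanishes there.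
    have h3 : 0 < metricDensity a ω₀ L w a :=
      lt_of_lt_of_le (by positivity) (le_metricDensity ha hw hL le_rfl)
    have h4 := hSpos a
    simp only [intervalIntegral.integral_same, zero_mul, sub_zero, Pi.mul_apply, id]
    positivity
  · intro r hr
    rw [hN r (le_of_lt hr)]
    exact div_pos (hGpos r hr) (mul_pos (hpos r (le_of_lt hr)) (hSpos r))
  · intro r hr
    rw [(hasDerivAt_configuration_m ha hw hr).deriv, hω']
    rfl
  · intro r hr
    have h1 : HasDerivAt (configuration a ω₀ L Sinf w).S _ r :=
      (hasDerivAt_lapse ha hw r).div_const Sinf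
    have hr' : a ≤ r := le_of_lt hr
    rw [h1.deriv, hω', max_eq_right hr']
    have h2 := (hSpos r).ne'
    simp only [configuration]
    field_simp
  · intro r hr
    have hr' : a < r := hr
    have hr0 := hpos r hr'.le
    have hS := (hSpos r).ne'
    have hrel : (configuration a ω₀ L Sinf w).N r * r * lapse a w r
        = ∫ s in a..r, metricDensity a ω₀ L w s := by
      rw [hN r hr'.le]
      field_simp
    have hm : 2 * (configuration a ω₀ L Sinf w).m r
        = r - (configuration a ω₀ L Sinf w).N r * r + L * r ^ 3 / 3 := by
      simp only [StaticEYM.N, configuration]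
      field_simp
      ring
    have hdv : HasDerivAt (profileDeriv a w) (deriv (profileDeriv a w) r) r :=
      ((hv.contDiffAt (Ici_mem_nhds hr')).differentiableAt (by norm_num)).hasDerivAt
    -- Differentiating ω' · (rNS) = r · (NSω') produces the second-order equation for ω.
    have h1 := (hdv.mul (hG r)).congr_of_eventuallyEq
      (f₁ := fun r => r * ∫ s in a..r, fluxDensity a ω₀ w s) (by
        filter_upwards [Ioi_mem_nhds hr'] with s hs
        exact (profileDeriv_mul_integral ha hw hL0 hL hb hfix (le_of_lt hs)).symm)
    have h2 := h1.unique ((hasDerivAt_id r).mul (hF r))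
    have h3 := profileDeriv_mul_integral ha hw hL0 hL hb hfix hr'.le
    rw [hω', hm]
    rw [← hrel] at h2 h3
    simp only [id, fluxDensity, metricDensity, max_eq_right hr'.le] at h2 h3
    set F := ∫ s in a..r, lapse a w s * (profile a ω₀ w s * (profile a ω₀ w s ^ 2 - 1))
      / max a s ^ 2
    set n := (configuration a ω₀ L Sinf w).N r
    have hF' : F = profileDeriv a w r * n * lapse a w r := by
      refine mul_left_cancel₀ hr0.ne' ?_
      rw [← h3]
      ring
    rw [hF'] at h2
    change 0 = r ^ 2 * n * deriv (profileDeriv a w) r + (r - n * r + L * r ^ 3 / 3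
      - 2 * (-L) * r ^ 3 / 3 - (profile a ω₀ w r ^ 2 - 1) ^ 2 / r) * profileDeriv a w r
      + (1 - profile a ω₀ w r ^ 2) * profile a ω₀ w r
    refine mul_left_cancel₀ hS ?_
    field_simp at h2 ⊢
    linear_combination -3 * h2
  -- The mass converges because m' = O(r⁻²): Nω'² is ω' = O(r⁻²) times the bounded flux divided by
  -- the lapse.
  · refine exists_tendsto_atTop_of_norm_deriv_le (a := a)
      (C := Real.exp (4 / a ^ 4) * ((|ω₀| + 1 / a) * ((|ω₀| + 1 / a) ^ 2 + 1)) / a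
        + ((|ω₀| + 1 / a) ^ 2 + 1) ^ 2) ha (fun r hr => hasDerivAt_configuration_m ha hw hr)
      fun r hr => ?_
    have hr0 := hpos r hr.le
    rw [add_div]
    refine (norm_add_le _ _).trans (add_le_add ?_ ?_)
    · have h1 := profileDeriv_mul_integral ha hw hL0 hL hb hfix hr.le
      have h2 : (configuration a ω₀ L Sinf w).N r * profileDeriv a w r ^ 2
          = (∫ s in a..r, fluxDensity a ω₀ w s) / lapse a w r * profileDeriv a w r := by
        rw [hN r hr.le]
        have hS := (hSpos r).ne'
        field_simp
        linear_combination profileDeriv a w r * h1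
      rw [h2, norm_mul, norm_div, Real.norm_eq_abs, Real.norm_eq_abs, Real.norm_eq_abs,
        abs_of_pos (hSpos r), div_eq_mul_one_div _ (r ^ 2)]
      refine mul_le_mul ?_ (abs_profileDeriv_le hr.le) (abs_nonneg _) (by positivity)
      exact (div_le_self (abs_nonneg _) (one_le_lapse ha hr.le)).trans (hflux r hr.le)
    · rw [Real.norm_of_nonneg (by positivity)]
      refine div_le_div₀ (by positivity)
        (sq_sub_one_sq_le (abs_profile_le (ω₀ := ω₀) ha hw hr.le)) (by positivity) ?_
      nlinarith [sq_nonneg r]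
  · have := hSlim.div_const Sinf
    rwa [div_self hSinf.ne'] at this
  · exact hωlim

theorem eventually_exists_isAdSBlackHole (ω₀ : ℝ) (ha : 0 < a) :
    ∀ᶠ L in atTop, ∃ (B : StaticEYM) (ωinf : ℝ), B.IsAdSBlackHole ωinf ∧
      B.Λ = -L ∧ B.rh = a ∧ B.ω a = ω₀ := by
  filter_upwards [eventually_exists_profileMap_eq ω₀ ha] with L hL
  obtain ⟨hL0, hL1, w, hw, hb, hfix⟩ := hL
  obtain ⟨Sinf, hS0, hS⟩ := exists_tendsto_lapse ha hw
  obtain ⟨ωinf, hω⟩ := exists_tendsto_atTop_of_norm_deriv_le (a := a) (f := profile a ω₀ w)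
    (C := 1) ha (fun r _ => hasDerivAt_profile ha hw r) fun r hr => abs_profileDeriv_le hr.le
  refine ⟨configuration a ω₀ L Sinf w, ωinf,
    isAdSBlackHole_configuration ha hw hL0 hL1 hb hfix hS0 hS hω, rfl, rfl, ?_⟩
  simp [configuration, profile]

end construction

end

/-! ### Uniform consequences for large |Λ|. -/

namespace StaticEYM

/-- For `|Λ|` large the gauge field is nearly constant, uniformly in the solution. -/
theorem eventually_abs_ω_sub_le {rh ωh δ : ℝ} (hrh : 0 < rh) (hδ : 0 < δ) (hδ1 : δ ≤ 1) :
    ∃ C, 0 ≤ C ∧ (∀ x, |x - ωh| ≤ δ → |x * (x ^ 2 - 1)| ≤ C) ∧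
      ∀ᶠ L in atTop, ∀ (B : StaticEYM) (ωinf : ℝ), B.IsAdSBlackHole ωinf → B.Λ = -L →
        B.rh = rh → B.ω rh = ωh → ∀ r, rh < r →
          |B.ω r - ωh| ≤ δ ∧ |deriv B.ω r| ≤ 12 * C / (L * rh) / r ^ 2 := by
  have hW : ∀ x, |x - ωh| ≤ δ → |x| ≤ |ωh| + 1 := fun x hx => by
    have := abs_sub_abs_le_abs_sub x ωh
    linarith
  set W := |ωh| + 1
  have hC0 : 0 ≤ W * (W ^ 2 + 1) := by positivity
  refine ⟨W * (W ^ 2 + 1), hC0, fun x hx => abs_mul_sq_sub_one_le (hW x hx), ?_⟩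
  have ev : ∀ c p : ℝ, 0 < p → ∀ᶠ L : ℝ in atTop, c ≤ L * p := fun c p hp =>
    (tendsto_id.atTop_mul_const hp).eventually_ge_atTop c
  filter_upwards [eventually_gt_atTop 0, ev (2 * (W ^ 2 + 1) ^ 2) (rh ^ 4) (by positivity),
    ev (4 * (W * (W ^ 2 + 1))) (rh ^ 3) (by positivity),
    (tendsto_id.atTop_mul_const (by positivity : 0 < rh * rh * δ)).eventually_gt_atTop
      (12 * (W * (W ^ 2 + 1)))] with L hL0 hL1 hL2 hL3
  intro B ωinf hB hΛ hBrh hω r hr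
  subst hBrh
  have hΛ' : -B.Λ = L := by rw [hΛ, neg_neg]
  rw [← hΛ'] at hL0 hL1 hL2 hL3 ⊢
  rw [← hω] at hW ⊢
  refine hB.abs_ω_sub_le_and_abs_deriv_ω_le hC0 (fun x hx => abs_mul_sq_sub_one_le (hW x hx))
    (fun x hx => sq_sub_one_sq_le (hW x hx)) hL1 hL2 ?_ hr
  rw [div_div, div_lt_iff₀ (by positivity)]
  simp only [id] at hL3
  linarith

theorem eventually_sqrt_mul_abs_deriv_ω_lt {rh ωh ε : ℝ} (hrh : 0 < rh) (hε : 0 < ε) :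
    ∀ᶠ L in atTop, ∀ (B : StaticEYM) (ωinf : ℝ), B.IsAdSBlackHole ωinf → B.Λ = -L →
      B.rh = rh → B.ω rh = ωh → ∀ r, rh ≤ r →
        Real.sqrt |B.Λ| * |derivWithin B.ω (Ici rh) r| < ε := by
  obtain ⟨C, hC0, -, hC⟩ := eventually_abs_ω_sub_le (ωh := ωh) hrh one_pos le_rfl
  filter_upwards [hC, eventually_gt_atTop 0,
    (Real.tendsto_sqrt_atTop.const_mul_atTop hε).eventually_gt_atTop (12 * C / rh ^ 3)]
    with L hL hL0 hL1
  intro B ωinf hB hΛ hBrh hω r hr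
  have h1 : ∀ s, rh < s → |deriv B.ω s| ≤ 12 * C / (L * rh) / rh ^ 2 := fun s hs =>
    (hL B ωinf hB hΛ hBrh hω s hs).2.trans (by gcongr)
  have h2 : |derivWithin B.ω (Ici rh) r| ≤ 12 * C / (L * rh) / rh ^ 2 := by
    -- At the horizon the one-sided derivative is the limit of the exterior values, so it inherits
    -- their bound.
    rcases eq_or_lt_of_le hr with h | h
    · rw [← h]
      have h3 := hB.tendsto_deriv_ω.abs
      rw [hBrh] at h3
      refine le_of_tendsto h3 ?_
      filter_upwards [self_mem_nhdsWithin] with s hs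
      exact h1 s hs
    · rw [derivWithin_of_mem_nhds (Ici_mem_nhds h)]
      exact h1 r h
  rw [hΛ, abs_neg, abs_of_pos hL0]
  have hs : 0 < Real.sqrt L := Real.sqrt_pos.2 hL0
  have hsq : Real.sqrt L * Real.sqrt L = L := Real.mul_self_sqrt hL0.le
  refine (mul_le_mul_of_nonneg_left h2 hs.le).trans_lt ?_
  -- The derivative is O(1/L), so the product with √L still decays like 1/√L.
  have h4 : Real.sqrt L * (12 * C / (L * rh) / rh ^ 2) = 12 * C / rh ^ 3 / Real.sqrt L := by
    nth_rewrite 2 [← hsq]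
    field_simp
  rw [h4, div_lt_iff₀ hs]
  exact hL1

/-- Positivity of the gravitational potential when `3 ω² > 1` and `ω'` is small. -/
theorem IsAdSBlackHole.gravitationalPotential_pos {B : StaticEYM} {ωinf : ℝ}
    (h : B.IsAdSBlackHole ωinf) {C D η r : ℝ} (hr : B.rh < r) (hC0 : 0 ≤ C) (hD0 : 0 ≤ D)
    (hη : η ≤ 3 * B.ω r ^ 2 - 1)
    (hC : |B.ω r * (B.ω r ^ 2 - 1)| ≤ C) (hD : |deriv B.ω r| ≤ D / r ^ 2)
    (hsmall : 4 * D ^ 2 * (1 / B.rh ^ 4 + -B.Λ / B.rh ^ 2) + 8 * C * D / B.rh ^ 3 < η) :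
    0 < B.gravitationalPotential r := by
  have hrh := h.radius_pos
  have hr0 := h.pos_of_le hr.le
  have hL : 0 < -B.Λ := neg_pos.2 h.cosmological_neg
  have hN := h.exterior r hr
  have hS := h.S_pos r hr.le
  refine mul_pos (by positivity) ?_
  -- Dropping the subtracted square only enlarges the bracket; the rest is decreasing in r, hence
  -- largest at the horizon.
  have h1 : 4 * r * deriv B.ω r ^ 2 * (1 / r - B.Λ * r - (1 - B.ω r ^ 2) ^ 2 / r ^ 3)
      ≤ 4 * D ^ 2 * (1 / B.rh ^ 4 + -B.Λ / B.rh ^ 2) := by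
    have e1 : deriv B.ω r ^ 2 ≤ (D / r ^ 2) ^ 2 := by
      rw [← sq_abs]
      exact pow_le_pow_left₀ (abs_nonneg _) hD 2
    have e2 : 1 / r - B.Λ * r - (1 - B.ω r ^ 2) ^ 2 / r ^ 3 ≤ 1 / r + -B.Λ * r := by
      have : 0 ≤ (1 - B.ω r ^ 2) ^ 2 / r ^ 3 := by positivity
      linarith
    calc 4 * r * deriv B.ω r ^ 2 * (1 / r - B.Λ * r - (1 - B.ω r ^ 2) ^ 2 / r ^ 3)
        ≤ 4 * r * deriv B.ω r ^ 2 * (1 / r + -B.Λ * r) := by gcongr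
      _ ≤ 4 * r * (D / r ^ 2) ^ 2 * (1 / r + -B.Λ * r) := by gcongr
      _ = 4 * D ^ 2 * (1 / r ^ 4 + -B.Λ / r ^ 2) := by
        field_simp
      _ ≤ 4 * D ^ 2 * (1 / B.rh ^ 4 + -B.Λ / B.rh ^ 2) := by gcongr
  have h2 : -(8 * C * D / B.rh ^ 3) ≤ 8 / r * B.ω r * deriv B.ω r * (B.ω r ^ 2 - 1) := by
    have e1 : |8 / r * B.ω r * deriv B.ω r * (B.ω r ^ 2 - 1)| ≤ 8 * C * D / B.rh ^ 3 := by
      have e2 : 8 / r * B.ω r * deriv B.ω r * (B.ω r ^ 2 - 1)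
          = 8 / r * (B.ω r * (B.ω r ^ 2 - 1) * deriv B.ω r) := by ring
      rw [e2, abs_mul, abs_mul, abs_of_pos (by positivity : 0 < 8 / r)]
      calc 8 / r * (|B.ω r * (B.ω r ^ 2 - 1)| * |deriv B.ω r|)
          ≤ 8 / r * (C * (D / r ^ 2)) := by gcongr
        _ = 8 * C * D / r ^ 3 := by field_simp
        _ ≤ 8 * C * D / B.rh ^ 3 := by gcongr
    exact (abs_le.1 e1).1
  linarith

/-- For `|Λ|` large every black hole with `ω(rh) = ωh > 1 / √3` has `ω` bounded away from `1 / √3`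
and a positive gravitational potential. -/
theorem eventually_gravitationalPotential_pos {rh ωh : ℝ} (hrh : 0 < rh)
    (hωh : 1 / Real.sqrt 3 < ωh) :
    ∃ c, 1 / Real.sqrt 3 < c ∧ ∀ᶠ L in atTop, ∀ (B : StaticEYM) (ωinf : ℝ),
      B.IsAdSBlackHole ωinf → B.Λ = -L → B.rh = rh → B.ω rh = ωh →
        (∀ r, rh ≤ r → c ≤ B.ω r) ∧ ∀ r, rh < r → 0 < B.gravitationalPotential r := by
  set s := 1 / Real.sqrt 3 with hs
  have hs0 : 0 < s := by positivity
  have hs2 : s ^ 2 = 1 / 3 := by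
    rw [hs, div_pow, Real.sq_sqrt (by norm_num), one_pow]
  -- Half the gap to 1/√3, so that a deviation of δ leaves ω strictly above it.
  set δ := min 1 ((ωh - s) / 2)
  have hδ0 : 0 < δ := lt_min one_pos (by linarith)
  have hδ1 : δ ≤ 1 := min_le_left _ _
  have hδ2 : δ ≤ (ωh - s) / 2 := min_le_right _ _
  have hc : s < ωh - δ := by linarith
  obtain ⟨C, hC0, hC1, hC2⟩ := eventually_abs_ω_sub_le (ωh := ωh) hrh hδ0 hδ1
  set η := 3 * (ωh - δ) ^ 2 - 1
  have hη : 0 < η := by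
    have : s ^ 2 < (ωh - δ) ^ 2 := pow_lt_pow_left₀ hc hs0.le two_ne_zero
    linarith
  -- The smallness condition on D = 12C/(L rh), written in x = 1/L: the factor L multiplying D²
  -- leaves one power of x.
  have hlim : Tendsto (fun x : ℝ => 4 * (12 * C / rh) ^ 2 * (x ^ 2 / rh ^ 4 + x / rh ^ 2)
      + 8 * C * (12 * C / rh) * x / rh ^ 3) (𝓝 0) (𝓝 0) :=
    Continuous.tendsto' (by fun_prop) 0 0 (by simp)
  refine ⟨ωh - δ, hc, ?_⟩
  filter_upwards [hC2, eventually_gt_atTop 0,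
    (hlim.comp tendsto_inv_atTop_zero).eventually (gt_mem_nhds hη)] with L hL hL0 hLη
  intro B ωinf hB hΛ hBrh hω
  have h1 := hL B ωinf hB hΛ hBrh hω
  have h2 : ∀ r, rh ≤ r → ωh - δ ≤ B.ω r := fun r hr => by
    rcases eq_or_lt_of_le hr with h | h
    · rw [← h, hω]
      linarith
    · have := (abs_le.1 (h1 r h).1).1
      linarith
  refine ⟨h2, fun r hr => ?_⟩
  subst hBrh
  refine hB.gravitationalPotential_pos (C := C) (D := 12 * C / (L * B.rh)) (η := η) hr hC0
    (by positivity) ?_ (hC1 _ (h1 r hr).1) (h1 r hr).2 ?_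
  · have : (ωh - δ) ^ 2 ≤ B.ω r ^ 2 :=
      pow_le_pow_left₀ (hs0.trans hc).le (h2 r hr.le) 2
    linarith
  · refine lt_of_eq_of_lt ?_ hLη
    rw [hΛ, neg_neg]
    simp only [Function.comp]
    field_simp

end StaticEYM

/-! ### The theorem. -/

theorem mainTheorem4 :
    -- nodeless solutions and the sphaleronic sector
    (∀ (B : StaticEYM) (ωinf : ℝ), B.IsAdSBlackHole ωinf → B.Nodeless →
      (∀ r, B.rh < r → 0 < B.sphaleronicPotential r) ∧
      ContinuousOn B.sphaleronicPotential (Ioi B.rh) ∧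
      Tendsto B.sphaleronicPotential (𝓝[>] B.rh) (𝓝 0) ∧
      (ωinf ≠ 0 → ∃ a : ℝ, Tendsto (fun r => r * (B.ω r - ωinf)) atTop (𝓝 a) ∧
        Tendsto B.sphaleronicPotential atTop
          (𝓝 (-B.Λ / 3 * (1 + ωinf ^ 2) + 2 * B.Λ ^ 2 * a ^ 2 / (9 * ωinf ^ 2)))) ∧
      (∀ (E : ℝ) (β : ℝ → ℂ), E < 0 → ¬ B.IsBoundState B.sphaleronicPotential E β) ∧
      (ωinf ≠ 0 → B.SphaleronicallyStable)) ∧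
    -- solutions with `ω_h > 1 / √3` and `|Λ|` large
    (∀ (rh ωh : ℝ), 0 < rh → 1 / Real.sqrt 3 < ωh →
      (∀ ε : ℝ, 0 < ε → ∃ L : ℝ, 0 < L ∧
        ∀ (B : StaticEYM) (ωinf : ℝ), B.IsAdSBlackHole ωinf → B.rh = rh → B.ω rh = ωh →
          B.Λ < -L → ∀ r, rh ≤ r →
            Real.sqrt |B.Λ| * |derivWithin B.ω (Ici rh) r| < ε) ∧
      (∃ L : ℝ, 0 < L ∧ ∀ Λ : ℝ, Λ < -L →
        (∃ (B : StaticEYM) (ωinf : ℝ), B.IsAdSBlackHole ωinf ∧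
          B.Λ = Λ ∧ B.rh = rh ∧ B.ω rh = ωh) ∧
        (∀ (B : StaticEYM) (ωinf : ℝ), B.IsAdSBlackHole ωinf →
          B.Λ = Λ → B.rh = rh → B.ω rh = ωh →
          (∀ r, rh ≤ r → 1 / Real.sqrt 3 < B.ω r) ∧
          1 / Real.sqrt 3 < ωinf ∧
          (∀ r, rh < r → 0 < B.gravitationalPotential r) ∧
          Tendsto B.gravitationalPotential (𝓝[>] rh) (𝓝 0) ∧
          Tendsto B.gravitationalPotential atTop (𝓝 (-Λ / 3 * (3 * ωinf ^ 2 - 1))) ∧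
          (∀ (E : ℝ) (β : ℝ → ℂ), E < 0 → ¬ B.IsBoundState B.sphaleronicPotential E β) ∧
          (∀ (E : ℝ) (β : ℝ → ℂ), E < 0 → ¬ B.IsBoundState B.gravitationalPotential E β) ∧
          B.LinearlyStable))) := by
  refine ⟨fun B ωinf h hn => ⟨fun r hr => h.sphaleronicPotential_pos hr,
    h.continuousOn_sphaleronicPotential hn, h.tendsto_sphaleronicPotential_horizon hn,
    fun hinf => ?_, fun E β hE => h.not_isBoundState
      (fun r hr => h.sphaleronicPotential_pos hr) hE β,
    fun hinf => h.sphaleronicallyStable hn hinf⟩, fun rh ωh hrh hωh => ⟨fun ε hε => ?_, ?_⟩⟩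
  · obtain ⟨c, hc⟩ := h.exists_tendsto_sq_mul_deriv_ω
    exact ⟨-c, h.tendsto_mul_sub hc, h.tendsto_sphaleronicPotential_atTop hinf hc⟩
  · obtain ⟨L, hL⟩ := (StaticEYM.eventually_sqrt_mul_abs_deriv_ω_lt (ωh := ωh) hrh
      hε).exists_forall_of_atTop
    refine ⟨max L 1, lt_max_of_lt_right one_pos, fun B ωinf hB hBrh hω hΛ => ?_⟩
    exact hL (-B.Λ) (by linarith [le_max_left L 1]) B ωinf hB (neg_neg _).symm hBrh hω
  · obtain ⟨c, hc, hev⟩ := StaticEYM.eventually_gravitationalPotential_pos hrh hωh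
    obtain ⟨L, hL⟩ := (hev.and (eventually_exists_isAdSBlackHole ωh hrh)).exists_forall_of_atTop
    refine ⟨max L 1, lt_max_of_lt_right one_pos, fun Λ hΛ => ?_⟩
    obtain ⟨h1, h2⟩ := hL (-Λ) (by linarith [le_max_left L 1])
    rw [neg_neg] at h1 h2
    refine ⟨h2, fun B ωinf hB hBΛ hBrh hω => ?_⟩
    obtain ⟨hωc, hU⟩ := h1 B ωinf hB hBΛ hBrh hω
    -- The uniform margin c > 1/√3 is what keeps the inequality strict in the limit.
    have hinf : c ≤ ωinf := by
      refine ge_of_tendsto hB.ω_lim ?_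
      filter_upwards [eventually_ge_atTop rh] with r hr
      exact hωc r hr
    subst hBrh hBΛ
    have hc0 : 0 < c := lt_trans (by positivity) hc
    have hn : B.Nodeless := fun r hr => (hc0.trans_le (hωc r hr)).ne'
    exact ⟨fun r hr => hc.trans_le (hωc r hr), hc.trans_le hinf, hU,
      hB.tendsto_gravitationalPotential_horizon, hB.tendsto_gravitationalPotential_atTop,
      fun E β hE => hB.not_isBoundState (fun r hr => hB.sphaleronicPotential_pos hr) hE β,
      fun E β hE => hB.not_isBoundState hU hE β,
      hB.sphaleronicallyStable hn (hc0.trans_le hinf).ne', hB.gravitationallyStable hU⟩
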